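/- **Setting.** Let $G$ be a finite connected graph (self-loops and multiple edges allowed) whose edges $e$ are massless propagators with parameters $x_e$, and with external momenta $p_1,\dots,p_K,q_1,\dots,q_N$ attached to its vertices; the momenta sum to zero and are non-exceptional. A spanning 2-tree is a set of edges without loops that, together with all vertices, has exactly two connected components; for a spanning 2-tree $T$, $s_T$ is the square of the external momentum flowing into one of its components. The invariants $p_i^2\neq 0$ are small, and all other squares of partial sums of external momenta that are not zero by momentum conservation, in particular the $q_j^2$ and $(p_k+p_l)^2$ ($k\neq l$), are large ("off-shell"). Put $$\mathcal P(x;\lambda^{w}s)=\mathcal U+\mathcal F=\sum_{T^1}\prod_{e\notin T^1}x_e-\sum_{T^2}\lambda^{w(T^2)}s_{T^2}\prod_{e\notin T^2}x_e ,$$ where $T^1$ runs over the spanning trees and $T^2$ over the spanning 2-trees of $G$, and $w(T^2)=1$ if the momentum flowing between the components of $T^2$ is some $p_i$, $w(T^2)=0$ otherwise. A region $R$ assigns to each edge one of the modes hard, collinear to $p_i$ ($1\le i\le K$), or soft; these are the edges of $H$, $J_i$, $S$. A vertex is in $S$ if it meets soft edges only; it is in $J_i$ if it meets an edge of $J_i$,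 possibly soft edges, and no other edges; otherwise it is in $H$. (Here $q_j$ counts as a hard line and $p_i$ as a line collinear to $p_i$.) It is required that $H$ is connected, with all $q_j$ attached to it; that each connected component of each $J_i$ is attached to $H$; that each $J_i$ with at least one edge has $p_i$ as its only external momentum; and that $S$ has no external momentum and each of its components is attached to $H\cup J$, $J=\bigcup_i J_i$. Let $\mathcal P_0^{(R)}$ be the sum of the terms of $\mathcal P(\lambda^{u}x;\lambda^{w}s)$ with the least power of $\lambda$, at $\lambda=1$, where $u_e=0,-1,-2$ for hard, jet and soft edges. Let $\widetilde J_i$ (resp. $\widetilde S$) be the graph consisting of $J_i$ (resp. $S$) and one auxiliary vertex, to which the vertices of $H$ (resp. $H\cup J$) are contracted, and let $L(\cdot)$ be the number of loops. For a term of $\mathcal P_0^{(R)}$, let $n_H,n_{J_i},n_S$ be the numbers of its parameters $x_e$ with $e$ in $H,J_i,S$. Let $\mathcal U^{(R)}$ and $\mathcal F^{(R)}$ be the sums of the terms of $\mathcal P_0^{(R)}$ that come from $\mathcal U$ and from $\mathcal F$. Let $\mathcal F^{(p_i^2,R)}$ consist of the terms of $\mathcal F^{(R)}$ with factor $p_i^2$.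 Let $\mathcal F_{\mathrm I}^{(q^2,R)}$ consist of those with an off-shell factor and $n_H=L(H)+1$, $\sum_i n_{J_i}=\sum_i L(\widetilde J_i)$, $n_S=L(\widetilde S)$. Let $\mathcal F_{\mathrm{II}}^{(q_{ij}^2,R)}$ consist of those with off-shell factor $q_{ij}^2=(p_i+p_j)^2$ and $n_H=L(H)$, $n_{J_i}=L(\widetilde J_i)+1$, $n_{J_j}=L(\widetilde J_j)+1$, $n_{J_l}=L(\widetilde J_l)$ for $l\ne i,j$, and $n_S=L(\widetilde S)-1$. **Theorem.** For every region $R$, $$\mathcal P_0^{(R)}=\mathcal U^{(R)}+\mathcal F^{(R)},\qquad \mathcal F^{(R)}=\sum_{i=1}^K\mathcal F^{(p_i^2,R)}+\mathcal F_{\mathrm I}^{(q^2,R)}+\sum_{i>j}\mathcal F_{\mathrm{II}}^{(q_{ij}^2,R)},$$ and, for all $i$ in the second formula and all $i>j$ in the fourth, $$\mathcal U^{(R)}=\mathcal U_H\Big(\prod_{i}\mathcal U_{J_i}\Big)\mathcal U_S,\qquad \mathcal F^{(p_i^2,R)}=\mathcal U_H\,\mathcal F_{J_i}^{(p_i^2)}\Big(\prod_{j\ne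 i}\mathcal U_{J_j}\Big)\mathcal U_S,$$ $$\mathcal F_{\mathrm I}^{(q^2,R)}=\mathcal F_{H\cup J}^{(q^2)}\,\mathcal U_S,\qquad \mathcal F_{\mathrm{II}}^{(q_{ij}^2,R)}=\mathcal U_H\,\mathcal F_{J_i\cup J_j\cup S}^{(q_{ij}^2)}\prod_{k\ne i,j}\mathcal U_{J_k}.$$ Here $\mathcal U_H,\mathcal U_{J_i},\mathcal U_S$ are the spanning-tree polynomials $\sum_T\prod_{e\notin T}x_e$ of $H,\widetilde J_i,\widetilde S$, and the other factors are sums of $-s_T\prod_{e\notin T}x_e$ over spanning 2-trees $T$: for $\mathcal F_{J_i}^{(p_i^2)}$, those of $\widetilde J_i$ with momentum $p_i$ flowing between the components; for $\mathcal F_{H\cup J}^{(q^2)}$, those of $H\cup J$ with an off-shell momentum flowing between the components and such that $T\cap H$ is a spanning 2-tree of $H$ and each $T\cap \widetilde J_i$ is a spanning tree of $\widetilde J_i$; for $\mathcal F_{J_i\cup J_j\cup S}^{(q_{ij}^2)}$, those of $J_i\cup J_j\cup S$ together with one auxiliary vertex, to which $H$ and the other jets are contracted, with momentum $p_i+p_j$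 flowing between the components and such that $T\cap\widetilde J_i$ and $T\cap\widetilde J_j$ are spanning 2-trees of $\widetilde J_i$ and $\widetilde J_j$. -/

import Mathlib

namespace WideAngle

open Classical MvPolynomial

/-! ### Connectivity, spanning trees and spanning 2-trees of a multigraph -/

section GraphTheory

variable {α E : Type*}

/-- There is a path (possibly of length zero) from `x` to `y`. -/
def Reachable (Γ : Graph α E) (x y : α) : Prop := Relation.ReflTransGen Γ.Adj x y

/-- `Γ` is nonempty and any two of its vertices are joined by a path. -/
def Connected (Γ : Graph α E) : Prop :=
  Γ.vertexSet.Nonempty ∧ ∀ x ∈ Γ.vertexSet, ∀ y ∈ Γ.vertexSet, Reachable Γ x y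

/-- `Γ` has no loops: the ends of any edge `e` are no longer joined by a path once `e` is deleted.
(In particular there are no self-loops and no multiple edges.) -/
def Acyclic (Γ : Graph α E) : Prop :=
  ∀ e x y, Γ.IsLink e x y → ¬ Reachable (Γ.deleteEdges {e}) x y

/-- The edge set `T` is a spanning tree of `Γ`. -/
def IsSpanningTree (Γ : Graph α E) (T : Finset E) : Prop :=
  (T : Set E) ⊆ Γ.edgeSet ∧ Acyclic (Γ.restrict T) ∧ Connected (Γ.restrict T)

/-- The edge set `T` is a spanning 2-tree of `Γ`: it contains no loop, and with all the vertices
of `Γ` it has exactly two connected components (those of `x` and of `y`). -/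
def IsSpanningTwoTree (Γ : Graph α E) (T : Finset E) : Prop :=
  (T : Set E) ⊆ Γ.edgeSet ∧ Acyclic (Γ.restrict T) ∧
    ∃ x ∈ Γ.vertexSet, ∃ y ∈ Γ.vertexSet, ¬ Reachable (Γ.restrict T) x y ∧
      ∀ z ∈ Γ.vertexSet, Reachable (Γ.restrict T) x z ∨ Reachable (Γ.restrict T) y z

/-- The number of connected components. -/
noncomputable def numComponents (Γ : Graph α E) : ℕ :=
  ((fun x => {y | y ∈ Γ.vertexSet ∧ Reachable Γ x y}) '' Γ.vertexSet).ncard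

/-- The number of (independent) loops of `Γ`, by Euler's formula. -/
noncomputable def loopNumber (Γ : Graph α E) : ℤ :=
  (Γ.edgeSet.ncard : ℤ) - Γ.vertexSet.ncard + numComponents Γ

/-- The contracted graph with edge set `F` and vertex set `W`, together with one auxiliary vertex
`none`, to which all the vertices of `Γ` outside `W` are contracted. -/
noncomputable def contract (Γ : Graph α E) (F : Set E) (W : Set α) : Graph (Option α) E :=
  (Γ.restrict F).map (fun v => if v ∈ W then some v else none)

/-- Where an external line attached to the vertex `v` of `Γ` is attached in
`contract Γ F W`. -/
noncomputable def contractVertex (W : Set α) (v : α) : Option α := if v ∈ W then some v else none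

end GraphTheory

/-! ### External momenta -/

/-- The external lines: `inl i` carries the nearly on-shell momentum `p_i`, and
`inr j` carries the off-shell momentum `q_j`. -/
abbrev Leg (K N : ℕ) := Fin K ⊕ Fin N

section Kinematics

variable {K N : ℕ} {M : Type*} [AddCommGroup M] [Module ℝ M]

/-- The momentum flowing in through the set `I` of external lines is, by momentum conservation,
one of the `± p_i`, so that its square is the small invariant `p_i ^ 2`. -/
def OnShellSet (I : Finset (Leg K N)) : Prop :=
  ∃ i : Fin K, I = {Sum.inl i} ∨ Iᶜ = {Sum.inl i}

/-- The square of the momentum flowing in through `I` is a large invariant: it is neither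
zero by momentum conservation, nor one of the small invariants `p_i ^ 2`. -/
def HardSet (I : Finset (Leg K N)) : Prop :=
  I ≠ ∅ ∧ I ≠ Finset.univ ∧ ¬ OnShellSet I

/-- External momenta of wide-angle scattering. The small invariants are exactly
`p_1 ^ 2, …, p_K ^ 2`; the momenta are otherwise non-exceptional, and the `q_j ^ 2` and
`(p_k + p_l) ^ 2` are large invariants. -/
structure WideAngleMomenta (Q : QuadraticForm ℝ M) (k : Leg K N → M) : Prop where
  conservation : ∑ l, k l = 0
  p_sq_ne_zero : ∀ i : Fin K, Q (k (Sum.inl i)) ≠ 0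
  nonexceptional : ∀ I : Finset (Leg K N), HardSet I → Q (∑ l ∈ I, k l) ≠ 0
  q_sq_large : ∀ j : Fin N, HardSet ({Sum.inr j} : Finset (Leg K N))
  p_mul_p_large : ∀ i j : Fin K, i ≠ j →
    HardSet ({Sum.inl i, Sum.inl j} : Finset (Leg K N))

end Kinematics

/-! ### Polynomials of a graph with external lines

Here `leg` tells at which vertices the external lines are attached. -/

section Polynomials

variable {α E : Type*} [Fintype E] {K N : ℕ} {M : Type*} [AddCommGroup M] [Module ℝ M]

/-- The external lines on the connected component of the vertex `x` in `T`. -/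
noncomputable def legsAt (Γ : Graph α E) (leg : Leg K N → α) (T : Finset E) (x : α) :
    Finset (Leg K N) :=
  Finset.univ.filter (fun l => Reachable (Γ.restrict T) x (leg l))

/-- One of the connected components of `T` carries exactly the external lines in `I`. -/
def Isolates (Γ : Graph α E) (leg : Leg K N → α) (T : Finset E) (I : Finset (Leg K N)) : Prop :=
  ∃ x ∈ Γ.vertexSet, legsAt Γ leg T x = I

/-- The momentum flowing between the components of the spanning 2-tree `T` is `p_i`. -/
def FlowsP (Γ : Graph α E) (leg : Leg K N → α) (T : Finset E) (i : Fin K) : Prop :=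
  Isolates Γ leg T {Sum.inl i}

/-- The momentum flowing between the components of the spanning 2-tree `T` is
`q_ij = p_i + p_j`. -/
def FlowsPP (Γ : Graph α E) (leg : Leg K N → α) (T : Finset E) (i j : Fin K) : Prop :=
  Isolates Γ leg T {Sum.inl i, Sum.inl j}

/-- The momentum flowing between the components of the spanning 2-tree `T` is off-shell. -/
def FlowsHard (Γ : Graph α E) (leg : Leg K N → α) (T : Finset E) : Prop :=
  ∀ x ∈ Γ.vertexSet, HardSet (legsAt Γ leg T x)

/-- `s_T`, the square of the momentum flowing into one of the components of a spanning 2-tree `T`.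
By momentum conservation it does not depend on the component: see `twoTreeInvariant_eq`. -/
noncomputable def twoTreeInvariant (Q : QuadraticForm ℝ M) (k : Leg K N → M)
    (Γ : Graph α E) (leg : Leg K N → α) (T : Finset E) : ℝ :=
  if h : Γ.vertexSet.Nonempty then Q (∑ l ∈ legsAt Γ leg T h.some, k l) else 0

/-- On a spanning 2-tree, by momentum conservation, `s_T` may be computed from any component. -/
theorem twoTreeInvariant_eq (Q : QuadraticForm ℝ M) (k : Leg K N → M) (hk : ∑ l, k l = 0)
    (Γ : Graph α E) (leg : Leg K N → α) (hleg : ∀ l, leg l ∈ Γ.vertexSet) (T : Finset E)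
    (hT : IsSpanningTwoTree Γ T) (x : α) (hx : x ∈ Γ.vertexSet) :
    Q (∑ l ∈ legsAt Γ leg T x, k l) = twoTreeInvariant Q k Γ leg T := by
  have hsymm : ∀ {a b}, Reachable (Γ.restrict T) a b → Reachable (Γ.restrict T) b a := by
    intro a b h
    induction h with
    | refl => exact Relation.ReflTransGen.refl
    | tail _ h ih => exact Relation.ReflTransGen.head h.symm ih
  have htr : ∀ {a b c}, Reachable (Γ.restrict T) a b → Reachable (Γ.restrict T) b c →
      Reachable (Γ.restrict T) a c := fun h h' => Relation.ReflTransGen.trans h h'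
  have hne : Γ.vertexSet.Nonempty := ⟨x, hx⟩
  obtain ⟨-, -, a, ha, b, hb, hab, hall⟩ := hT
  rw [twoTreeInvariant, dif_pos hne]
  have hr : hne.some ∈ Γ.vertexSet := hne.some_mem
  generalize hne.some = r at hr
  by_cases hxr : Reachable (Γ.restrict T) x r
  · congr 2
    ext l
    simp only [legsAt, Finset.mem_filter, Finset.mem_univ, true_and]
    exact ⟨fun h => htr (hsymm hxr) h, fun h => htr hxr h⟩
  · have hc : legsAt Γ leg T x = (legsAt Γ leg T r)ᶜ := by
      ext l
      simp only [legsAt, Finset.mem_filter, Finset.mem_univ, true_and, Finset.mem_compl]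
      refine ⟨fun h h' => hxr (htr h (hsymm h')), fun h => ?_⟩
      rcases hall x hx with h1 | h1 <;> rcases hall r hr with h2 | h2 <;>
        rcases hall (leg l) (hleg l) with h3 | h3
      · exact htr (hsymm h1) h3
      · exact absurd (htr (hsymm h1) h2) hxr
      · exact htr (hsymm h1) h3
      · exact absurd (htr (hsymm h2) h3) h
      · exact absurd (htr (hsymm h2) h3) h
      · exact htr (hsymm h1) h3
      · exact absurd (htr (hsymm h1) h2) hxr
      · exact htr (hsymm h1) h3
    have hs : ∑ l ∈ legsAt Γ leg T x, k l = -∑ l ∈ legsAt Γ leg T r, k l := by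
      rw [hc, eq_neg_iff_add_eq_zero, Finset.sum_compl_add_sum, hk]
    rw [hs, QuadraticMap.map_neg]

/-- The edges of `Γ` that are removed to obtain `T`. -/
noncomputable def removed (Γ : Graph α E) (T : Finset E) : Finset E :=
  Finset.univ.filter (fun e => e ∈ Γ.edgeSet ∧ e ∉ T)

/-- The sum of `∏ x_e`, `e ∉ T`, over the spanning trees `T` of `Γ` with the property `C`. -/
noncomputable def treeSum (Γ : Graph α E) (C : Finset E → Prop) : MvPolynomial E ℝ :=
  ∑ T ∈ Finset.univ.filter (fun T => IsSpanningTree Γ T ∧ C T), ∏ e ∈ removed Γ T, X e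

/-- The sum of `-s_T ∏ x_e`, `e ∉ T`, over the spanning 2-trees `T` of `Γ` with the
property `C`. -/
noncomputable def twoTreeSum (Q : QuadraticForm ℝ M) (k : Leg K N → M) (Γ : Graph α E)
    (leg : Leg K N → α) (C : Finset E → Prop) : MvPolynomial E ℝ :=
  ∑ T ∈ Finset.univ.filter (fun T => IsSpanningTwoTree Γ T ∧ C T),
    MvPolynomial.C (-twoTreeInvariant Q k Γ leg T) * ∏ e ∈ removed Γ T, X e

/-- The spanning tree polynomial (first Symanzik polynomial) of `Γ`. -/
noncomputable def treePoly (Γ : Graph α E) : MvPolynomial E ℝ := treeSum Γ (fun _ => True)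

/-- The power of `λ` by which `s_T` is rescaled: `1` if `s_T` is one of the `p_i ^ 2`, and `0`
otherwise. -/
noncomputable def lamPower (Γ : Graph α E) (leg : Leg K N → α) (T : Finset E) : ℕ :=
  if ∃ i, FlowsP Γ leg T i then 1 else 0

/-- The Lee-Pomeransky polynomial `P(x; λ^w s) = U(x) + F(x; λ^w s)` as a polynomial in `λ` (the
variable `none`) and the `x_e` (the variables `some e`). -/
noncomputable def leePomeransky (Q : QuadraticForm ℝ M) (k : Leg K N → M) (Γ : Graph α E)
    (leg : Leg K N → α) : MvPolynomial (Option E) ℝ :=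
  (∑ T ∈ Finset.univ.filter (fun T => IsSpanningTree Γ T), ∏ e ∈ removed Γ T, X (some e)) +
  ∑ T ∈ Finset.univ.filter (fun T => IsSpanningTwoTree Γ T),
    MvPolynomial.C (-twoTreeInvariant Q k Γ leg T) * X none ^ lamPower Γ leg T *
      ∏ e ∈ removed Γ T, X (some e)

/-- The exponent vector of the monomial `λ ^ n * ∏ x_e`, `e ∉ T`. -/
noncomputable def point (Γ : Graph α E) (T : Finset E) (n : ℕ) : Option E →₀ ℕ :=
  Finsupp.single none n + ∑ e ∈ removed Γ T, Finsupp.single (some e) 1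

end Polynomials

/-! ### Leading parts -/

section Leading

variable {σ : Type*}

/-- The scalar product `r · v`. -/
def pairing (v : σ → ℤ) (r : σ →₀ ℕ) : ℤ := r.sum (fun i n => (n : ℤ) * v i)

/-- The exponent vectors of `P` that minimise `r · v`: those on the face of the Newton polytope of
`P` with inward normal vector `v`. -/
noncomputable def face (v : σ → ℤ) (P : MvPolynomial σ ℝ) : Finset (σ →₀ ℕ) :=
  P.support.filter (fun r => ∀ r' ∈ P.support, pairing v r ≤ pairing v r')

/-- The sum of the terms of `P` whose exponent vectors minimise `r · v`. -/
noncomputable def leadingPart (v : σ → ℤ) (P : MvPolynomial σ ℝ) : MvPolynomial σ ℝ :=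
  ∑ r ∈ face v P, monomial r (coeff r P)

end Leading

/-! ### Scattering graphs and regions -/

/-- A connected graph with external lines attached to its vertices. -/
structure ScatteringGraph (V E : Type*) (K N : ℕ) where
  graph : Graph V E
  leg : Leg K N → V
  connected : Connected graph
  leg_mem : ∀ l, leg l ∈ graph.vertexSet

/-- The possible modes of a propagator: hard, collinear to `p_i`, or soft. -/
inductive Mode (K : ℕ) where
  | hard : Mode K
  | jet (i : Fin K) : Mode K
  | soft : Mode K

section Subgraphs

variable {V E : Type*} {K N : ℕ} (G : ScatteringGraph V E K N) (μ : E → Mode K)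

/-- The edges with the mode `m`: those of `H`, `J_i` or `S`. -/
def edgesOf (m : Mode K) : Set E := {e | e ∈ G.graph.edgeSet ∧ μ e = m}

/-- The edges of `J`, the union of the `J_i`. -/
def jetEdges : Set E := ⋃ i, edgesOf G μ (Mode.jet i)

/-- The vertices of `S`: those that connect to soft edges only. (In this definition and the next,
external lines count: `q_j` is a hard line, and `p_i` is a line collinear to `p_i`.) -/
def softVerts : Set V :=
  {v | v ∈ G.graph.vertexSet ∧ (∃ e, G.graph.Inc e v) ∧
    (∀ e, G.graph.Inc e v → μ e = Mode.soft) ∧ ∀ l, G.leg l ≠ v}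

/-- The vertices of `J_i`: those that connect to at least one edge of `J_i`, possibly to soft
edges, but to no hard line and to no line of another jet. -/
def jetVerts (i : Fin K) : Set V :=
  {v | v ∈ G.graph.vertexSet ∧ (∃ e, G.graph.Inc e v ∧ μ e = Mode.jet i) ∧
    (∀ e, G.graph.Inc e v → μ e = Mode.jet i ∨ μ e = Mode.soft) ∧
    ∀ l, G.leg l = v → l = Sum.inl i}

/-- The vertices of `H`: all the others. -/
def hardVerts : Set V :=
  {v | v ∈ G.graph.vertexSet ∧ v ∉ softVerts G μ ∧ ∀ i, v ∉ jetVerts G μ i}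

/-- The hard subgraph `H`. -/
def hardGraph : Graph V E :=
  (G.graph.restrict (edgesOf G μ Mode.hard)).induce (hardVerts G μ)

/-- The subgraph `H ∪ J`. -/
def hardJetGraph : Graph V E :=
  (G.graph.restrict (edgesOf G μ Mode.hard ∪ jetEdges G μ)).induce
    (hardVerts G μ ∪ ⋃ i, jetVerts G μ i)

/-- The contracted jet graph of `J_i`: the hard vertices to which `J_i` is attached are contracted
to an auxiliary vertex. -/
noncomputable def jetTilde (i : Fin K) : Graph (Option V) E :=
  contract G.graph (edgesOf G μ (Mode.jet i)) (jetVerts G μ i)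

/-- The contracted soft graph: the vertices of `H ∪ J` are contracted to an auxiliary vertex. -/
noncomputable def softTilde : Graph (Option V) E :=
  contract G.graph (edgesOf G μ Mode.soft) (softVerts G μ)

/-- The vertices of `J_i ∪ J_j ∪ S`. -/
def jetPairVerts (i j : Fin K) : Set V :=
  jetVerts G μ i ∪ jetVerts G μ j ∪ softVerts G μ

/-- The graph `J_i ∪ J_j ∪ S`, where the vertices of `H` and of the other jets are contracted to
an auxiliary vertex. -/
noncomputable def jetPairTilde (i j : Fin K) : Graph (Option V) E :=
  contract G.graph
    (edgesOf G μ (Mode.jet i) ∪ edgesOf G μ (Mode.jet j) ∪ edgesOf G μ Mode.soft)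
    (jetPairVerts G μ i j)

/-- The number of edges with the mode `m` that are not in `T`, that is `n_H`, `n_{J_i}`
or `n_S`. -/
noncomputable def nRemoved (m : Mode K) (T : Finset E) : ℤ :=
  ((edgesOf G μ m \ T).ncard : ℤ)

/-- The edges of `T` with the mode `m`. -/
noncomputable def part (m : Mode K) (T : Finset E) : Finset E :=
  T.filter (fun e => e ∈ edgesOf G μ m)

end Subgraphs

/-- A region: every propagator is hard, or collinear to one of the `p_i`, or soft, such that
* the hard subgraph `H` is connected (and by definition, the `q_j` are attached to it),
* each `J_i` that is present is attached to `H` (each component of it is, so that the contracted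
  jet graph is connected) and it has `p_i` as its external momentum (its only one, by definition).

The soft subgraph `S` has no external momenta by definition, and each of its components is
attached to `H ∪ J`, as `G` is connected. It is not required that the region vector is normal
to a facet, and not a face of lower dimension, of the Newton polytope. -/
structure Region {V E : Type*} {K N : ℕ} (G : ScatteringGraph V E K N) where
  mode : E → Mode K
  hard_connected : Connected (hardGraph G mode)
  jet_attached : ∀ i, Connected (jetTilde G mode i)
  jet_external : ∀ i, (edgesOf G mode (Mode.jet i)).Nonempty →
    G.leg (Sum.inl i) ∈ jetVerts G mode i

namespace Region

variable {V E : Type*} [Fintype E] {K N : ℕ} {M : Type*} [AddCommGroup M] [Module ℝ M]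
  {G : ScatteringGraph V E K N} (R : Region G) (Q : QuadraticForm ℝ M) (k : Leg K N → M)

/-- The region vector: `0`, `-1`, `-2` for hard, jet and soft propagators, and `1` for `λ`. -/
def vector : Option E → ℤ
  | none => 1
  | some e => match R.mode e with
    | Mode.hard => 0
    | Mode.jet _ => -1
    | Mode.soft => -2

/-- The leading Lee-Pomeransky polynomial `P_0`: the terms of `P(λ^u x; λ^w s)` with the least
power of `λ`, at `λ = 1`. -/
noncomputable def P0 : MvPolynomial E ℝ :=
  aeval (fun o : Option E => o.elim 1 X)
    (leadingPart R.vector (leePomeransky Q k G.graph G.leg))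

/-- The term `λ ^ n * ∏ x_e`, `e ∉ T`, is a leading one. -/
def IsLeading (T : Finset E) (n : ℕ) : Prop :=
  point G.graph T n ∈ face R.vector (leePomeransky Q k G.graph G.leg)

/-- The term of `F` that belongs to the spanning 2-tree `T` is a leading one. -/
def IsLeadingTwo (T : Finset E) : Prop :=
  R.IsLeading Q k T (lamPower G.graph G.leg T)

/-- The terms of `U` in `P_0`. -/
noncomputable def URegion : MvPolynomial E ℝ :=
  treeSum G.graph (fun T => R.IsLeading Q k T 0)

/-- The terms of `F` in `P_0`. -/
noncomputable def FRegion : MvPolynomial E ℝ :=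
  twoTreeSum Q k G.graph G.leg (fun T => R.IsLeadingTwo Q k T)

/-- The terms of `F` in `P_0` with the kinematic factor `p_i ^ 2`. -/
noncomputable def FpRegion (i : Fin K) : MvPolynomial E ℝ :=
  twoTreeSum Q k G.graph G.leg (fun T => R.IsLeadingTwo Q k T ∧ FlowsP G.graph G.leg T i)

/-- The number of loops of `H`. -/
noncomputable def loopsH : ℤ := loopNumber (hardGraph G R.mode)

/-- The number of loops of the contracted jet graph of `J_i`. -/
noncomputable def loopsJ (i : Fin K) : ℤ := loopNumber (jetTilde G R.mode i)

/-- The number of loops of the contracted soft graph. -/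
noncomputable def loopsS : ℤ := loopNumber (softTilde G R.mode)

/-- The terms of `F` in `P_0` of the first off-shell type: with an off-shell kinematic factor, one
hard parameter more than terms of `U` in `P_0` have, and as many jet and soft ones. -/
noncomputable def FIRegion : MvPolynomial E ℝ :=
  twoTreeSum Q k G.graph G.leg (fun T => R.IsLeadingTwo Q k T ∧ FlowsHard G.graph G.leg T ∧
    nRemoved G R.mode Mode.hard T = R.loopsH + 1 ∧
    ∑ i, nRemoved G R.mode (Mode.jet i) T = ∑ i, R.loopsJ i ∧
    nRemoved G R.mode Mode.soft T = R.loopsS)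

/-- The terms of `F` in `P_0` of the second off-shell type, for the jets `i` and `j`: with an
off-shell kinematic factor `(p_i + p_j) ^ 2`, one soft parameter less than terms of `U` in `P_0`
have, one parameter more of each of the jets `i` and `j`, and as many others. -/
noncomputable def FIIRegion (i j : Fin K) : MvPolynomial E ℝ :=
  twoTreeSum Q k G.graph G.leg (fun T => R.IsLeadingTwo Q k T ∧ FlowsHard G.graph G.leg T ∧
    FlowsPP G.graph G.leg T i j ∧
    nRemoved G R.mode Mode.hard T = R.loopsH ∧
    (∀ l, nRemoved G R.mode (Mode.jet l) T = R.loopsJ l + if l = i ∨ l = j then 1 else 0) ∧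
    nRemoved G R.mode Mode.soft T = R.loopsS - 1)

/-- The spanning tree polynomial of `H`. -/
noncomputable def UH : MvPolynomial E ℝ := treePoly (hardGraph G R.mode)

/-- The spanning tree polynomial of the contracted jet graph of `J_i`. -/
noncomputable def UJ (i : Fin K) : MvPolynomial E ℝ := treePoly (jetTilde G R.mode i)

/-- The spanning tree polynomial of the contracted soft graph. -/
noncomputable def US : MvPolynomial E ℝ := treePoly (softTilde G R.mode)

/-- The spanning 2-tree polynomial of the contracted jet graph of `J_i`, with the momentum `p_i`
flowing between the components. -/
noncomputable def FJ (i : Fin K) : MvPolynomial E ℝ :=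
  twoTreeSum Q k (jetTilde G R.mode i) (fun l => contractVertex (jetVerts G R.mode i) (G.leg l))
    (fun T => FlowsP (jetTilde G R.mode i)
      (fun l => contractVertex (jetVerts G R.mode i) (G.leg l)) T i)

/-- The spanning 2-tree polynomial of `H ∪ J`, with an off-shell momentum flowing between the
components, from the spanning 2-trees that are spanning 2-trees of `H` and spanning trees of the
contracted jet graphs. -/
noncomputable def FHJ : MvPolynomial E ℝ :=
  twoTreeSum Q k (hardJetGraph G R.mode) G.leg
    (fun T => FlowsHard (hardJetGraph G R.mode) G.leg T ∧
      IsSpanningTwoTree (hardGraph G R.mode) (part G R.mode Mode.hard T) ∧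
      ∀ i, IsSpanningTree (jetTilde G R.mode i) (part G R.mode (Mode.jet i) T))

/-- The spanning 2-tree polynomial of `J_i ∪ J_j ∪ S` (with the rest of the graph contracted), with
the momentum `p_i + p_j` flowing between the components, from the spanning 2-trees that are
spanning 2-trees of the contracted jet graphs of `J_i` and `J_j`. -/
noncomputable def FJJS (i j : Fin K) : MvPolynomial E ℝ :=
  twoTreeSum Q k (jetPairTilde G R.mode i j)
    (fun l => contractVertex (jetPairVerts G R.mode i j) (G.leg l))
    (fun T => FlowsPP (jetPairTilde G R.mode i j)
        (fun l => contractVertex (jetPairVerts G R.mode i j) (G.leg l)) T i j ∧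
      IsSpanningTwoTree (jetTilde G R.mode i) (part G R.mode (Mode.jet i) T) ∧
      IsSpanningTwoTree (jetTilde G R.mode j) (part G R.mode (Mode.jet j) T))

end Region

end WideAngle

/-! The power of `λ` of a term of `P` measures how disconnected its forest `T` is in `H` and in `H ∪
J`. Let `d = |V(H)| - 1 - |T ∩ H|` (`hardDeficit`) and `d' = |V(H ∪ J)| - 1 - |T ∩ (H ∪ J)|`
(`hardJetDeficit`). Both are nonnegative, since `d + 1` and `d' + 1` are the numbers of components
of `T` within `H` and within `H ∪ J`. If `T` has `c + 1` components and its kinematic factor carries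
`λ ^ n`, Euler's formula turns the weights `0, -1, -2` into the exponent `minPairing + n + d + d' -
2c` (`pairing_of_card`).

For spanning trees `n = c = 0`, so the exponent is at least `minPairing`, with equality exactly if
`d = d' = 0`. Spanning trees of `H`, of the contracted jet graphs and of the contracted soft graph
combine to such a tree (`exists_leading_tree`).

For 2-trees with `s_T ≠ 0` the same bound says `n + d + d' ≥ 2` (`two_le_deficit`). All external
lines end in `H ∪ J`, so `d' = 0` would put them into one component and make `s_T` vanish; hence `d'
≥ 1`. If `d = 0`, then `H` lies in one component, and a line in the other component is some `p_i`
that ends in its jet. If there is only one such line, then `n = 1`. If there are two, then `H` and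
the two jet ends lie in three components within `H ∪ J`, so `d' ≥ 2`. The leading 2-trees therefore
have `(n, d, d')` equal to `(1, 0, 1)`, `(0, 1, 1)` or `(0, 0, 2)`, which are the terms with `p_i ^
2` and the two off-shell types.

In each case `T` is leading exactly if its parts are spanning trees or 2-trees of the corresponding
subgraphs. This is a matter of counting: edges that join all vertices to `r` representatives number
at least `|V| - r` (`Covers.card_le`), a forest that separates `r` vertices has at most `|V| - r`
edges (`Acyclic.card_le`), and equality in either bound gives the missing half. As these conditions
concern disjoint sets of edges, the sums over `T` factorize (`LocalOn.subsetSum_mul`). Distinct `T`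
have distinct monomials (`eq_of_point_eq`), so no terms cancel. -/

namespace WideAngle

open Classical MvPolynomial

/-! ### Reachability -/

section GraphLemmas

variable {α β E : Type*}

theorem Reachable.refl (Γ : Graph α E) (x : α) : Reachable Γ x x := Relation.ReflTransGen.refl

theorem Reachable.symm {Γ : Graph α E} {x y : α} (h : Reachable Γ x y) : Reachable Γ y x := by
  induction h with
  | refl => exact Relation.ReflTransGen.refl
  | tail _ h ih => exact Relation.ReflTransGen.head h.symm ih

theorem Reachable.trans {Γ : Graph α E} {x y z : α} (h : Reachable Γ x y) (h' : Reachable Γ y z) :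
    Reachable Γ x z := Relation.ReflTransGen.trans h h'

theorem Reachable.of_isLink {Γ : Graph α E} {T : Finset E} {e : E} {x y : α} (he : e ∈ T)
    (h : Γ.IsLink e x y) : Reachable (Γ.restrict T) x y :=
  Relation.ReflTransGen.single ⟨e, by simpa using ⟨he, h⟩⟩

/-- A vertex map under which the ends of each edge remain joined preserves reachability. -/
theorem Reachable.map {Γ : Graph α E} {Δ : Graph β E} {T : Finset E} (f : α → β)
    (hf : ∀ e ∈ T, ∀ x y, Γ.IsLink e x y → Reachable Δ (f x) (f y)) {x y : α}
    (h : Reachable (Γ.restrict T) x y) : Reachable Δ (f x) (f y) := by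
  induction h with
  | refl => exact Relation.ReflTransGen.refl
  | tail _ h ih =>
    obtain ⟨e, he⟩ := h
    rw [Graph.restrict_isLink] at he
    exact ih.trans (hf e he.1 _ _ he.2)

theorem Reachable.mono {Γ : Graph α E} {T T' : Finset E} (hT : T ⊆ T') {x y : α}
    (h : Reachable (Γ.restrict T) x y) : Reachable (Γ.restrict T') x y :=
  h.map id fun _ he _ _ hl => .of_isLink (hT he) hl

theorem Reachable.mem {Γ : Graph α E} {x y : α} (h : Reachable Γ x y) (hx : x ∈ Γ.vertexSet) :
    y ∈ Γ.vertexSet := by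
  induction h with
  | refl => exact hx
  | tail _ h ih => exact h.right_mem

/-- Invariance of a set of vertices along the edges. -/
theorem Reachable.mem_of_closed {Γ : Graph α E} {T : Finset E} {W : Set α}
    (hW : ∀ e ∈ T, ∀ x y, Γ.IsLink e x y → x ∈ W → y ∈ W) {x y : α}
    (h : Reachable (Γ.restrict T) x y) (hx : x ∈ W) : y ∈ W := by
  induction h with
  | refl => exact hx
  | tail _ h ih =>
    obtain ⟨e, he⟩ := h
    rw [Graph.restrict_isLink] at he
    exact hW e he.1 _ _ he.2 ih

theorem restrict_deleteEdges (Γ : Graph α E) (T : Finset E) (e : E) :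
    (Γ.restrict T).deleteEdges {e} = Γ.restrict (T.erase e : Finset E) := by
  refine Graph.ext rfl fun f x y => ?_
  simp only [Graph.deleteEdges_isLink, Graph.restrict_isLink, Finset.coe_erase]
  simp
  tauto

theorem acyclic_restrict_iff {Γ : Graph α E} {T : Finset E} :
    Acyclic (Γ.restrict T) ↔
      ∀ e ∈ T, ∀ x y, Γ.IsLink e x y → ¬ Reachable (Γ.restrict (T.erase e : Finset E)) x y := by
  simp only [Acyclic, restrict_deleteEdges, Graph.restrict_isLink, Finset.mem_coe]
  exact ⟨fun h e he x y hl => h e x y ⟨he, hl⟩, fun h e x y hl => h e hl.1 x y hl.2⟩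

theorem Acyclic.mono {Γ : Graph α E} {T T' : Finset E} (hT : T ⊆ T')
    (h : Acyclic (Γ.restrict T')) : Acyclic (Γ.restrict T) := by
  rw [acyclic_restrict_iff] at *
  exact fun e he x y hl hr => h e (hT he) x y hl (hr.mono (Finset.erase_subset_erase e hT))

/-- Acyclicity passes to subgraphs. -/
theorem Acyclic.of_isLink {Γ Δ : Graph α E} {T T' : Finset E} (hT : T' ⊆ T)
    (hΔ : ∀ e x y, Δ.IsLink e x y → Γ.IsLink e x y) (h : Acyclic (Γ.restrict T)) :
    Acyclic (Δ.restrict T') := by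
  rw [acyclic_restrict_iff] at *
  refine fun e he x y hl hr => h e (hT he) x y (hΔ _ _ _ hl) (hr.map id fun f hf u v huv => ?_)
  exact .of_isLink (Finset.erase_subset_erase e hT hf) (hΔ _ _ _ huv)

/-- Deleting the edge `e` from `T` keeps a vertex joined to at least one of its former partner and
the ends of `e`. -/
theorem Reachable.erase {Γ : Graph α E} {T : Finset E} {e : E} {a b x y : α}
    (hab : Γ.IsLink e a b) (h : Reachable (Γ.restrict T) x y) :
    Reachable (Γ.restrict (T.erase e : Finset E)) x y ∨
      Reachable (Γ.restrict (T.erase e : Finset E)) a y ∨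
      Reachable (Γ.restrict (T.erase e : Finset E)) b y := by
  induction h with
  | refl => exact Or.inl (Reachable.refl _ _)
  | @tail c d _ h ih =>
    obtain ⟨f, hf⟩ := h
    rw [Graph.restrict_isLink] at hf
    by_cases hfe : f = e
    · subst hfe
      obtain ⟨rfl, rfl⟩ | ⟨rfl, rfl⟩ := hab.eq_and_eq_or_eq_and_eq hf.2
      · exact Or.inr (Or.inr (Reachable.refl _ _))
      · exact Or.inr (Or.inl (Reachable.refl _ _))
    · have hs : Reachable (Γ.restrict (T.erase e : Finset E)) c d :=
        .of_isLink (Finset.mem_erase.2 ⟨hfe, hf.1⟩) hf.2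
      exact ih.imp (·.trans hs) (Or.imp (·.trans hs) (·.trans hs))

/-! ### Edge counts of covering sets and of forests -/

/-- Every vertex of `Γ` is joined to an element of `X` by edges of `T`. -/
def Covers (Γ : Graph α E) (T : Finset E) (X : Finset α) : Prop :=
  ∀ v ∈ Γ.vertexSet, ∃ x ∈ X, Reachable (Γ.restrict T) x v

/-- An edge merges at most two components. By induction, the loss of `e` is compensated by adding
one suitable vertex to `X`. -/
theorem Covers.card_le [Finite α] {Γ : Graph α E} {T : Finset E} {X : Finset α}
    (hT : (T : Set E) ⊆ Γ.edgeSet) (h : Covers Γ T X) : Γ.vertexSet.ncard ≤ T.card + X.card := by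
  induction T using Finset.induction_on generalizing X with
  | empty =>
    have : Γ.vertexSet ⊆ (X : Set α) := by
      intro v hv
      obtain ⟨x, hx, hr⟩ := h v hv
      have : x = v := by
        refine Reachable.mem_of_closed (W := {w | x = w}) ?_ hr rfl
        simp
      exact this ▸ hx
    simpa using Set.ncard_le_ncard this
  | @insert e T he ih =>
    obtain ⟨a, b, hab⟩ := Graph.exists_isLink_of_mem_edgeSet (hT (by simp : e ∈ _))
    have hE : (insert e T).erase e = T := Finset.erase_insert he
    have hT' : (T : Set E) ⊆ Γ.edgeSet := fun f hf => hT (by simp [Finset.mem_coe.1 hf])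
    have key : ∃ c, Covers Γ T (insert c X) := by
      have hc : ∀ v ∈ Γ.vertexSet, ∃ x ∈ X, Reachable (Γ.restrict T) x v ∨
          Reachable (Γ.restrict T) a v ∨ Reachable (Γ.restrict T) b v := fun v hv => by
        obtain ⟨x, hx, hr⟩ := h v hv
        exact ⟨x, hx, hE ▸ hr.erase hab⟩
      -- If `X` reaches one end of `e` without using `e`, the other end is the vertex to add. If it
      -- reaches neither end, no path from `X` uses `e`, and `a` serves only as an arbitrary choice.
      by_cases hx : ∃ x ∈ X, Reachable (Γ.restrict T) x a
      · obtain ⟨x, hx, hxa⟩ := hx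
        refine ⟨b, fun v hv => ?_⟩
        obtain ⟨y, hy, h1 | h1 | h1⟩ := hc v hv
        · exact ⟨y, by simp [hy], h1⟩
        · exact ⟨x, by simp [hx], hxa.trans h1⟩
        · exact ⟨b, by simp, h1⟩
      · by_cases hb : ∃ x ∈ X, Reachable (Γ.restrict T) x b
        · obtain ⟨x, hx, hxb⟩ := hb
          refine ⟨a, fun v hv => ?_⟩
          obtain ⟨y, hy, h1 | h1 | h1⟩ := hc v hv
          · exact ⟨y, by simp [hy], h1⟩
          · exact ⟨a, by simp, h1⟩
          · exact ⟨x, by simp [hx], hxb.trans h1⟩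
        · refine ⟨a, fun v hv => ?_⟩
          obtain ⟨y, hy, hyv⟩ := h v hv
          obtain ⟨z, hz, hzv⟩ := Reachable.mem_of_closed
            (W := {w | ∃ x ∈ X, Reachable (Γ.restrict T) x w})
            (by
              rintro f hf u w huw ⟨z, hz, hzu⟩
              by_cases hfe : f = e
              · subst hfe
                obtain ⟨rfl, rfl⟩ | ⟨rfl, rfl⟩ := hab.eq_and_eq_or_eq_and_eq huw
                · exact absurd ⟨z, hz, hzu⟩ hx
                · exact absurd ⟨z, hz, hzu⟩ hb
              · exact ⟨z, hz, hzu.trans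
                  (.of_isLink ((Finset.mem_insert.1 hf).resolve_left hfe) huw)⟩)
            hyv ⟨y, hy, Reachable.refl _ _⟩
          exact ⟨z, by simp [hz], hzv⟩
    obtain ⟨c, hc⟩ := key
    have h1 := ih hT' hc
    have h2 := Finset.card_insert_le c X
    rw [Finset.card_insert_of_notMem he]
    omega

/-- If `X` covers and the cardinalities match, then `T` has no loops. -/
theorem Covers.acyclic [Finite α] {Γ : Graph α E} {T : Finset E} {X : Finset α}
    (hT : (T : Set E) ⊆ Γ.edgeSet) (h : Covers Γ T X)
    (hc : Γ.vertexSet.ncard = T.card + X.card) : Acyclic (Γ.restrict T) := by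
  rw [acyclic_restrict_iff]
  intro e he a b hab hr
  have hcov : Covers Γ (T.erase e) X := by
    intro v hv
    obtain ⟨x, hx, hxv⟩ := h v hv
    refine ⟨x, hx, hxv.map id fun f hf u w huw => ?_⟩
    by_cases hfe : f = e
    · subst hfe
      obtain ⟨rfl, rfl⟩ | ⟨rfl, rfl⟩ := hab.eq_and_eq_or_eq_and_eq huw
      · exact hr
      · exact hr.symm
    · exact .of_isLink (Finset.mem_erase.2 ⟨hfe, hf⟩) huw
  have h1 := hcov.card_le (fun f hf => hT (Finset.mem_of_mem_erase (Finset.mem_coe.1 hf)))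
  have h2 := Finset.card_erase_lt_of_mem he
  omega

/-- If `X` covers and the cardinalities match, then distinct elements of `X` are not joined. -/
theorem Covers.eq_of_reachable [Finite α] {Γ : Graph α E} {T : Finset E} {X : Finset α}
    (hT : (T : Set E) ⊆ Γ.edgeSet) (h : Covers Γ T X)
    (hc : Γ.vertexSet.ncard = T.card + X.card) {x y : α} (hx : x ∈ X) (hy : y ∈ X)
    (hr : Reachable (Γ.restrict T) x y) : x = y := by
  by_contra hne
  have hcov : Covers Γ T (X.erase y) := by
    intro v hv
    obtain ⟨z, hz, hzv⟩ := h v hv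
    by_cases hzy : z = y
    · exact ⟨x, Finset.mem_erase.2 ⟨hne, hx⟩, hr.trans (hzy ▸ hzv)⟩
    · exact ⟨z, Finset.mem_erase.2 ⟨hzy, hz⟩, hzv⟩
  have h1 := hcov.card_le hT
  have h2 := Finset.card_erase_lt_of_mem hy
  omega

/-- The opposite bound, for forests: deleting an edge splits a component, and at least one of its
two ends is then separated from all of `X` and may be added to `X`. -/
theorem Acyclic.card_le [Finite α] {Γ : Graph α E} {T : Finset E} {X : Finset α}
    (hT : (T : Set E) ⊆ Γ.edgeSet) (h : Acyclic (Γ.restrict T)) (hX : (X : Set α) ⊆ Γ.vertexSet)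
    (hne : ∀ x ∈ X, ∀ y ∈ X, Reachable (Γ.restrict T) x y → x = y) :
    T.card + X.card ≤ Γ.vertexSet.ncard := by
  induction T using Finset.induction_on generalizing X with
  | empty => simpa using Set.ncard_le_ncard hX
  | @insert e T he ih =>
    obtain ⟨a, b, hab⟩ := Graph.exists_isLink_of_mem_edgeSet (hT (by simp : e ∈ _))
    have hE : (insert e T).erase e = T := Finset.erase_insert he
    have hT' : (T : Set E) ⊆ Γ.edgeSet := fun f hf => hT (by simp [Finset.mem_coe.1 hf])
    have hsub : T ⊆ insert e T := Finset.subset_insert _ _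
    have hnab : ¬ Reachable (Γ.restrict T) a b := by
      simpa only [hE] using acyclic_restrict_iff.1 h e (by simp) a b hab
    have hrab : Reachable (Γ.restrict (insert e T : Finset E)) a b := .of_isLink (by simp) hab
    have key : ∃ c ∈ Γ.vertexSet, ∀ x ∈ X, ¬ Reachable (Γ.restrict T) x c := by
      by_cases hx : ∃ x ∈ X, Reachable (Γ.restrict T) x a
      · obtain ⟨x, hx, hxa⟩ := hx
        refine ⟨b, hab.right_mem, fun y hy hyb => ?_⟩
        have hxy : x = y :=
          hne x hx y hy (((hxa.mono hsub).trans hrab).trans (hyb.mono hsub).symm)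
        exact hnab (hxa.symm.trans (hxy ▸ hyb))
      · exact ⟨a, hab.left_mem, fun y hy hya => hx ⟨y, hy, hya⟩⟩
    obtain ⟨c, hc, hXc⟩ := key
    have hcX : c ∉ X := fun hcX => hXc c hcX (Reachable.refl _ _)
    have h1 := ih (X := insert c X) hT' (h.mono hsub)
      (by
        intro v hv
        rw [Finset.mem_coe, Finset.mem_insert] at hv
        exact hv.elim (· ▸ hc) (fun hv => hX hv))
      (by
        intro x hx y hy hr
        rw [Finset.mem_insert] at hx hy
        rcases hx with rfl | hx <;> rcases hy with rfl | hy
        · rfl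
        · exact absurd hr.symm (hXc y hy)
        · exact absurd hr (hXc x hx)
        · exact hne x hx y hy (hr.mono hsub))
    rw [Finset.card_insert_of_notMem hcX] at h1
    rw [Finset.card_insert_of_notMem he]
    omega

theorem eq_of_reachable_pair {Γ : Graph α E} {x y : α} (h : ¬ Reachable Γ x y) :
    ({x, y} : Finset α).card = 2 ∧
      ∀ u ∈ ({x, y} : Finset α), ∀ v ∈ ({x, y} : Finset α), Reachable Γ u v → u = v := by
  refine ⟨Finset.card_pair fun e => h (e ▸ Reachable.refl _ _), fun u hu v hv hr => ?_⟩
  simp only [Finset.mem_insert, Finset.mem_singleton] at hu hv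
  rcases hu with rfl | rfl <;> rcases hv with rfl | rfl
  · rfl
  · exact absurd hr h
  · exact absurd hr.symm h
  · rfl

theorem coe_pair_subset {W : Set α} {x y : α} (hx : x ∈ W) (hy : y ∈ W) :
    (({x, y} : Finset α) : Set α) ⊆ W := by
  rw [Finset.coe_pair]
  exact Set.pair_subset hx hy

/-! ### Criteria for spanning trees and spanning 2-trees -/

variable {Γ : Graph α E} {T : Finset E}

/-- Once the number of edges is right, connectedness excludes loops; `isSpanningTree_of_acyclic` is
the converse. The version with coverings is the one suited to contracted graphs, because contraction
preserves paths but may close loops. -/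
theorem isSpanningTree_of_covers [Finite α] {x : α} (hT : (T : Set E) ⊆ Γ.edgeSet) (hx : x ∈ Γ.vertexSet)
    (h : Covers Γ T {x}) (hc : Γ.vertexSet.ncard = T.card + 1) : IsSpanningTree Γ T := by
  refine ⟨hT, h.acyclic hT (by simpa using hc), ⟨x, hx⟩, fun u hu v hv => ?_⟩
  obtain ⟨y, hy, hyu⟩ := h u hu
  obtain ⟨z, hz, hzv⟩ := h v hv
  rw [Finset.mem_singleton] at hy hz
  subst hy hz
  exact hyu.symm.trans hzv

theorem IsSpanningTree.reachable (h : IsSpanningTree Γ T) {x y : α} (hx : x ∈ Γ.vertexSet)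
    (hy : y ∈ Γ.vertexSet) : Reachable (Γ.restrict T) x y := h.2.2.2 x hx y hy

theorem IsSpanningTree.card [Finite α] (h : IsSpanningTree Γ T) : Γ.vertexSet.ncard = T.card + 1 := by
  obtain ⟨hT, hac, ⟨x, hx⟩, hcon⟩ := h
  have h1 : Covers Γ T {x} := fun v hv => ⟨x, by simp, hcon x hx v hv⟩
  have h2 := h1.card_le hT
  have h3 := hac.card_le (X := {x}) hT (by simpa using hx) (by simp)
  simp only [Finset.card_singleton] at h2 h3
  omega

/-- That `x` and `y` are separated need not be assumed: with `|V| - 2` edges, fewer than two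
representatives cannot cover. -/
theorem isSpanningTwoTree_of_covers [Finite α] {x y : α} (hT : (T : Set E) ⊆ Γ.edgeSet)
    (hx : x ∈ Γ.vertexSet) (hy : y ∈ Γ.vertexSet)
    (h : Covers Γ T {x, y}) (hc : Γ.vertexSet.ncard = T.card + 2) :
    IsSpanningTwoTree Γ T ∧ ¬ Reachable (Γ.restrict T) x y := by
  have hcard : ({x, y} : Finset α).card = 2 := by
    have h1 := h.card_le hT
    have h2 := Finset.card_le_two (a := x) (b := y)
    omega
  have hxy : x ≠ y := by
    rintro rfl
    simp at hcard
  have hn : ¬ Reachable (Γ.restrict T) x y := fun hr =>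
    hxy (h.eq_of_reachable hT (by omega) (by simp) (by simp) hr)
  refine ⟨⟨hT, h.acyclic hT (by omega), x, hx, y, hy, hn, fun z hz => ?_⟩, hn⟩
  obtain ⟨w, hw, hr⟩ := h z hz
  simp only [Finset.mem_insert, Finset.mem_singleton] at hw
  rcases hw with rfl | rfl
  · exact Or.inl hr
  · exact Or.inr hr

theorem IsSpanningTwoTree.card [Finite α] (h : IsSpanningTwoTree Γ T) : Γ.vertexSet.ncard = T.card + 2 := by
  obtain ⟨hT, hac, x, hx, y, hy, hxy, hall⟩ := h
  have h1 : Covers Γ T {x, y} := fun v hv => by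
    rcases hall v hv with h | h
    · exact ⟨x, by simp, h⟩
    · exact ⟨y, by simp, h⟩
  have h2 := h1.card_le hT
  obtain ⟨hc, hp⟩ := eq_of_reachable_pair hxy
  have h3 := hac.card_le hT (coe_pair_subset hx hy) hp
  omega

/-- In a spanning 2-tree, of any two vertices that are not joined one is joined to any given
vertex. -/
theorem IsSpanningTwoTree.reachable_or (h : IsSpanningTwoTree Γ T) {x y z : α}
    (hx : x ∈ Γ.vertexSet) (hy : y ∈ Γ.vertexSet) (hz : z ∈ Γ.vertexSet)
    (hxy : ¬ Reachable (Γ.restrict T) x y) :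
    Reachable (Γ.restrict T) x z ∨ Reachable (Γ.restrict T) y z := by
  obtain ⟨-, -, a, ha, b, hb, hab, hall⟩ := h
  rcases hall x hx with h1 | h1 <;> rcases hall y hy with h2 | h2 <;>
    rcases hall z hz with h3 | h3
  · exact absurd (h1.symm.trans h2) hxy
  · exact absurd (h1.symm.trans h2) hxy
  · exact Or.inl (h1.symm.trans h3)
  · exact Or.inr (h2.symm.trans h3)
  · exact Or.inr (h2.symm.trans h3)
  · exact Or.inl (h1.symm.trans h3)
  · exact absurd (h1.symm.trans h2) hxy
  · exact absurd (h1.symm.trans h2) hxy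

theorem IsSpanningTwoTree.exists_not_reachable (h : IsSpanningTwoTree Γ T) (x : α) : ∃ y ∈ Γ.vertexSet, ¬ Reachable (Γ.restrict T) x y := by
  obtain ⟨-, -, a, ha, b, hb, hab, hall⟩ := h
  by_contra! hcon
  exact hab ((hcon a ha).symm.trans (hcon b hb))

theorem isSpanningTree_of_acyclic [Finite α] {x : α} (hT : (T : Set E) ⊆ Γ.edgeSet)
    (hac : Acyclic (Γ.restrict T)) (hx : x ∈ Γ.vertexSet)
    (hc : Γ.vertexSet.ncard = T.card + 1) : IsSpanningTree Γ T := by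
  refine isSpanningTree_of_covers hT hx (fun v hv => ⟨x, by simp, ?_⟩) hc
  by_contra hr
  obtain ⟨hc', hp⟩ := eq_of_reachable_pair hr
  have h3 := hac.card_le hT (coe_pair_subset hx hv) hp
  omega

/-- In a forest with as many components as `X` has elements, no two of them joined, `X` covers. -/
theorem Acyclic.covers [Finite α] {X : Finset α} (hT : (T : Set E) ⊆ Γ.edgeSet)
    (hac : Acyclic (Γ.restrict T)) (hX : (X : Set α) ⊆ Γ.vertexSet)
    (hne : ∀ x ∈ X, ∀ y ∈ X, Reachable (Γ.restrict T) x y → x = y)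
    (hc : Γ.vertexSet.ncard = T.card + X.card) : Covers Γ T X := by
  intro v hv
  by_contra! hcon
  have hvX : v ∉ X := fun h => hcon v h (Reachable.refl _ _)
  have h3 := hac.card_le (X := insert v X) hT
    (by
      intro w hw
      rw [Finset.mem_coe, Finset.mem_insert] at hw
      exact hw.elim (· ▸ hv) (fun hw => hX hw))
    (by
      intro u hu w hw hr
      rw [Finset.mem_insert] at hu hw
      rcases hu with rfl | hu <;> rcases hw with rfl | hw
      · rfl
      · exact absurd hr.symm (hcon w hw)
      · exact absurd hr (hcon u hu)
      · exact hne u hu w hw hr)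
  rw [Finset.card_insert_of_notMem hvX] at h3
  omega

/-- One vertex cannot cover with `|V| - 2` edges, so two vertices are separated; a third component
would violate the bound for forests. -/
theorem isSpanningTwoTree_of_acyclic [Finite α] (hT : (T : Set E) ⊆ Γ.edgeSet)
    (hac : Acyclic (Γ.restrict T)) (hc : Γ.vertexSet.ncard = T.card + 2) :
    IsSpanningTwoTree Γ T := by
  have hV : Γ.vertexSet.Nonempty := by
    rw [← Set.ncard_pos]
    omega
  obtain ⟨x, hx⟩ := hV
  have h1 : ∃ y ∈ Γ.vertexSet, ¬ Reachable (Γ.restrict T) x y := by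
    by_contra! hcon
    have h2 : Covers Γ T {x} := fun v hv => ⟨x, by simp, hcon v hv⟩
    have h3 := h2.card_le hT
    rw [Finset.card_singleton] at h3
    omega
  obtain ⟨y, hy, hxy⟩ := h1
  obtain ⟨hc', hp⟩ := eq_of_reachable_pair hxy
  exact (isSpanningTwoTree_of_covers hT hx hy
    (hac.covers hT (coe_pair_subset hx hy) hp (hc.trans (by rw [hc']))) hc).1

/-- A connected graph has a spanning tree. -/
theorem Connected.exists_isSpanningTree [Finite α] [Finite E] (h : Connected Γ) :
    ∃ T : Finset E, IsSpanningTree Γ T := by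
  obtain ⟨⟨x, hx⟩, hcon⟩ := h
  have hfin : Γ.edgeSet.Finite := Set.toFinite _
  have hne : ∃ T : Finset E, (T : Set E) ⊆ Γ.edgeSet ∧ Covers Γ T {x} := by
    refine ⟨hfin.toFinset, by simp, fun v hv => ⟨x, by simp, ?_⟩⟩
    rw [hfin.coe_toFinset, Graph.restrict_self]
    exact hcon x hx v hv
  -- A covering edge set with the fewest edges has no loop, since an edge whose ends remain joined
  -- without it could be dropped.
  obtain ⟨T, ⟨hT, hcov⟩, hmin⟩ := (WellFounded.has_min (measure (Finset.card (α := E))).wf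
    {T : Finset E | (T : Set E) ⊆ Γ.edgeSet ∧ Covers Γ T {x}} hne)
  refine ⟨T, isSpanningTree_of_acyclic hT ?_ hx ?_⟩
  all_goals
    have hac : Acyclic (Γ.restrict T) := by
      rw [acyclic_restrict_iff]
      intro e he a b hab hr
      refine hmin (T.erase e) ⟨fun f hf => hT (Finset.mem_of_mem_erase (Finset.mem_coe.1 hf)), ?_⟩
        (Finset.card_erase_lt_of_mem he)
      intro v hv
      obtain ⟨y, hy, hyv⟩ := hcov v hv
      refine ⟨y, hy, hyv.map id fun f hf u w huw => ?_⟩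
      by_cases hfe : f = e
      · subst hfe
        obtain ⟨rfl, rfl⟩ | ⟨rfl, rfl⟩ := hab.eq_and_eq_or_eq_and_eq huw
        · exact hr
        · exact hr.symm
      · exact .of_isLink (Finset.mem_erase.2 ⟨hfe, hf⟩) huw
  · exact hac
  · have h2 := hcov.card_le hT
    have h3 := hac.card_le (X := {x}) hT (by simpa using hx) (by simp)
    rw [Finset.card_singleton] at h2 h3
    omega

theorem Connected.numComponents_eq (h : Connected Γ) : numComponents Γ = 1 := by
  obtain ⟨⟨x, hx⟩, hcon⟩ := h
  rw [numComponents, Set.ncard_eq_one]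
  refine ⟨Γ.vertexSet, Set.eq_singleton_iff_nonempty_unique_mem.2 ⟨⟨_, x, hx, rfl⟩, ?_⟩⟩
  rintro _ ⟨y, hy, rfl⟩
  ext z
  exact ⟨fun h => h.1, fun hz => ⟨hz, hcon y hy z hz⟩⟩

end GraphLemmas

/-! ### Contracted graphs -/

section Contract

variable {α E : Type*} {Γ : Graph α E} {F : Set E} {W : Set α}

theorem contractVertex_of_mem {v : α} (h : v ∈ W) : contractVertex W v = some v := if_pos h

theorem contractVertex_of_notMem {v : α} (h : v ∉ W) : contractVertex W v = none := if_neg h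

theorem contractVertex_eq_none {v : α} : contractVertex W v = none ↔ v ∉ W := by
  unfold contractVertex
  split_ifs with h <;> simp [h]

theorem contractVertex_eq_some {v w : α} : contractVertex W v = some w ↔ v ∈ W ∧ v = w := by
  unfold contractVertex
  split_ifs with h <;> simp [h]

theorem contract_vertexSet : (contract Γ F W).vertexSet = contractVertex W '' Γ.vertexSet := rfl

theorem contract_isLink_iff {e : E} {x y : Option α} : (contract Γ F W).IsLink e x y ↔
    ∃ u v, e ∈ F ∧ Γ.IsLink e u v ∧ contractVertex W u = x ∧ contractVertex W v = y := by
  simp only [contract, Graph.map_isLink, Relation.Map, Graph.restrict_isLink, contractVertex]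
  constructor
  · rintro ⟨u, v, ⟨h1, h2⟩, h3, h4⟩; exact ⟨u, v, h1, h2, h3, h4⟩
  · rintro ⟨u, v, h1, h2, h3, h4⟩; exact ⟨u, v, ⟨h1, h2⟩, h3, h4⟩

theorem contract_isLink {e : E} {u v : α} (he : e ∈ F) (h : Γ.IsLink e u v) :
    (contract Γ F W).IsLink e (contractVertex W u) (contractVertex W v) :=
  contract_isLink_iff.2 ⟨u, v, he, h, rfl, rfl⟩

/-- A path of the contracted graph can be lifted until it arrives at the auxiliary vertex. -/
theorem Reachable.lift_contract {T : Finset E} {v : α} {z : Option α}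
    (h : Reachable ((contract Γ F W).restrict T) (contractVertex W v) z) :
    (∃ u, u ∉ W ∧ Reachable (Γ.restrict T) v u) ∨
      ∃ u ∈ W, z = some u ∧ Reachable (Γ.restrict T) v u := by
  by_cases hv : v ∈ W
  swap
  · exact Or.inl ⟨v, hv, Reachable.refl _ _⟩
  rw [contractVertex_of_mem hv] at h
  induction h with
  | refl => exact Or.inr ⟨v, hv, rfl, Reachable.refl _ _⟩
  | tail _ h ih =>
    obtain ih | ⟨u, hu, rfl, hr⟩ := ih
    · exact Or.inl ih
    obtain ⟨e, he⟩ := h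
    rw [Graph.restrict_isLink, contract_isLink_iff] at he
    obtain ⟨heT, a, b, -, hab, ha, hb⟩ := he
    obtain ⟨-, rfl⟩ := contractVertex_eq_some.1 ha
    have hr' := hr.trans (.of_isLink heT hab)
    by_cases hbW : b ∈ W
    · exact Or.inr ⟨b, hbW, by rw [← hb, contractVertex_of_mem hbW], hr'⟩
    · exact Or.inl ⟨b, hbW, hr'⟩

theorem Reachable.lift_contract_none {T : Finset E} {v : α}
    (h : Reachable ((contract Γ F W).restrict T) (contractVertex W v) none) :
    ∃ u, u ∉ W ∧ Reachable (Γ.restrict T) v u := by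
  obtain h | ⟨u, -, h, -⟩ := h.lift_contract
  · exact h
  · simp at h

/-- A set of edges that maps to the contracted graph, up to edges that are contracted. -/
theorem Reachable.contract {T T' : Finset E}
    (hT : ∀ e ∈ T, ∀ x y, Γ.IsLink e x y → (e ∈ F ∧ e ∈ T') ∨ (x ∉ W ∧ y ∉ W)) {x y : α}
    (h : Reachable (Γ.restrict T) x y) :
    Reachable ((contract Γ F W).restrict T') (contractVertex W x) (contractVertex W y) := by
  refine h.map (contractVertex W) fun e he x y hl => ?_
  obtain ⟨h1, h2⟩ | ⟨h1, h2⟩ := hT e he x y hl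
  · exact .of_isLink h2 (contract_isLink h1 hl)
  · rw [contractVertex_of_notMem h1, contractVertex_of_notMem h2]
    exact Reachable.refl _ _

/-- The extra `1` is the auxiliary vertex. It belongs to the image only if some vertex lies outside
`W`; in a region, `H` provides one. -/
theorem contract_vertexSet_ncard [Finite α] (hW : W ⊆ Γ.vertexSet) (hne : ∃ v ∈ Γ.vertexSet, v ∉ W) :
    (contract Γ F W).vertexSet.ncard = W.ncard + 1 := by
  have h1 : (contract Γ F W).vertexSet = insert none (some '' W) := by
    rw [contract_vertexSet]
    ext z
    constructor
    · rintro ⟨v, hv, rfl⟩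
      by_cases h : v ∈ W
      · rw [contractVertex_of_mem h]; exact Or.inr ⟨v, h, rfl⟩
      · rw [contractVertex_of_notMem h]; exact Or.inl rfl
    · rintro (rfl | ⟨v, hv, rfl⟩)
      · obtain ⟨v, hv, h⟩ := hne
        exact ⟨v, hv, contractVertex_of_notMem h⟩
      · exact ⟨v, hW hv, contractVertex_of_mem hv⟩
  rw [h1, Set.ncard_insert_of_notMem (by simp), Set.ncard_image_of_injective _ (Option.some_injective _)]

end Contract

/-! ### The subgraphs of a region -/

section SubgraphLemmas

variable {V E : Type*} {K N : ℕ} {G : ScatteringGraph V E K N} {μ : E → Mode K}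

theorem mem_jetEdges {e : E} : e ∈ jetEdges G μ ↔ ∃ i, e ∈ edgesOf G μ (Mode.jet i) := by
  simp [jetEdges]

theorem softVerts_subset : softVerts G μ ⊆ G.graph.vertexSet := fun _ h => h.1

theorem jetVerts_subset (i : Fin K) : jetVerts G μ i ⊆ G.graph.vertexSet := fun _ h => h.1

theorem mem_verts_cases {v : V} (hv : v ∈ G.graph.vertexSet) :
    v ∈ hardVerts G μ ∨ (∃ i, v ∈ jetVerts G μ i) ∨ v ∈ softVerts G μ := by
  by_cases h1 : v ∈ softVerts G μ
  · exact Or.inr (Or.inr h1)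
  by_cases h2 : ∃ i, v ∈ jetVerts G μ i
  · exact Or.inr (Or.inl h2)
  · exact Or.inl ⟨hv, h1, fun i hi => h2 ⟨i, hi⟩⟩

theorem mode_of_jetVerts {v w : V} {e : E} {i : Fin K} (hv : v ∈ jetVerts G μ i)
    (h : G.graph.IsLink e v w) : μ e = Mode.jet i ∨ μ e = Mode.soft := hv.2.2.1 e h.inc_left

theorem mode_of_softVerts {v w : V} {e : E} (hv : v ∈ softVerts G μ)
    (h : G.graph.IsLink e v w) : μ e = Mode.soft := hv.2.2.1 e h.inc_left

theorem jetVerts_unique {v : V} {i j : Fin K} (hi : v ∈ jetVerts G μ i)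
    (hj : v ∈ jetVerts G μ j) : i = j := by
  obtain ⟨e, he, hm⟩ := hi.2.1
  rcases hj.2.2.1 e he with h | h
  · simpa [hm] using h
  · simp [hm] at h

theorem notMem_softVerts_of_jetVerts {v : V} {i : Fin K} (hi : v ∈ jetVerts G μ i) :
    v ∉ softVerts G μ := fun hs => by
  obtain ⟨e, he, hm⟩ := hi.2.1
  simpa [hm] using hs.2.2.1 e he

theorem notMem_jetVerts_of_hardVerts {v : V} (h : v ∈ hardVerts G μ) (i : Fin K) :
    v ∉ jetVerts G μ i := h.2.2 i

theorem notMem_softVerts_of_hardVerts {v : V} (h : v ∈ hardVerts G μ) :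
    v ∉ softVerts G μ := h.2.1

/-- A vertex of a jet or of `S` meets no hard edge. -/
theorem mem_hardVerts_of_hard {e : E} {v w : V} (h : G.graph.IsLink e v w)
    (he : μ e = Mode.hard) : v ∈ hardVerts G μ := by
  rcases mem_verts_cases (μ := μ) h.left_mem with h1 | ⟨i, h1⟩ | h1
  · exact h1
  · simpa [he] using mode_of_jetVerts h1 h
  · simpa [he] using mode_of_softVerts h1 h

theorem mem_of_jet {e : E} {v w : V} {i : Fin K} (h : G.graph.IsLink e v w)
    (he : μ e = Mode.jet i) : v ∈ hardVerts G μ ∨ v ∈ jetVerts G μ i := by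
  rcases mem_verts_cases (μ := μ) h.left_mem with h1 | ⟨j, h1⟩ | h1
  · exact Or.inl h1
  · rcases mode_of_jetVerts h1 h with h2 | h2
    · rw [he, Mode.jet.injEq] at h2
      exact Or.inr (h2 ▸ h1)
    · simp [he] at h2
  · simpa [he] using mode_of_softVerts h1 h

theorem leg_eq_of_mem_jetVerts {l : Leg K N} {i : Fin K} (h : G.leg l ∈ jetVerts G μ i) :
    l = Sum.inl i := h.2.2.2 l rfl

/-- An external line makes its vertex hard or collinear, so all momenta enter through `H ∪ J`. The
bounds for the 2-trees rest on this. -/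
theorem leg_notMem_softVerts (l : Leg K N) : G.leg l ∉ softVerts G μ := fun h => h.2.2.2 l rfl

variable (G μ) in
/-- The vertices of `H ∪ J`. -/
def hardJetVerts : Set V := hardVerts G μ ∪ ⋃ i, jetVerts G μ i

variable (G μ) in
/-- The edges of `H ∪ J`. -/
def hardJetEdges : Set E := edgesOf G μ Mode.hard ∪ jetEdges G μ

theorem mem_hardJetVerts {v : V} :
    v ∈ hardJetVerts G μ ↔ v ∈ hardVerts G μ ∨ ∃ i, v ∈ jetVerts G μ i := by
  simp [hardJetVerts]

theorem mem_hardJetEdges {e : E} :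
    e ∈ hardJetEdges G μ ↔ e ∈ G.graph.edgeSet ∧ μ e ≠ Mode.soft := by
  rw [hardJetEdges, Set.mem_union, mem_jetEdges]
  simp only [edgesOf, Set.mem_ofPred_eq]
  cases h : μ e <;> simp

theorem mem_hardJetVerts_of_notMem {v : V} (hv : v ∈ G.graph.vertexSet)
    (h : v ∉ softVerts G μ) : v ∈ hardJetVerts G μ := by
  rw [mem_hardJetVerts]
  rcases mem_verts_cases (μ := μ) hv with h1 | h1 | h1
  · exact Or.inl h1
  · exact Or.inr h1
  · exact absurd h1 h

theorem notMem_softVerts_of_hardJetVerts {v : V} (h : v ∈ hardJetVerts G μ) :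
    v ∉ softVerts G μ := by
  rcases mem_hardJetVerts.1 h with h | ⟨i, h⟩
  · exact notMem_softVerts_of_hardVerts h
  · exact notMem_softVerts_of_jetVerts h

theorem hardJetVerts_subset : hardJetVerts G μ ⊆ G.graph.vertexSet := fun v h => by
  rcases mem_hardJetVerts.1 h with h | ⟨i, h⟩
  exacts [h.1, h.1]

theorem leg_mem_hardJetVerts (l : Leg K N) : G.leg l ∈ hardJetVerts G μ :=
  mem_hardJetVerts_of_notMem (G.leg_mem l) (leg_notMem_softVerts l)

theorem mem_hardJetVerts_of_isLink {e : E} {v w : V} (h : G.graph.IsLink e v w)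
    (he : μ e ≠ Mode.soft) : v ∈ hardJetVerts G μ :=
  mem_hardJetVerts_of_notMem h.left_mem fun hs => he (mode_of_softVerts hs h)

/-- Restricting to the hard vertices loses no hard edge, since both ends of such an edge are hard.
-/
theorem hardGraph_isLink {e : E} {v w : V} :
    (hardGraph G μ).IsLink e v w ↔ μ e = Mode.hard ∧ G.graph.IsLink e v w := by
  simp only [hardGraph, Graph.induce_isLink, Graph.restrict_isLink, edgesOf, Set.mem_ofPred_eq]
  exact ⟨fun h => ⟨h.1.1.2, h.1.2⟩, fun h => ⟨⟨⟨h.2.edge_mem, h.1⟩, h.2⟩,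
    mem_hardVerts_of_hard h.2 h.1, mem_hardVerts_of_hard h.2.symm h.1⟩⟩

theorem hardJetGraph_isLink {e : E} {v w : V} :
    (hardJetGraph G μ).IsLink e v w ↔ μ e ≠ Mode.soft ∧ G.graph.IsLink e v w := by
  change (_ ∧ _) ∧ _ ∧ _ ↔ _
  change (e ∈ hardJetEdges G μ ∧ G.graph.IsLink e v w) ∧ v ∈ hardJetVerts G μ ∧
    w ∈ hardJetVerts G μ ↔ _
  rw [mem_hardJetEdges]
  exact ⟨fun h => ⟨h.1.1.2, h.1.2⟩, fun h => ⟨⟨⟨h.2.edge_mem, h.1⟩, h.2⟩,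
    mem_hardJetVerts_of_isLink h.2 h.1, mem_hardJetVerts_of_isLink h.2.symm h.1⟩⟩

theorem hardGraph_vertexSet : (hardGraph G μ).vertexSet = hardVerts G μ := rfl

theorem hardJetGraph_vertexSet : (hardJetGraph G μ).vertexSet = hardJetVerts G μ := rfl

theorem hardGraph_edgeSet : (hardGraph G μ).edgeSet = edgesOf G μ Mode.hard := by
  ext e
  rw [Graph.edge_mem_iff_exists_isLink]
  simp only [hardGraph_isLink]
  constructor
  · rintro ⟨x, y, h, hl⟩
    exact ⟨hl.edge_mem, h⟩
  · rintro ⟨he, h⟩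
    obtain ⟨x, y, hl⟩ := Graph.exists_isLink_of_mem_edgeSet he
    exact ⟨x, y, h, hl⟩

theorem hardJetGraph_edgeSet : (hardJetGraph G μ).edgeSet = hardJetEdges G μ := by
  ext e
  rw [Graph.edge_mem_iff_exists_isLink, mem_hardJetEdges]
  simp only [hardJetGraph_isLink]
  constructor
  · rintro ⟨x, y, h, hl⟩
    exact ⟨hl.edge_mem, h⟩
  · rintro ⟨he, h⟩
    obtain ⟨x, y, hl⟩ := Graph.exists_isLink_of_mem_edgeSet he
    exact ⟨x, y, h, hl⟩

theorem jetTilde_edgeSet (i : Fin K) : (jetTilde G μ i).edgeSet = edgesOf G μ (Mode.jet i) :=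
  Set.inter_eq_right.2 fun _ h => h.1

theorem softTilde_edgeSet : (softTilde G μ).edgeSet = edgesOf G μ Mode.soft :=
  Set.inter_eq_right.2 fun _ h => h.1

variable (G μ) in
/-- The edges of `J_i ∪ J_j ∪ S`. -/
def jetPairEdges (i j : Fin K) : Set E :=
  edgesOf G μ (Mode.jet i) ∪ edgesOf G μ (Mode.jet j) ∪ edgesOf G μ Mode.soft

theorem jetPairTilde_edgeSet (i j : Fin K) :
    (jetPairTilde G μ i j).edgeSet = jetPairEdges G μ i j :=
  Set.inter_eq_right.2 fun _ h => by
    rcases h with (h | h) | h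
    exacts [h.1, h.1, h.1]

theorem mem_part {m : Mode K} {T : Finset E} {e : E} :
    e ∈ part G μ m T ↔ e ∈ T ∧ e ∈ G.graph.edgeSet ∧ μ e = m := by
  rw [part, Finset.mem_filter]
  rfl

theorem part_subset (m : Mode K) (T : Finset E) : part G μ m T ⊆ T := Finset.filter_subset _ _

theorem part_subset_edgesOf (m : Mode K) (T : Finset E) :
    (part G μ m T : Set E) ⊆ edgesOf G μ m := fun _ he => (mem_part.1 (Finset.mem_coe.1 he)).2

variable (G μ) in
/-- The edges of `T` that are edges of `H ∪ J`. -/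
noncomputable def hardJetPart (T : Finset E) : Finset E :=
  T.filter (fun e => e ∈ hardJetEdges G μ)

theorem mem_hardJetPart {T : Finset E} {e : E} :
    e ∈ hardJetPart G μ T ↔ e ∈ T ∧ e ∈ G.graph.edgeSet ∧ μ e ≠ Mode.soft := by
  rw [hardJetPart, Finset.mem_filter, mem_hardJetEdges]

theorem hardJetPart_subset (T : Finset E) : hardJetPart G μ T ⊆ T := Finset.filter_subset _ _

variable (G μ) in
/-- The edges of `T` that are edges of `J_i ∪ J_j ∪ S`. -/
noncomputable def jetPairPart (i j : Fin K) (T : Finset E) : Finset E :=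
  T.filter (fun e => e ∈ jetPairEdges G μ i j)

theorem mem_jetPairPart {i j : Fin K} {T : Finset E} {e : E} :
    e ∈ jetPairPart G μ i j T ↔ e ∈ T ∧ e ∈ G.graph.edgeSet ∧
      (μ e = Mode.jet i ∨ μ e = Mode.jet j ∨ μ e = Mode.soft) := by
  rw [jetPairPart, Finset.mem_filter]
  simp only [jetPairEdges, edgesOf, Set.mem_union, Set.mem_ofPred_eq]
  tauto

/-! ### Counting vertices and edges -/

theorem card_hardJetPart (T : Finset E) : (hardJetPart G μ T).card =
    (part G μ Mode.hard T).card + ∑ i, (part G μ (Mode.jet i) T).card := by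
  have h1 : hardJetPart G μ T = part G μ Mode.hard T ∪
      Finset.univ.biUnion (fun i => part G μ (Mode.jet i) T) := by
    ext e
    simp only [mem_hardJetPart, Finset.mem_union, mem_part, Finset.mem_biUnion, Finset.mem_univ,
      true_and]
    cases h : μ e <;> simp
  rw [h1, Finset.card_union_of_disjoint, Finset.card_biUnion]
  · intro i _ j _ hij
    refine Finset.disjoint_left.2 fun e he he' => hij ?_
    have := (mem_part.1 he).2.2.symm.trans (mem_part.1 he').2.2
    simpa using this
  · refine Finset.disjoint_left.2 fun e he he' => ?_
    simp only [Finset.mem_biUnion, mem_part, Finset.mem_univ, true_and] at he he'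
    obtain ⟨i, h⟩ := he'
    simpa using he.2.2.symm.trans h.2.2

theorem card_eq_hardJetPart_add {T : Finset E} (hT : (T : Set E) ⊆ G.graph.edgeSet) :
    T.card = (hardJetPart G μ T).card + (part G μ Mode.soft T).card := by
  have h1 : T = hardJetPart G μ T ∪ part G μ Mode.soft T := by
    ext e
    simp only [mem_hardJetPart, Finset.mem_union, mem_part]
    have : e ∈ T → e ∈ G.graph.edgeSet := fun h => hT h
    tauto
  conv_lhs => rw [h1]
  rw [Finset.card_union_of_disjoint]
  refine Finset.disjoint_left.2 fun e he he' => ?_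
  exact (mem_hardJetPart.1 he).2.2 (mem_part.1 he').2.2

theorem card_jetPairPart {i j : Fin K} (hij : i ≠ j) (T : Finset E) :
    (jetPairPart G μ i j T).card = (part G μ (Mode.jet i) T).card +
      (part G μ (Mode.jet j) T).card + (part G μ Mode.soft T).card := by
  have h1 : jetPairPart G μ i j T = part G μ (Mode.jet i) T ∪ part G μ (Mode.jet j) T ∪
      part G μ Mode.soft T := by
    ext e
    simp only [mem_jetPairPart, Finset.mem_union, mem_part]
    tauto
  rw [h1, Finset.card_union_of_disjoint, Finset.card_union_of_disjoint]
  · refine Finset.disjoint_left.2 fun e he he' => hij ?_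
    have := (mem_part.1 he).2.2.symm.trans (mem_part.1 he').2.2
    simpa using this
  · refine Finset.disjoint_left.2 fun e he he' => ?_
    have h2 := (mem_part.1 he').2.2
    rcases Finset.mem_union.1 he with he | he
    all_goals simpa using (mem_part.1 he).2.2.symm.trans h2

theorem nRemoved_eq [Finite E] (m : Mode K) (T : Finset E) :
    nRemoved G μ m T = (edgesOf G μ m).ncard - ((part G μ m T).card : ℤ) := by
  have h1 : edgesOf G μ m \ T = edgesOf G μ m \ (part G μ m T : Set E) := by
    ext e
    simp only [Set.mem_sdiff, Finset.mem_coe, mem_part, edgesOf, Set.mem_ofPred_eq]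
    tauto
  have h2 := Set.ncard_sdiff_add_ncard_of_subset (part_subset_edgesOf (G := G) (μ := μ) m T)
    (Set.toFinite _)
  rw [Set.ncard_coe_finset] at h2
  rw [nRemoved, h1]
  omega

section Finite

variable [Finite V]

theorem ncard_hardJetVerts : (hardJetVerts G μ).ncard =
    (hardVerts G μ).ncard + ∑ i, (jetVerts G μ i).ncard := by
  rw [hardJetVerts, Set.ncard_union_eq]
  · congr 1
    rw [Set.ncard_iUnion_of_finite (fun i => Set.toFinite _), finsum_eq_sum_of_fintype]
    intro i j hij
    exact Set.disjoint_left.2 fun v hi hj => hij (jetVerts_unique hi hj)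
  · refine Set.disjoint_left.2 fun v hv hv' => ?_
    obtain ⟨i, hi⟩ := Set.mem_iUnion.1 hv'
    exact notMem_jetVerts_of_hardVerts hv i hi

theorem ncard_vertexSet : G.graph.vertexSet.ncard =
    (hardJetVerts G μ).ncard + (softVerts G μ).ncard := by
  rw [← Set.ncard_union_eq]
  · congr 1
    ext v
    constructor
    · intro hv
      by_cases h : v ∈ softVerts G μ
      · exact Or.inr h
      · exact Or.inl (mem_hardJetVerts_of_notMem hv h)
    · rintro (h | h)
      · exact hardJetVerts_subset h
      · exact h.1
  · exact Set.disjoint_left.2 fun v hv hv' => notMem_softVerts_of_hardJetVerts hv hv'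

theorem ncard_jetPairVerts {i j : Fin K} (hij : i ≠ j) : (jetPairVerts G μ i j).ncard =
    (jetVerts G μ i).ncard + (jetVerts G μ j).ncard + (softVerts G μ).ncard := by
  rw [jetPairVerts, Set.ncard_union_eq, Set.ncard_union_eq]
  · exact Set.disjoint_left.2 fun v hi hj => hij (jetVerts_unique hi hj)
  · refine Set.disjoint_left.2 fun v hv hv' => ?_
    rcases hv with hv | hv
    all_goals exact notMem_softVerts_of_jetVerts hv hv'

end Finite

/-! ### Reachability in the subgraphs -/

theorem jetPairVerts_subset (i j : Fin K) : jetPairVerts G μ i j ⊆ G.graph.vertexSet := by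
  rintro v ((h | h) | h)
  exacts [h.1, h.1, h.1]

/-- Edges of `H ∪ J` do not leave a jet except to `H`. -/
theorem Reachable.jet_or_hard {T : Finset E} {i : Fin K} {v w : V} (hv : v ∈ jetVerts G μ i)
    (h : Reachable (G.graph.restrict (hardJetPart G μ T)) v w) :
    w ∈ jetVerts G μ i ∨
      ∃ u ∈ hardVerts G μ, Reachable (G.graph.restrict (hardJetPart G μ T)) v u := by
  by_contra! hcon
  refine hcon.1 (And.left (Reachable.mem_of_closed
    (W := {w | w ∈ jetVerts G μ i ∧ Reachable (G.graph.restrict (hardJetPart G μ T)) v w})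
    ?_ h ⟨hv, Reachable.refl _ _⟩))
  rintro e he x y hl ⟨hx, hr⟩
  have hr' := hr.trans (.of_isLink he hl)
  refine ⟨?_, hr'⟩
  have hm : μ e = Mode.jet i :=
    (mode_of_jetVerts hx hl).resolve_right (mem_hardJetPart.1 he).2.2
  exact (mem_of_jet hl.symm hm).resolve_left fun hy => hcon.2 y hy hr'

theorem Reachable.of_hardGraph {T T' : Finset E} (hT : T ⊆ T') {v w : V}
    (h : Reachable ((WideAngle.hardGraph G μ).restrict T) v w) :
    Reachable (G.graph.restrict T') v w :=
  h.map id fun _ he _ _ hl => .of_isLink (hT he) (hardGraph_isLink.1 hl).2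

theorem Reachable.of_hardJetGraph {T T' : Finset E} (hT : T ⊆ T') {v w : V}
    (h : Reachable ((WideAngle.hardJetGraph G μ).restrict T) v w) :
    Reachable (G.graph.restrict T') v w :=
  h.map id fun _ he _ _ hl => .of_isLink (hT he) (hardJetGraph_isLink.1 hl).2

/-- An edge of `H ∪ J` outside `J_i` has no end among the vertices of `J_i`, so it collapses to the
auxiliary vertex. -/
theorem Reachable.jetTilde {T : Finset E} {v w : V} (i : Fin K)
    (h : Reachable (G.graph.restrict (hardJetPart G μ T)) v w) :
    Reachable ((jetTilde G μ i).restrict (part G μ (Mode.jet i) T))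
      (contractVertex (jetVerts G μ i) v) (contractVertex (jetVerts G μ i) w) := by
  refine h.contract fun e he x y hl => ?_
  obtain ⟨h1, h2, h3⟩ := mem_hardJetPart.1 he
  by_cases hm : μ e = Mode.jet i
  · exact Or.inl ⟨⟨h2, hm⟩, mem_part.2 ⟨h1, h2, hm⟩⟩
  · right
    constructor
    · exact fun hx => (mode_of_jetVerts hx hl).elim hm h3
    · exact fun hx => (mode_of_jetVerts hx hl.symm).elim hm h3

/-- Edges that are not soft do not touch soft vertices and collapse to the auxiliary vertex, so the
path may use edges of all modes. -/
theorem Reachable.softTilde {T : Finset E} {v w : V} (h : Reachable (G.graph.restrict T) v w) :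
    Reachable ((softTilde G μ).restrict (part G μ Mode.soft T))
      (contractVertex (softVerts G μ) v) (contractVertex (softVerts G μ) w) := by
  refine h.contract fun e he x y hl => ?_
  by_cases hm : μ e = Mode.soft
  · exact Or.inl ⟨⟨hl.edge_mem, hm⟩, mem_part.2 ⟨he, hl.edge_mem, hm⟩⟩
  · exact Or.inr ⟨fun hx => hm (mode_of_softVerts hx hl),
      fun hx => hm (mode_of_softVerts hx hl.symm)⟩

theorem Reachable.jetPairTilde {T : Finset E} {v w : V} (i j : Fin K)
    (h : Reachable (G.graph.restrict T) v w) :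
    Reachable ((jetPairTilde G μ i j).restrict (jetPairPart G μ i j T))
      (contractVertex (jetPairVerts G μ i j) v) (contractVertex (jetPairVerts G μ i j) w) := by
  refine h.contract fun e he x y hl => ?_
  by_cases hm : μ e = Mode.jet i ∨ μ e = Mode.jet j ∨ μ e = Mode.soft
  · have h1 := mem_jetPairPart.2 ⟨he, hl.edge_mem, hm⟩
    exact Or.inl ⟨(Finset.mem_filter.1 h1).2, h1⟩
  · have key : ∀ x y, G.graph.IsLink e x y → x ∉ jetPairVerts G μ i j := by
      rintro x y hl ((hx | hx) | hx)
      · have := mode_of_jetVerts hx hl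
        tauto
      · have := mode_of_jetVerts hx hl
        tauto
      · have := mode_of_softVerts hx hl
        tauto
    exact Or.inr ⟨key x y hl, key y x hl.symm⟩

end SubgraphLemmas

/-! ### Vertex and loop numbers of the subgraphs of a region -/

namespace Region

variable {V E : Type*} {K N : ℕ} {G : ScatteringGraph V E K N} (R : Region G)

theorem exists_mem_hardVerts : ∃ v, v ∈ hardVerts G R.mode := R.hard_connected.1

section Finite

variable [Finite V]

theorem ncard_jetTilde (i : Fin K) :
    (jetTilde G R.mode i).vertexSet.ncard = (jetVerts G R.mode i).ncard + 1 := by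
  obtain ⟨v, hv⟩ := R.exists_mem_hardVerts
  exact contract_vertexSet_ncard (jetVerts_subset i) ⟨v, hv.1, notMem_jetVerts_of_hardVerts hv i⟩

theorem ncard_softTilde :
    (softTilde G R.mode).vertexSet.ncard = (softVerts G R.mode).ncard + 1 := by
  obtain ⟨v, hv⟩ := R.exists_mem_hardVerts
  exact contract_vertexSet_ncard softVerts_subset ⟨v, hv.1, notMem_softVerts_of_hardVerts hv⟩

theorem ncard_jetPairTilde (i j : Fin K) :
    (jetPairTilde G R.mode i j).vertexSet.ncard = (jetPairVerts G R.mode i j).ncard + 1 := by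
  obtain ⟨v, hv⟩ := R.exists_mem_hardVerts
  refine contract_vertexSet_ncard (jetPairVerts_subset i j) ⟨v, hv.1, ?_⟩
  rintro ((h | h) | h)
  exacts [notMem_jetVerts_of_hardVerts hv i h, notMem_jetVerts_of_hardVerts hv j h,
    notMem_softVerts_of_hardVerts hv h]

end Finite

theorem none_mem_jetTilde (i : Fin K) : none ∈ (jetTilde G R.mode i).vertexSet := by
  obtain ⟨v, hv⟩ := R.exists_mem_hardVerts
  exact ⟨v, hv.1, contractVertex_of_notMem (notMem_jetVerts_of_hardVerts hv i)⟩

theorem none_mem_softTilde : none ∈ (softTilde G R.mode).vertexSet := by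
  obtain ⟨v, hv⟩ := R.exists_mem_hardVerts
  exact ⟨v, hv.1, contractVertex_of_notMem (notMem_softVerts_of_hardVerts hv)⟩

theorem hardVerts_notMem_jetPairVerts {v : V} (hv : v ∈ hardVerts G R.mode) (i j : Fin K) :
    v ∉ jetPairVerts G R.mode i j := by
  rintro ((h | h) | h)
  exacts [notMem_jetVerts_of_hardVerts hv i h, notMem_jetVerts_of_hardVerts hv j h,
    notMem_softVerts_of_hardVerts hv h]

theorem none_mem_jetPairTilde (i j : Fin K) :
    none ∈ (jetPairTilde G R.mode i j).vertexSet := by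
  obtain ⟨v, hv⟩ := R.exists_mem_hardVerts
  exact ⟨v, hv.1, contractVertex_of_notMem (R.hardVerts_notMem_jetPairVerts hv i j)⟩

/-- The contracted soft graph inherits this from `G`, since every path in `G` maps to it. For the
jets the analogous property has to be required of a region. -/
theorem softTilde_connected [Finite E] : Connected (softTilde G R.mode) := by
  refine ⟨⟨none, R.none_mem_softTilde⟩, ?_⟩
  rintro _ ⟨x, hx, rfl⟩ _ ⟨y, hy, rfl⟩
  have h := G.connected.2 x hx y hy
  have hfin : G.graph.edgeSet.Finite := Set.toFinite _
  have h' : Reachable (G.graph.restrict hfin.toFinset) x y := by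
    rwa [hfin.coe_toFinset, Graph.restrict_self]
  exact (Reachable.softTilde (μ := R.mode) h').map id fun e he u v hl => by
    exact Relation.ReflTransGen.single ⟨e, hl⟩

theorem loopsH_eq : R.loopsH =
    (edgesOf G R.mode Mode.hard).ncard - (hardVerts G R.mode).ncard + 1 := by
  rw [loopsH, loopNumber, R.hard_connected.numComponents_eq, hardGraph_edgeSet, hardGraph_vertexSet]
  simp

/-- In Euler's formula the auxiliary vertex cancels against the single component, which leaves edges
minus jet vertices. -/
theorem loopsJ_eq [Finite V] (i : Fin K) : R.loopsJ i =
    (edgesOf G R.mode (Mode.jet i)).ncard - (jetVerts G R.mode i).ncard := by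
  rw [loopsJ, loopNumber, (R.jet_attached i).numComponents_eq, jetTilde_edgeSet, R.ncard_jetTilde]
  push_cast
  ring

theorem loopsS_eq [Finite V] [Finite E] : R.loopsS =
    (edgesOf G R.mode Mode.soft).ncard - (softVerts G R.mode).ncard := by
  rw [loopsS, loopNumber, R.softTilde_connected.numComponents_eq, softTilde_edgeSet,
    R.ncard_softTilde]
  push_cast
  ring

end Region

/-! ### Sums over sets of edges -/

section SubsetSum

variable {E : Type*} [Fintype E]

/-- `a` if `p` holds, and `0` otherwise. -/
noncomputable def onlyIf (p : Prop) (a : ℝ) : ℝ := if p then a else 0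

theorem onlyIf_pos {p : Prop} (h : p) (a : ℝ) : onlyIf p a = a := if_pos h

theorem onlyIf_neg {p : Prop} (h : ¬ p) (a : ℝ) : onlyIf p a = 0 := if_neg h

theorem onlyIf_congr {p q : Prop} {a b : ℝ} (h : p ↔ q) (hab : p → a = b) :
    onlyIf p a = onlyIf q b := by
  by_cases hp : p
  · rw [onlyIf_pos hp, onlyIf_pos (h.1 hp), hab hp]
  · rw [onlyIf_neg hp, onlyIf_neg fun hq => hp (h.2 hq)]

theorem onlyIf_mul (p q : Prop) (a b : ℝ) : onlyIf p a * onlyIf q b = onlyIf (p ∧ q) (a * b) := by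
  by_cases hp : p <;> by_cases hq : q <;> simp [onlyIf, hp, hq]

theorem prod_onlyIf_one {ι : Type*} (s : Finset ι) (p : ι → Prop) :
    ∏ i ∈ s, onlyIf (p i) 1 = onlyIf (∀ i ∈ s, p i) 1 := by
  by_cases h : ∀ i ∈ s, p i
  · rw [onlyIf_pos h]
    exact Finset.prod_eq_one fun i hi => onlyIf_pos (h i hi) 1
  · rw [onlyIf_neg h]
    push Not at h
    obtain ⟨i, hi, hp⟩ := h
    exact Finset.prod_eq_zero hi (onlyIf_neg hp 1)

/-- The edges in `F` that are not in `T`. -/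
noncomputable def edgesOff (F : Set E) (T : Finset E) : Finset E :=
  Finset.univ.filter (fun e => e ∈ F ∧ e ∉ T)

theorem mem_edgesOff {F : Set E} {T : Finset E} {e : E} : e ∈ edgesOff F T ↔ e ∈ F ∧ e ∉ T := by
  simp [edgesOff]

/-- The sum of `c T * ∏ x_e`, `e ∈ F \ T`, over the subsets `T` of `F`. -/
noncomputable def subsetSum (F : Set E) (c : Finset E → ℝ) : MvPolynomial E ℝ :=
  ∑ T ∈ Finset.univ.filter (fun T : Finset E => (T : Set E) ⊆ F),
    MvPolynomial.C (c T) * ∏ e ∈ edgesOff F T, X e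

theorem subsetSum_congr {F : Set E} {c c' : Finset E → ℝ}
    (h : ∀ T : Finset E, (T : Set E) ⊆ F → c T = c' T) : subsetSum F c = subsetSum F c' :=
  Finset.sum_congr rfl fun T hT => by rw [h T (Finset.mem_filter.1 hT).2]

theorem subsetSum_add (F : Set E) (c c' : Finset E → ℝ) :
    subsetSum F c + subsetSum F c' = subsetSum F (fun T => c T + c' T) := by
  rw [subsetSum, subsetSum, subsetSum, ← Finset.sum_add_distrib]
  exact Finset.sum_congr rfl fun T _ => by rw [map_add, add_mul]

theorem sum_subsetSum {ι : Type*} (s : Finset ι) (F : Set E) (c : ι → Finset E → ℝ) :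
    ∑ i ∈ s, subsetSum F (c i) = subsetSum F (fun T => ∑ i ∈ s, c i T) := by
  simp only [subsetSum]
  rw [Finset.sum_comm]
  exact Finset.sum_congr rfl fun T _ => by rw [map_sum, Finset.sum_mul]

/-- A subset of `F ∪ F'` is the same as a pair of subsets of `F` and of `F'`, and the complementary
monomial is the product of the two complementary monomials. -/
theorem subsetSum_mul {F F' : Set E} (hd : Disjoint F F') (c c' : Finset E → ℝ) :
    subsetSum F c * subsetSum F' c' = subsetSum (F ∪ F')
      (fun T => c (T.filter (fun e => e ∈ F)) * c' (T.filter (fun e => e ∈ F'))) := by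
  rw [subsetSum, subsetSum, subsetSum, Finset.sum_mul_sum, ← Finset.sum_product']
  have hd' : ∀ e, e ∈ F → e ∉ F' := fun e h h' => Set.disjoint_left.1 hd h h'
  refine Finset.sum_bij' (fun p _ => p.1 ∪ p.2)
    (fun T _ => (T.filter (fun e => e ∈ F), T.filter (fun e => e ∈ F'))) ?_ ?_ ?_ ?_ ?_
  · rintro ⟨T, T'⟩ h
    simp only [Finset.mem_product, Finset.mem_filter, Finset.mem_univ, true_and] at h ⊢
    rw [Finset.coe_union]
    exact Set.union_subset_union h.1 h.2
  · intro T _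
    simp only [Finset.mem_product, Finset.mem_filter, Finset.mem_univ, true_and]
    constructor <;> intro e he <;> simpa using (Finset.mem_filter.1 (Finset.mem_coe.1 he)).2
  · rintro ⟨T, T'⟩ h
    simp only [Finset.mem_product, Finset.mem_filter, Finset.mem_univ, true_and] at h
    refine Prod.ext (Finset.ext fun e => ?_) (Finset.ext fun e => ?_)
    all_goals
      have h1 : e ∈ T → e ∈ F := fun he => h.1 he
      have h2 : e ∈ T' → e ∈ F' := fun he => h.2 he
      have h3 := hd' e
      simp only [Finset.mem_filter, Finset.mem_union]
      tauto
  · intro T h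
    simp only [Finset.mem_filter, Finset.mem_univ, true_and] at h
    ext e
    have h1 : e ∈ T → e ∈ F ∪ F' := fun he => h he
    simp only [Finset.mem_filter, Finset.mem_union]
    simp only [Set.mem_union] at h1
    tauto
  · rintro ⟨T, T'⟩ h
    simp only [Finset.mem_product, Finset.mem_filter, Finset.mem_univ, true_and] at h
    have e1 : (T ∪ T').filter (fun e => e ∈ F) = T := by
      ext e
      have h1 : e ∈ T → e ∈ F := fun he => h.1 he
      have h2 : e ∈ T' → e ∈ F' := fun he => h.2 he
      have h3 := hd' e
      simp only [Finset.mem_filter, Finset.mem_union]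
      tauto
    have e2 : (T ∪ T').filter (fun e => e ∈ F') = T' := by
      ext e
      have h1 : e ∈ T → e ∈ F := fun he => h.1 he
      have h2 : e ∈ T' → e ∈ F' := fun he => h.2 he
      have h3 := hd' e
      simp only [Finset.mem_filter, Finset.mem_union]
      tauto
    have e3 : edgesOff (F ∪ F') (T ∪ T') = edgesOff F T ∪ edgesOff F' T' := by
      ext e
      have h1 : e ∈ T → e ∈ F := fun he => h.1 he
      have h2 : e ∈ T' → e ∈ F' := fun he => h.2 he
      have h3 := hd' e
      simp only [mem_edgesOff, Finset.mem_union, Set.mem_union]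
      tauto
    have e4 : Disjoint (edgesOff F T) (edgesOff F' T') :=
      Finset.disjoint_left.2 fun e he he' => hd' e (mem_edgesOff.1 he).1 (mem_edgesOff.1 he').1
    dsimp only
    rw [e1, e2, e3, Finset.prod_union e4, map_mul]
    ring

theorem subsetSum_empty (c : Finset E → ℝ) : subsetSum ∅ c = MvPolynomial.C (c ∅) := by
  have h : Finset.univ.filter (fun T : Finset E => (T : Set E) ⊆ ∅) = {∅} := by
    ext T
    simp
  rw [subsetSum, h, Finset.sum_singleton]
  simp [edgesOff]

/-- `c T` depends only on the elements of `T` in `F`. -/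
def LocalOn (F : Set E) (c : Finset E → ℝ) : Prop :=
  ∀ T : Finset E, c (T.filter (fun e => e ∈ F)) = c T

omit [Fintype E] in
theorem LocalOn.of_filter (F : Set E) (c : Finset E → ℝ) :
    LocalOn F (fun T => c (T.filter (fun e => e ∈ F))) := fun T => by
  simp only [Finset.filter_filter, and_self]

omit [Fintype E] in
theorem LocalOn.mono {F F' : Set E} (hF : F ⊆ F') {c : Finset E → ℝ} (h : LocalOn F c) :
    LocalOn F' c := fun T => by
  rw [← h, ← h T, Finset.filter_filter]
  congr 1
  exact Finset.filter_congr fun e _ => ⟨fun h => h.2, fun h => ⟨hF h, h⟩⟩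

omit [Fintype E] in
theorem LocalOn.mul {F F' : Set E} {c c' : Finset E → ℝ} (h : LocalOn F c) (h' : LocalOn F' c') :
    LocalOn (F ∪ F') (fun T => c T * c' T) := fun T =>
  congrArg₂ (· * ·) (h.mono Set.subset_union_left T) (h'.mono Set.subset_union_right T)

theorem subsetSum_eq_filter (F : Set E) (c : Finset E → ℝ) :
    subsetSum F c = subsetSum F (fun T => c (T.filter (fun e => e ∈ F))) :=
  subsetSum_congr fun T hT => by rw [Finset.filter_true_of_mem fun e he => hT he]

theorem LocalOn.subsetSum_mul {F F' : Set E} (hd : Disjoint F F') {c c' : Finset E → ℝ}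
    (h : LocalOn F c) (h' : LocalOn F' c') :
    subsetSum F c * subsetSum F' c' = subsetSum (F ∪ F') (fun T => c T * c' T) := by
  rw [WideAngle.subsetSum_mul hd]
  exact subsetSum_congr fun T _ => by rw [h T, h' T]

/-- Locality of the partial product is carried through the induction because multiplication by the
next factor needs it. -/
theorem LocalOn.prod_subsetSum {ι : Type*} (s : Finset ι) {F : ι → Set E}
    (hd : ∀ i j, i ≠ j → Disjoint (F i) (F j)) {c : ι → Finset E → ℝ}
    (h : ∀ i, LocalOn (F i) (c i)) :
    LocalOn (⋃ i ∈ s, F i) (fun T => ∏ i ∈ s, c i T) ∧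
      ∏ i ∈ s, subsetSum (F i) (c i) = subsetSum (⋃ i ∈ s, F i) (fun T => ∏ i ∈ s, c i T) := by
  induction s using Finset.induction_on with
  | empty => exact ⟨fun T => by simp, by simp [subsetSum_empty]⟩
  | @insert a s ha ih =>
    have h1 : Disjoint (F a) (⋃ i ∈ s, F i) := by
      simp only [Set.disjoint_iUnion_right]
      exact fun i hi => hd a i fun h => ha (h ▸ hi)
    simp only [Finset.prod_insert ha, Finset.set_biUnion_insert]
    exact ⟨(h a).mul ih.1, by rw [ih.2, (h a).subsetSum_mul h1 ih.1]⟩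

variable {α : Type*} {K N : ℕ} {M : Type*} [AddCommGroup M] [Module ℝ M]

/-- The condition on `T` is moved into the coefficient. The sum then runs over all subsets of the
edge set, and such sums multiply without any knowledge of trees. -/
theorem treeSum_eq_subsetSum (Γ : Graph α E) (D : Finset E → Prop) :
    treeSum Γ D = subsetSum Γ.edgeSet (fun T => onlyIf (IsSpanningTree Γ T ∧ D T) 1) := by
  rw [treeSum, subsetSum]
  refine Eq.trans (Finset.sum_congr rfl fun T hT => ?_) (Finset.sum_subset ?_ ?_)
  · rw [onlyIf_pos (Finset.mem_filter.1 hT).2, map_one, one_mul]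
    rfl
  · intro T hT
    exact Finset.mem_filter.2 ⟨Finset.mem_univ _, (Finset.mem_filter.1 hT).2.1.1⟩
  · intro T _ hT
    rw [onlyIf_neg, map_zero, zero_mul]
    simpa using hT

theorem treePoly_eq_subsetSum (Γ : Graph α E) :
    treePoly Γ = subsetSum Γ.edgeSet (fun T => onlyIf (IsSpanningTree Γ T) 1) := by
  rw [treePoly, treeSum_eq_subsetSum]
  simp only [and_true]

theorem twoTreeSum_eq_subsetSum (Q : QuadraticForm ℝ M) (k : Leg K N → M) (Γ : Graph α E)
    (leg : Leg K N → α) (D : Finset E → Prop) :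
    twoTreeSum Q k Γ leg D = subsetSum Γ.edgeSet
      (fun T => onlyIf (IsSpanningTwoTree Γ T ∧ D T) (-twoTreeInvariant Q k Γ leg T)) := by
  rw [twoTreeSum, subsetSum]
  refine Eq.trans (Finset.sum_congr rfl fun T hT => ?_) (Finset.sum_subset ?_ ?_)
  · rw [onlyIf_pos (Finset.mem_filter.1 hT).2]
    rfl
  · intro T hT
    exact Finset.mem_filter.2 ⟨Finset.mem_univ _, (Finset.mem_filter.1 hT).2.1.1⟩
  · intro T _ hT
    rw [onlyIf_neg, map_zero, zero_mul]
    simpa using hT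

end SubsetSum

/-! ### The Lee-Pomeransky polynomial and its leading part -/

section LeePomeransky

variable {α E : Type*} [Fintype E] {K N : ℕ} {M : Type*} [AddCommGroup M] [Module ℝ M]

theorem monomial_point (Γ : Graph α E) (T : Finset E) (n : ℕ) (a : ℝ) :
    monomial (point Γ T n) a =
      MvPolynomial.C a * X none ^ n * ∏ e ∈ removed Γ T, X (some e) := by
  have h : ∀ s : Finset E, monomial (∑ e ∈ s, Finsupp.single (some e) 1) (1 : ℝ) =
      ∏ e ∈ s, X (some e) := by
    intro s
    rw [monomial_sum_one]
    rfl
  rw [point, ← h, X_pow_eq_monomial, mul_assoc, monomial_mul, C_mul_monomial]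
  simp

theorem leePomeransky_eq (Q : QuadraticForm ℝ M) (k : Leg K N → M) (Γ : Graph α E)
    (leg : Leg K N → α) : leePomeransky Q k Γ leg =
      ∑ T ∈ Finset.univ.filter (fun T => IsSpanningTree Γ T), monomial (point Γ T 0) 1 +
      ∑ T ∈ Finset.univ.filter (fun T => IsSpanningTwoTree Γ T),
        monomial (point Γ T (lamPower Γ leg T)) (-twoTreeInvariant Q k Γ leg T) := by
  simp only [monomial_point, leePomeransky, map_one, pow_zero, one_mul]

/-- Taking the leading terms can be done summand by summand even if some of the exponents `r i`
coincide: summands with equal exponents are kept or dropped together. -/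
theorem leadingPart_eq {σ : Type*} (v : σ → ℤ) (P : MvPolynomial σ ℝ) {ι : Type*} (s : Finset ι)
    (r : ι → σ →₀ ℕ) (a : ι → ℝ) [DecidablePred fun i => r i ∈ face v P] :
    ∑ x ∈ face v P, monomial x (coeff x (∑ i ∈ s, monomial (r i) (a i))) =
      ∑ i ∈ s.filter (fun i => r i ∈ face v P), monomial (r i) (a i) := by
  simp only [coeff_sum, coeff_monomial, map_sum]
  rw [Finset.sum_comm, Finset.sum_filter]
  refine Finset.sum_congr rfl fun i _ => ?_
  split_ifs with h
  · rw [Finset.sum_eq_single_of_mem (r i) h, if_pos rfl]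
    intro x _ hx
    rw [if_neg (Ne.symm hx), monomial_zero]
  · refine Finset.sum_eq_zero fun x hx => ?_
    rw [if_neg, monomial_zero]
    rintro rfl
    exact h hx

theorem aeval_monomial_point (Γ : Graph α E) (T : Finset E) (n : ℕ) (a : ℝ) :
    aeval (fun o : Option E => o.elim (1 : MvPolynomial E ℝ) X) (monomial (point Γ T n) a) =
      MvPolynomial.C a * ∏ e ∈ removed Γ T, X e := by
  rw [monomial_point]
  simp [algebraMap_eq]

theorem point_apply_some (Γ : Graph α E) (T : Finset E) (n : ℕ) (e : E) :
    point Γ T n (some e) = if e ∈ removed Γ T then 1 else 0 := by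
  simp [point, Finsupp.single_apply]

/-- The exponents of the `x_e` record the complement of `T`. Hence different trees and 2-trees never
share a monomial, and the coefficients of `P` can be read off without cancellations. -/
theorem eq_of_point_eq {Γ : Graph α E} {T T' : Finset E} {n n' : ℕ}
    (hT : (T : Set E) ⊆ Γ.edgeSet) (hT' : (T' : Set E) ⊆ Γ.edgeSet)
    (h : point Γ T n = point Γ T' n') : T = T' := by
  ext e
  have h1 : e ∈ removed Γ T ↔ e ∈ removed Γ T' := by
    have h2 := DFunLike.congr_fun h (some e)
    rw [point_apply_some, point_apply_some] at h2
    split_ifs at h2 with h3 h4 h4 <;> simp_all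
  simp only [removed, Finset.mem_filter, Finset.mem_univ, true_and] at h1
  have h3 : e ∈ T → e ∈ Γ.edgeSet := fun h => hT h
  have h4 : e ∈ T' → e ∈ Γ.edgeSet := fun h => hT' h
  tauto

variable [Finite α] (Q : QuadraticForm ℝ M) (k : Leg K N → M) {Γ : Graph α E} (leg : Leg K N → α)
  {T : Finset E}

omit [Fintype E] in
theorem IsSpanningTree.not_isSpanningTwoTree (h : IsSpanningTree Γ T) :
    ¬ IsSpanningTwoTree Γ T := fun h' => by
  have h1 := h.card
  have h2 := h'.card
  omega

theorem coeff_point_tree (h : IsSpanningTree Γ T) :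
    coeff (point Γ T 0) (leePomeransky Q k Γ leg) = 1 := by
  rw [leePomeransky_eq, coeff_add, coeff_sum, coeff_sum, Finset.sum_eq_single_of_mem T,
    Finset.sum_eq_zero]
  · simp [coeff_monomial]
  · intro T' hT'
    rw [coeff_monomial, if_neg]
    intro he
    have h' := (Finset.mem_filter.1 hT').2
    exact h.not_isSpanningTwoTree (eq_of_point_eq h'.1 h.1 he ▸ h')
  · simpa using h
  · intro T' hT' hne
    rw [coeff_monomial, if_neg]
    exact fun he => hne (eq_of_point_eq (Finset.mem_filter.1 hT').2.1 h.1 he)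

theorem coeff_point_twoTree (h : IsSpanningTwoTree Γ T) :
    coeff (point Γ T (lamPower Γ leg T)) (leePomeransky Q k Γ leg) =
      -twoTreeInvariant Q k Γ leg T := by
  rw [leePomeransky_eq, coeff_add, coeff_sum, coeff_sum, Finset.sum_eq_zero,
    Finset.sum_eq_single_of_mem T]
  · simp [coeff_monomial]
  · simpa using h
  · intro T' hT' hne
    rw [coeff_monomial, if_neg]
    exact fun he => hne (eq_of_point_eq (Finset.mem_filter.1 hT').2.1 h.1 he)
  · intro T' hT'
    rw [coeff_monomial, if_neg]
    intro he
    have h' := (Finset.mem_filter.1 hT').2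
    exact h'.not_isSpanningTwoTree (eq_of_point_eq h'.1 h.1 he ▸ h)

theorem mem_support_leePomeransky {r : Option E →₀ ℕ}
    (h : r ∈ (leePomeransky Q k Γ leg).support) :
    (∃ T, IsSpanningTree Γ T ∧ r = point Γ T 0) ∨
      ∃ T, IsSpanningTwoTree Γ T ∧ twoTreeInvariant Q k Γ leg T ≠ 0 ∧
        r = point Γ T (lamPower Γ leg T) := by
  by_contra! hcon
  have hr := mem_support_iff.1 h
  have h1 : r ∈ (leePomeransky Q k Γ leg).support := h
  by_cases hT : ∃ T, IsSpanningTwoTree Γ T ∧ r = point Γ T (lamPower Γ leg T)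
  · obtain ⟨T, hT, rfl⟩ := hT
    rw [coeff_point_twoTree Q k leg hT] at hr
    exact hcon.2 T hT (by simpa using hr) rfl
  · refine hr ?_
    rw [leePomeransky_eq, coeff_add, coeff_sum, coeff_sum, Finset.sum_eq_zero, Finset.sum_eq_zero,
      add_zero]
    · intro T hT'
      rw [coeff_monomial, if_neg]
      exact fun he => hT ⟨T, (Finset.mem_filter.1 hT').2, he.symm⟩
    · intro T hT'
      rw [coeff_monomial, if_neg]
      exact fun he => hcon.1 T (Finset.mem_filter.1 hT').2 he.symm

end LeePomeransky

/-! ### The scalar product with the region vector, and the splitting of `P_0` into its `U` and `F`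
terms -/

section Pairing

variable {σ : Type*}

theorem pairing_add (v : σ → ℤ) (r r' : σ →₀ ℕ) :
    pairing v (r + r') = pairing v r + pairing v r' := by
  rw [pairing, Finsupp.sum_add_index']
  · rfl
  · simp
  · intro i m n
    push_cast
    ring

theorem pairing_single (v : σ → ℤ) (i : σ) (n : ℕ) :
    pairing v (Finsupp.single i n) = n * v i := by
  rw [pairing, Finsupp.sum_single_index]
  simp

theorem pairing_sum {ι : Type*} (v : σ → ℤ) (s : Finset ι) (r : ι → σ →₀ ℕ) :
    pairing v (∑ i ∈ s, r i) = ∑ i ∈ s, pairing v (r i) := by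
  induction s using Finset.induction_on with
  | empty => simp [pairing]
  | insert a s ha ih => rw [Finset.sum_insert ha, Finset.sum_insert ha, pairing_add, ih]

end Pairing

namespace Region

variable {V E : Type*} [Fintype E] {K N : ℕ} {M : Type*} [AddCommGroup M] [Module ℝ M]
  {G : ScatteringGraph V E K N} (R : Region G) (Q : QuadraticForm ℝ M) (k : Leg K N → M)

theorem P0_eq : R.P0 Q k = R.URegion Q k + R.FRegion Q k := by
  have h : leadingPart R.vector (leePomeransky Q k G.graph G.leg) =
      ∑ T ∈ (Finset.univ.filter (fun T => IsSpanningTree G.graph T)).filter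
        (fun T => point G.graph T 0 ∈ face R.vector (leePomeransky Q k G.graph G.leg)),
          monomial (point G.graph T 0) 1 +
      ∑ T ∈ (Finset.univ.filter (fun T => IsSpanningTwoTree G.graph T)).filter
        (fun T => point G.graph T (lamPower G.graph G.leg T) ∈
          face R.vector (leePomeransky Q k G.graph G.leg)),
          monomial (point G.graph T (lamPower G.graph G.leg T))
            (-twoTreeInvariant Q k G.graph G.leg T) := by
    rw [← leadingPart_eq, ← leadingPart_eq, ← Finset.sum_add_distrib, leadingPart]
    refine Finset.sum_congr rfl fun r _ => ?_
    rw [← map_add, ← coeff_add, ← leePomeransky_eq]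
  rw [P0, h, map_add, map_sum, map_sum, URegion, FRegion, treeSum, twoTreeSum, Finset.filter_filter,
    Finset.filter_filter]
  congr 1
  · refine Finset.sum_congr (Finset.filter_congr fun T _ => Iff.rfl) fun T _ => ?_
    rw [aeval_monomial_point, map_one, one_mul]
  · refine Finset.sum_congr (Finset.filter_congr fun T _ => Iff.rfl) fun T _ => ?_
    rw [aeval_monomial_point]

theorem pairing_point (T : Finset E) (n : ℕ) : pairing R.vector (point G.graph T n) =
    n - ∑ i, nRemoved G R.mode (Mode.jet i) T - 2 * nRemoved G R.mode Mode.soft T := by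
  -- Written with indicators of the modes, the weights sum over the removed edges to the numbers
  -- `n_{J_i}` and `n_S`.
  have hv : ∀ e, R.vector (some e) = ∑ i, (if R.mode e = Mode.jet i then (-1 : ℤ) else 0) +
      if R.mode e = Mode.soft then -2 else 0 := by
    intro e
    cases h : R.mode e <;> simp [vector, h]
  have hn : ∀ m, nRemoved G R.mode m T =
      ((removed G.graph T).filter (fun e => R.mode e = m)).card := by
    intro m
    rw [nRemoved, ← Set.ncard_coe_finset]
    congr 2
    ext e
    simp only [removed, Set.mem_sdiff, Finset.mem_coe, Finset.mem_filter, Finset.mem_univ, true_and,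
      edgesOf, Set.mem_ofPred_eq]
    tauto
  have h1 : pairing R.vector (point G.graph T n) =
      n + ∑ e ∈ removed G.graph T, R.vector (some e) := by
    rw [point, pairing_add, pairing_sum, pairing_single]
    simp [pairing_single, vector]
  rw [h1]
  simp only [hv, Finset.sum_add_distrib, hn]
  rw [Finset.sum_comm]
  simp only [← Finset.sum_filter, Finset.sum_const, nsmul_eq_mul]
  rw [← Finset.sum_mul]
  ring

end Region

/-! ### Momentum flow through spanning 2-trees -/

section Kinematics

variable {K N : ℕ} {M : Type*} [AddCommGroup M] [Module ℝ M]

theorem HardSet.compl {I : Finset (Leg K N)} (h : HardSet I) : HardSet Iᶜ := by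
  refine ⟨fun h' => h.2.1 (by simpa using h'), fun h' => h.1 (by simpa using h'), ?_⟩
  rintro ⟨i, hi | hi⟩
  · exact h.2.2 ⟨i, Or.inr hi⟩
  · exact h.2.2 ⟨i, Or.inl (by simpa using hi)⟩

variable {Q : QuadraticForm ℝ M} {k : Leg K N → M}

/-- If `p_i` were the only external momentum, conservation would give `p_i = 0`, contradicting `p_i
^ 2 ≠ 0`. -/
theorem WideAngleMomenta.exists_ne_inl (hk : WideAngleMomenta Q k) (i : Fin K) :
    ∃ l : Leg K N, l ≠ Sum.inl i := by
  by_contra! hcon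
  refine hk.p_sq_ne_zero i ?_
  have h := hk.conservation
  rw [Finset.sum_eq_single (Sum.inl i) (fun l _ hl => absurd (hcon l) hl) (by simp)] at h
  rw [h, map_zero]

/-- If equality held, `p_i` and `p_j` would be the only external momenta, and `(p_i + p_j) ^ 2`
would vanish by conservation instead of being large. This makes the `p_i` that flows through a
2-tree unique. -/
theorem WideAngleMomenta.singleton_ne_compl (hk : WideAngleMomenta Q k) (i j : Fin K) :
    ({Sum.inl i} : Finset (Leg K N)) ≠ {Sum.inl j}ᶜ := by
  intro h
  have hij : i ≠ j := by
    rintro rfl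
    have h1 : Sum.inl i ∈ ({Sum.inl i} : Finset (Leg K N))ᶜ := h ▸ Finset.mem_singleton_self _
    simp at h1
  refine (hk.p_mul_p_large i j hij).2.1 ?_
  rw [Finset.eq_univ_iff_forall]
  intro l
  by_cases hl : l = Sum.inl j
  · simp [hl]
  · have h1 : l ∈ ({Sum.inl i} : Finset (Leg K N)) := by
      rw [h]
      simpa using hl
    simp only [Finset.mem_singleton] at h1
    simp [h1]

theorem WideAngleMomenta.exists_notMem_pair (hk : WideAngleMomenta Q k) {i j : Fin K}
    (hij : i ≠ j) : ∃ l : Leg K N, l ≠ Sum.inl i ∧ l ≠ Sum.inl j := by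
  by_contra! hcon
  refine (hk.p_mul_p_large i j hij).2.1 (Finset.eq_univ_iff_forall.2 fun l => ?_)
  by_cases hl : l = Sum.inl i
  · simp [hl]
  · simp [hcon l hl]

end Kinematics

section Flow

variable {α E : Type*} {K N : ℕ} {M : Type*} [AddCommGroup M] [Module ℝ M]
  {Q : QuadraticForm ℝ M} {k : Leg K N → M} {Γ : Graph α E} {leg : Leg K N → α} {T : Finset E}

theorem mem_legsAt {x : α} {l : Leg K N} :
    l ∈ legsAt Γ leg T x ↔ Reachable (Γ.restrict T) x (leg l) := by
  simp [legsAt]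

theorem legsAt_congr {x y : α} (h : Reachable (Γ.restrict T) x y) :
    legsAt Γ leg T x = legsAt Γ leg T y := by
  ext l
  rw [mem_legsAt, mem_legsAt]
  exact ⟨h.symm.trans, h.trans⟩

variable (hleg : ∀ l, leg l ∈ Γ.vertexSet)
include hleg

theorem IsSpanningTwoTree.legsAt_eq_compl (hT : IsSpanningTwoTree Γ T) {x y : α}
    (hx : x ∈ Γ.vertexSet) (hy : y ∈ Γ.vertexSet) (hxy : ¬ Reachable (Γ.restrict T) x y) :
    legsAt Γ leg T y = (legsAt Γ leg T x)ᶜ := by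
  ext l
  rw [Finset.mem_compl, mem_legsAt, mem_legsAt]
  exact ⟨fun h h' => hxy (h'.trans h.symm),
    fun h => (hT.reachable_or hx hy (hleg l) hxy).resolve_left h⟩

theorem IsSpanningTwoTree.legsAt_eq_or (hT : IsSpanningTwoTree Γ T) {x y : α}
    (hx : x ∈ Γ.vertexSet) (hy : y ∈ Γ.vertexSet) :
    legsAt Γ leg T y = legsAt Γ leg T x ∨ legsAt Γ leg T y = (legsAt Γ leg T x)ᶜ := by
  by_cases h : Reachable (Γ.restrict T) x y
  · exact Or.inl (legsAt_congr h).symm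
  · exact Or.inr (hT.legsAt_eq_compl hleg hx hy h)

theorem IsSpanningTwoTree.isolates_compl (hT : IsSpanningTwoTree Γ T) {I : Finset (Leg K N)}
    (h : Isolates Γ leg T I) : Isolates Γ leg T Iᶜ := by
  obtain ⟨x, hx, rfl⟩ := h
  obtain ⟨y, hy, hxy⟩ := hT.exists_not_reachable x
  exact ⟨y, hy, hT.legsAt_eq_compl hleg hx hy hxy⟩

theorem IsSpanningTwoTree.isolates_eq_or (hT : IsSpanningTwoTree Γ T) {I I' : Finset (Leg K N)}
    (h : Isolates Γ leg T I) (h' : Isolates Γ leg T I') : I' = I ∨ I' = Iᶜ := by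
  obtain ⟨x, hx, rfl⟩ := h
  obtain ⟨y, hy, rfl⟩ := h'
  exact hT.legsAt_eq_or hleg hx hy

theorem FlowsHard.of_isolates (hT : IsSpanningTwoTree Γ T) {I : Finset (Leg K N)}
    (h : Isolates Γ leg T I) (hI : HardSet I) : FlowsHard Γ leg T := fun x hx => by
  rcases hT.isolates_eq_or hleg h ⟨x, hx, rfl⟩ with h' | h'
  · rwa [h']
  · rw [h']
    exact hI.compl

section Fintype

variable [Fintype E]

theorem IsSpanningTwoTree.twoTreeInvariant_eq (hT : IsSpanningTwoTree Γ T) (hk : ∑ l, k l = 0)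
    {I : Finset (Leg K N)} (h : Isolates Γ leg T I) :
    twoTreeInvariant Q k Γ leg T = Q (∑ l ∈ I, k l) := by
  obtain ⟨x, hx, rfl⟩ := h
  exact (WideAngle.twoTreeInvariant_eq Q k hk Γ leg hleg T hT x hx).symm

theorem IsSpanningTwoTree.legsAt_ne_univ (hT : IsSpanningTwoTree Γ T) (hk : ∑ l, k l = 0)
    (hs : twoTreeInvariant Q k Γ leg T ≠ 0) {x : α} (hx : x ∈ Γ.vertexSet) :
    legsAt Γ leg T x ≠ Finset.univ := fun h => by
  rw [hT.twoTreeInvariant_eq hleg hk ⟨x, hx, h⟩, hk, map_zero] at hs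
  exact hs rfl

theorem IsSpanningTwoTree.exists_mem_legsAt (hT : IsSpanningTwoTree Γ T) (hk : ∑ l, k l = 0)
    (hs : twoTreeInvariant Q k Γ leg T ≠ 0) {x : α} (hx : x ∈ Γ.vertexSet) :
    ∃ l, Reachable (Γ.restrict T) x (leg l) := by
  by_contra! hcon
  have h : legsAt Γ leg T x = ∅ := Finset.eq_empty_of_forall_notMem fun l hl =>
    hcon l (mem_legsAt.1 hl)
  rw [hT.twoTreeInvariant_eq hleg hk ⟨x, hx, h⟩] at hs
  simp at hs

/-- As `s_T ≠ 0`, no component carries none or all of the external lines. If it is the complement of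
`p_i` that flows into one component, then `p_i` flows into the other. -/
theorem IsSpanningTwoTree.flowsP_or_flowsHard (hT : IsSpanningTwoTree Γ T) (hk : ∑ l, k l = 0)
    (hs : twoTreeInvariant Q k Γ leg T ≠ 0) :
    (∃ i, FlowsP Γ leg T i) ∨ FlowsHard Γ leg T := by
  obtain ⟨x, hx⟩ : Γ.vertexSet.Nonempty := by
    obtain ⟨-, -, x, hx, -⟩ := hT
    exact ⟨x, hx⟩
  by_cases h : OnShellSet (legsAt Γ leg T x)
  · left
    obtain ⟨i, h | h⟩ := h
    · exact ⟨i, x, hx, h⟩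
    · have := hT.isolates_compl hleg ⟨x, hx, rfl⟩
      exact ⟨i, by rwa [h] at this⟩
  · refine Or.inr (FlowsHard.of_isolates hleg hT ⟨x, hx, rfl⟩
      ⟨?_, hT.legsAt_ne_univ hleg hk hs hx, h⟩)
    obtain ⟨l, hl⟩ := hT.exists_mem_legsAt hleg hk hs hx
    exact Finset.ne_empty_of_mem (mem_legsAt.2 hl)

end Fintype

omit hleg in
theorem FlowsHard.not_flowsP (h : FlowsHard Γ leg T) (i : Fin K) : ¬ FlowsP Γ leg T i := by
  rintro ⟨x, hx, hi⟩
  exact (h x hx).2.2 ⟨i, Or.inl hi⟩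

theorem FlowsP.unique (hT : IsSpanningTwoTree Γ T) (hk : WideAngleMomenta Q k) {i j : Fin K}
    (hi : FlowsP Γ leg T i) (hj : FlowsP Γ leg T j) : i = j := by
  rcases hT.isolates_eq_or hleg hi hj with h | h
  · simpa using h.symm
  · exact absurd h (hk.singleton_ne_compl j i)

theorem twoTreeInvariant_of_flowsP [Fintype E] (hT : IsSpanningTwoTree Γ T)
    (hk : WideAngleMomenta Q k) {i : Fin K} (hi : FlowsP Γ leg T i) :
    twoTreeInvariant Q k Γ leg T = Q (k (Sum.inl i)) := by
  rw [hT.twoTreeInvariant_eq hleg hk.conservation hi, Finset.sum_singleton]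

theorem twoTreeInvariant_ne_zero_of_flowsHard [Fintype E] (hT : IsSpanningTwoTree Γ T)
    (hk : WideAngleMomenta Q k) (h : FlowsHard Γ leg T) :
    twoTreeInvariant Q k Γ leg T ≠ 0 := by
  obtain ⟨-, -, x, hx, -⟩ := id hT
  rw [hT.twoTreeInvariant_eq hleg hk.conservation ⟨x, hx, rfl⟩]
  exact hk.nonexceptional _ (h x hx)

omit hleg in
theorem lamPower_of_flowsP {i : Fin K} (h : FlowsP Γ leg T i) : lamPower Γ leg T = 1 :=
  if_pos ⟨i, h⟩

omit hleg in
theorem lamPower_of_flowsHard (h : FlowsHard Γ leg T) : lamPower Γ leg T = 0 :=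
  if_neg fun ⟨i, hi⟩ => h.not_flowsP i hi

end Flow

/-! ### Leading spanning trees and 2-trees -/

section Parts

variable {V E : Type*} {K N : ℕ} {G : ScatteringGraph V E K N} {μ : E → Mode K}

theorem part_jet_subset_hardJetPart (i : Fin K) (T : Finset E) :
    part G μ (Mode.jet i) T ⊆ hardJetPart G μ T := fun e he => by
  obtain ⟨h1, h2, h3⟩ := mem_part.1 he
  exact mem_hardJetPart.2 ⟨h1, h2, by simp [h3]⟩

theorem part_hard_subset_hardJetPart (T : Finset E) :
    part G μ Mode.hard T ⊆ hardJetPart G μ T := fun e he => by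
  obtain ⟨h1, h2, h3⟩ := mem_part.1 he
  exact mem_hardJetPart.2 ⟨h1, h2, by simp [h3]⟩

theorem Acyclic.hard {T : Finset E} (h : Acyclic (G.graph.restrict T)) :
    Acyclic ((hardGraph G μ).restrict (part G μ Mode.hard T)) :=
  h.of_isLink (part_subset _ _) fun _ _ _ hl => (hardGraph_isLink.1 hl).2

theorem Acyclic.hardJet {T : Finset E} (h : Acyclic (G.graph.restrict T)) :
    Acyclic ((hardJetGraph G μ).restrict (hardJetPart G μ T)) :=
  h.of_isLink (hardJetPart_subset _) fun _ _ _ hl => (hardJetGraph_isLink.1 hl).2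

theorem part_hard_subset_edgeSet (T : Finset E) :
    (part G μ Mode.hard T : Set E) ⊆ (hardGraph G μ).edgeSet := by
  rw [hardGraph_edgeSet]
  exact part_subset_edgesOf _ _

theorem hardJetPart_subset_edgeSet (T : Finset E) :
    (hardJetPart G μ T : Set E) ⊆ (hardJetGraph G μ).edgeSet := by
  rw [hardJetGraph_edgeSet]
  exact fun e he => (Finset.mem_filter.1 (Finset.mem_coe.1 he)).2

theorem part_jet_subset_edgeSet (i : Fin K) (T : Finset E) :
    (part G μ (Mode.jet i) T : Set E) ⊆ (jetTilde G μ i).edgeSet := by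
  rw [jetTilde_edgeSet]
  exact part_subset_edgesOf _ _

theorem part_soft_subset_edgeSet (T : Finset E) :
    (part G μ Mode.soft T : Set E) ⊆ (softTilde G μ).edgeSet := by
  rw [softTilde_edgeSet]
  exact part_subset_edgesOf _ _

theorem jetPairPart_subset_edgeSet (i j : Fin K) (T : Finset E) :
    (jetPairPart G μ i j T : Set E) ⊆ (jetPairTilde G μ i j).edgeSet := by
  rw [jetPairTilde_edgeSet]
  exact fun e he => (Finset.mem_filter.1 (Finset.mem_coe.1 he)).2

/-- A vertex of `J_i` joined to the auxiliary vertex of the contracted jet graph is joined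
to `H`. -/
theorem exists_hardVerts_of_jetTilde {T : Finset E} {i : Fin K} {v : V} (hv : v ∈ jetVerts G μ i)
    (h : Reachable ((jetTilde G μ i).restrict (part G μ (Mode.jet i) T))
      (contractVertex (jetVerts G μ i) v) none) :
    ∃ u ∈ hardVerts G μ, Reachable (G.graph.restrict (hardJetPart G μ T)) v u := by
  obtain ⟨u, hu, hr⟩ := Reachable.lift_contract_none h
  exact (Reachable.jet_or_hard hv (hr.mono (part_jet_subset_hardJetPart i T))).resolve_left hu

/-- A soft vertex joined to the auxiliary vertex of the contracted soft graph is joined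
to `H ∪ J`. -/
theorem exists_hardJetVerts_of_softTilde {T : Finset E} {v : V} (hv : v ∈ G.graph.vertexSet)
    (h : Reachable ((softTilde G μ).restrict (part G μ Mode.soft T))
      (contractVertex (softVerts G μ) v) none) :
    ∃ u ∈ hardJetVerts G μ, Reachable (G.graph.restrict T) v u := by
  obtain ⟨u, hu, hr⟩ := Reachable.lift_contract_none h
  exact ⟨u, mem_hardJetVerts_of_notMem (hr.mem hv) hu, hr.mono (part_subset _ _)⟩

/-- `X` holds the representatives needed besides the auxiliary vertex: none if the whole jet is
joined to `H`, one if a piece of it is cut off. -/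
theorem covers_jetTilde {T : Finset E} {i : Fin K} (X : Finset V)
    (h : ∀ v ∈ jetVerts G μ i, ∃ u, (u ∈ hardVerts G μ ∨ u ∈ X) ∧
      Reachable (G.graph.restrict (hardJetPart G μ T)) v u) :
    Covers (jetTilde G μ i) (part G μ (Mode.jet i) T)
      (insert none (X.image (contractVertex (jetVerts G μ i)))) := by
  rintro _ ⟨v, hv, rfl⟩
  change ∃ x ∈ _, Reachable _ x (contractVertex (jetVerts G μ i) v)
  by_cases hvi : v ∈ jetVerts G μ i
  · obtain ⟨u, hu | hu, hr⟩ := h v hvi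
    · refine ⟨none, by simp, ?_⟩
      have h1 := (hr.jetTilde i).symm
      rwa [contractVertex_of_notMem (notMem_jetVerts_of_hardVerts hu i)] at h1
    · exact ⟨_, Finset.mem_insert_of_mem (Finset.mem_image_of_mem _ hu), (hr.jetTilde i).symm⟩
  · exact ⟨none, by simp, by rw [contractVertex_of_notMem hvi]; exact Reachable.refl _ _⟩

theorem covers_softTilde {T : Finset E}
    (h : ∀ v ∈ G.graph.vertexSet, ∃ u ∈ hardJetVerts G μ, Reachable (G.graph.restrict T) v u) :
    Covers (softTilde G μ) (part G μ Mode.soft T) {none} := by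
  rintro _ ⟨v, hv, rfl⟩
  change ∃ x ∈ _, Reachable _ x (contractVertex (softVerts G μ) v)
  obtain ⟨u, hu, hr⟩ := h v hv
  refine ⟨none, by simp, ?_⟩
  have h1 := (hr.softTilde (μ := μ)).symm
  rwa [contractVertex_of_notMem (notMem_softVerts_of_hardJetVerts hu)] at h1

end Parts

/-! ### Deficits of a forest, and the leading spanning trees -/

namespace Region

variable {V E : Type*} {K N : ℕ} {G : ScatteringGraph V E K N} (R : Region G)

/-- The number of edges that `T` lacks to be connected within `H`, for a forest `T`. -/
noncomputable def hardDeficit (T : Finset E) : ℤ :=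
  (hardVerts G R.mode).ncard - 1 - (part G R.mode Mode.hard T).card

/-- The number of edges that `T` lacks to be connected within `H ∪ J`, for a forest `T`. -/
noncomputable def hardJetDeficit (T : Finset E) : ℤ :=
  (hardJetVerts G R.mode).ncard - 1 - (hardJetPart G R.mode T).card

variable [Finite V] {T : Finset E}

theorem hardDeficit_nonneg (h : Acyclic (G.graph.restrict T)) : 0 ≤ R.hardDeficit T := by
  obtain ⟨v, hv⟩ := R.exists_mem_hardVerts
  have h1 := (h.hard (μ := R.mode)).card_le (X := {v}) (part_hard_subset_edgeSet T)
    (by rw [hardGraph_vertexSet]; simpa using hv) (by simp)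
  rw [hardGraph_vertexSet, Finset.card_singleton] at h1
  rw [hardDeficit]
  omega

/-- The right-hand side is the number of components of the forest within `H ∪ J`, and `X` meets each
of them at most once. -/
theorem card_le_hardJetDeficit (h : Acyclic (G.graph.restrict T)) {X : Finset V}
    (hX : (X : Set V) ⊆ hardJetVerts G R.mode)
    (hne : ∀ x ∈ X, ∀ y ∈ X,
      Reachable (G.graph.restrict (hardJetPart G R.mode T)) x y → x = y) :
    X.card ≤ R.hardJetDeficit T + 1 := by
  have h1 := (h.hardJet (μ := R.mode)).card_le (X := X) (hardJetPart_subset_edgeSet T) hX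
    (fun x hx y hy hr => hne x hx y hy (hr.of_hardJetGraph subset_rfl))
  rw [hardJetGraph_vertexSet] at h1
  rw [hardJetDeficit]
  omega

theorem hardJetDeficit_nonneg (h : Acyclic (G.graph.restrict T)) : 0 ≤ R.hardJetDeficit T := by
  obtain ⟨v, hv⟩ := R.exists_mem_hardVerts
  have h1 := R.card_le_hardJetDeficit h (X := {v})
    (by simpa using mem_hardJetVerts.2 (Or.inl hv)) (by simp)
  rw [Finset.card_singleton] at h1
  push_cast at h1
  linarith

theorem hardTree_of_deficit (h : Acyclic (G.graph.restrict T)) (hd : R.hardDeficit T = 0) :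
    IsSpanningTree (hardGraph G R.mode) (part G R.mode Mode.hard T) := by
  obtain ⟨v, hv⟩ := R.exists_mem_hardVerts
  refine isSpanningTree_of_acyclic (part_hard_subset_edgeSet T) h.hard hv ?_
  rw [hardGraph_vertexSet]
  rw [hardDeficit] at hd
  omega

theorem hardDeficit_of_hardTree
    (h : IsSpanningTree (hardGraph G R.mode) (part G R.mode Mode.hard T)) :
    R.hardDeficit T = 0 := by
  have h1 := h.card
  rw [hardGraph_vertexSet] at h1
  rw [hardDeficit]
  omega

/-- The case of equality in `card_le_hardJetDeficit`: every component within `H ∪ J` then contains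
an element of `X`. -/
theorem exists_reachable_of_hardJetDeficit (h : Acyclic (G.graph.restrict T)) {X : Finset V}
    (hX : (X : Set V) ⊆ hardJetVerts G R.mode)
    (hne : ∀ x ∈ X, ∀ y ∈ X,
      Reachable (G.graph.restrict (hardJetPart G R.mode T)) x y → x = y)
    (hd : R.hardJetDeficit T + 1 = X.card) {v : V} (hv : v ∈ hardJetVerts G R.mode) :
    ∃ x ∈ X, Reachable (G.graph.restrict (hardJetPart G R.mode T)) x v := by
  obtain ⟨x, hx, hr⟩ := (h.hardJet (μ := R.mode)).covers (X := X) (hardJetPart_subset_edgeSet T) hX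
    (fun x hx y hy hr => hne x hx y hy (hr.of_hardJetGraph subset_rfl))
    (by
      rw [hardJetGraph_vertexSet]
      rw [hardJetDeficit] at hd
      omega) v hv
  exact ⟨x, hx, hr.of_hardJetGraph subset_rfl⟩

omit [Finite V] in
theorem reachable_of_hardTree
    (h : IsSpanningTree (hardGraph G R.mode) (part G R.mode Mode.hard T)) {u v : V}
    (hu : u ∈ hardVerts G R.mode) (hv : v ∈ hardVerts G R.mode) :
    Reachable (G.graph.restrict (hardJetPart G R.mode T)) u v :=
  (h.reachable hu hv).of_hardGraph (part_hard_subset_hardJetPart T)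

theorem ncard_eq_of_jetTree {i : Fin K}
    (h : IsSpanningTree (jetTilde G R.mode i) (part G R.mode (Mode.jet i) T)) :
    (part G R.mode (Mode.jet i) T).card = (jetVerts G R.mode i).ncard := by
  have h1 := h.card
  rw [R.ncard_jetTilde] at h1
  omega

theorem ncard_eq_of_softTree
    (h : IsSpanningTree (softTilde G R.mode) (part G R.mode Mode.soft T)) :
    (part G R.mode Mode.soft T).card = (softVerts G R.mode).ncard := by
  have h1 := h.card
  rw [R.ncard_softTilde] at h1
  omega

omit [Finite V] in
theorem exists_hardVerts_of_jetTree {i : Fin K}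
    (h : IsSpanningTree (jetTilde G R.mode i) (part G R.mode (Mode.jet i) T))
    {v : V} (hv : v ∈ jetVerts G R.mode i) :
    ∃ u ∈ hardVerts G R.mode, Reachable (G.graph.restrict (hardJetPart G R.mode T)) v u :=
  exists_hardVerts_of_jetTilde hv
    (h.reachable ⟨v, hv.1, rfl⟩ (R.none_mem_jetTilde i))

omit [Finite V] in
theorem exists_hardJetVerts_of_softTree
    (h : IsSpanningTree (softTilde G R.mode) (part G R.mode Mode.soft T))
    {v : V} (hv : v ∈ G.graph.vertexSet) :
    ∃ u ∈ hardJetVerts G R.mode, Reachable (G.graph.restrict T) v u :=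
  exists_hardJetVerts_of_softTilde hv (h.reachable ⟨v, hv, rfl⟩ R.none_mem_softTilde)

/-- The summands may be negative for a general forest: if `T` is disconnected within `H`, its jet
edges can form loops once `H` is contracted. -/
theorem hardJetDeficit_eq (T : Finset E) : R.hardJetDeficit T =
    R.hardDeficit T + ∑ i, (((jetVerts G R.mode i).ncard : ℤ) -
      (part G R.mode (Mode.jet i) T).card) := by
  rw [hardJetDeficit, hardDeficit, ncard_hardJetVerts, card_hardJetPart, Finset.sum_sub_distrib]
  push_cast
  ring

/-- Spanning trees of `H`, the contracted jet graphs and the contracted soft graph combine to a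
spanning tree. -/
theorem isSpanningTree_of_parts (hE : (T : Set E) ⊆ G.graph.edgeSet)
    (hH : IsSpanningTree (hardGraph G R.mode) (part G R.mode Mode.hard T))
    (hJ : ∀ i, IsSpanningTree (jetTilde G R.mode i) (part G R.mode (Mode.jet i) T))
    (hS : IsSpanningTree (softTilde G R.mode) (part G R.mode Mode.soft T)) :
    IsSpanningTree G.graph T ∧ R.hardDeficit T = 0 ∧ R.hardJetDeficit T = 0 := by
  obtain ⟨v, hv⟩ := R.exists_mem_hardVerts
  have hd := R.hardDeficit_of_hardTree hH
  have hd' : R.hardJetDeficit T = 0 := by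
    rw [R.hardJetDeficit_eq, hd]
    simp [R.ncard_eq_of_jetTree (hJ _)]
  refine ⟨isSpanningTree_of_covers (x := v) hE hv.1 (fun w hw => ⟨v, by simp, ?_⟩) ?_, hd, hd'⟩
  · obtain ⟨u, hu, hr⟩ := R.exists_hardJetVerts_of_softTree hS hw
    obtain ⟨u', hu', hr'⟩ : ∃ u' ∈ hardVerts G R.mode,
        Reachable (G.graph.restrict (hardJetPart G R.mode T)) u u' := by
      rcases mem_hardJetVerts.1 hu with hu | ⟨i, hu⟩
      · exact ⟨u, hu, Reachable.refl _ _⟩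
      · exact R.exists_hardVerts_of_jetTree (hJ i) hu
    exact (hr.trans ((hr'.trans (R.reachable_of_hardTree hH hu' hv)).mono
      (hardJetPart_subset T))).symm
  · have h1 := R.ncard_eq_of_softTree hS
    have h2 := card_eq_hardJetPart_add (μ := R.mode) hE
    have h3 := ncard_vertexSet (G := G) (μ := R.mode)
    rw [hardJetDeficit] at hd'
    omega

theorem softTree_of_reachable (h : ∀ v ∈ G.graph.vertexSet, ∃ u ∈ hardJetVerts G R.mode,
      Reachable (G.graph.restrict T) v u)
    (hc : (part G R.mode Mode.soft T).card = (softVerts G R.mode).ncard) :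
    IsSpanningTree (softTilde G R.mode) (part G R.mode Mode.soft T) := by
  refine isSpanningTree_of_covers (part_soft_subset_edgeSet T) R.none_mem_softTilde
    (covers_softTilde h) ?_
  rw [R.ncard_softTilde, hc]

theorem ncard_le_of_jet {i : Fin K} (h : ∀ v ∈ jetVerts G R.mode i, ∃ u ∈ hardVerts G R.mode,
      Reachable (G.graph.restrict (hardJetPart G R.mode T)) v u) :
    (jetVerts G R.mode i).ncard ≤ (part G R.mode (Mode.jet i) T).card := by
  have h1 := (covers_jetTilde ∅ fun v hv => by
    obtain ⟨u, hu, hr⟩ := h v hv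
    exact ⟨u, Or.inl hu, hr⟩).card_le (part_jet_subset_edgeSet i T)
  rw [R.ncard_jetTilde] at h1
  simpa using h1

theorem jetTree_of_reachable {i : Fin K} (h : ∀ v ∈ jetVerts G R.mode i, ∃ u ∈ hardVerts G R.mode,
      Reachable (G.graph.restrict (hardJetPart G R.mode T)) v u)
    (hc : (part G R.mode (Mode.jet i) T).card = (jetVerts G R.mode i).ncard) :
    IsSpanningTree (jetTilde G R.mode i) (part G R.mode (Mode.jet i) T) := by
  refine isSpanningTree_of_covers (part_jet_subset_edgeSet i T) (R.none_mem_jetTilde i) ?_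
    (by rw [R.ncard_jetTilde, hc])
  simpa using covers_jetTilde ∅ fun v hv => by
    obtain ⟨u, hu, hr⟩ := h v hv
    exact ⟨u, Or.inl hu, hr⟩

/-- The jets in a spanning forest whose number of jet edges is the number of jet vertices. -/
theorem jetTree_of_sum (h : ∀ i, ∀ v ∈ jetVerts G R.mode i, ∃ u ∈ hardVerts G R.mode,
      Reachable (G.graph.restrict (hardJetPart G R.mode T)) v u)
    (hd : R.hardJetDeficit T = R.hardDeficit T) (i : Fin K) :
    IsSpanningTree (jetTilde G R.mode i) (part G R.mode (Mode.jet i) T) := by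
  refine R.jetTree_of_reachable (h i) ?_
  rw [R.hardJetDeficit_eq, add_eq_left, Finset.sum_sub_distrib, sub_eq_zero] at hd
  -- Each jet has at least as many edges of `T` as it has vertices, and the totals agree, so
  -- equality holds jet by jet.
  have h1 := (Finset.sum_eq_sum_iff_of_le (s := Finset.univ)
    (f := fun i => (jetVerts G R.mode i).ncard)
    (g := fun i => (part G R.mode (Mode.jet i) T).card)
    fun i _ => R.ncard_le_of_jet (h i)).1 (by exact_mod_cast hd)
  exact (h1 i (Finset.mem_univ i)).symm

/-- With `d' = 0` the tree is already connected within `H ∪ J`, so each jet is joined to `H` there,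
and equality of the deficits fixes the number of edges in each jet. The remaining edges are as many
as the soft vertices. -/
theorem parts_of_isSpanningTree (hT : IsSpanningTree G.graph T) (hd : R.hardDeficit T = 0)
    (hd' : R.hardJetDeficit T = 0) :
    IsSpanningTree (hardGraph G R.mode) (part G R.mode Mode.hard T) ∧
      (∀ i, IsSpanningTree (jetTilde G R.mode i) (part G R.mode (Mode.jet i) T)) ∧
      IsSpanningTree (softTilde G R.mode) (part G R.mode Mode.soft T) := by
  obtain ⟨v, hv⟩ := R.exists_mem_hardVerts
  have hvHJ : v ∈ hardJetVerts G R.mode := mem_hardJetVerts.2 (Or.inl hv)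
  refine ⟨R.hardTree_of_deficit hT.2.1 hd, R.jetTree_of_sum (fun i w hw => ⟨v, hv, ?_⟩)
    (hd'.trans hd.symm), R.softTree_of_reachable
      (fun w hw => ⟨v, hvHJ, hT.reachable hw hv.1⟩) ?_⟩
  · obtain ⟨x, hx, hr⟩ := R.exists_reachable_of_hardJetDeficit hT.2.1 (X := {v})
      (by simpa using hvHJ) (by simp) (by simp [hd']) (mem_hardJetVerts.2 (Or.inr ⟨i, hw⟩))
    rw [Finset.mem_singleton] at hx
    exact hx ▸ hr.symm
  · have h1 := hT.card
    have h2 := card_eq_hardJetPart_add (μ := R.mode) hT.1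
    have h3 := ncard_vertexSet (G := G) (μ := R.mode)
    rw [hardJetDeficit] at hd'
    omega

/-- This is where the connectedness of `H` and of the contracted graphs enters: it ensures that the
lower bound for the power of `λ` is attained. -/
theorem exists_leading_tree [Fintype E] :
    ∃ T, IsSpanningTree G.graph T ∧ R.hardDeficit T = 0 ∧ R.hardJetDeficit T = 0 := by
  obtain ⟨A, hA⟩ := R.hard_connected.exists_isSpanningTree
  choose B hB using fun i => (R.jet_attached i).exists_isSpanningTree
  obtain ⟨C, hC⟩ := R.softTilde_connected.exists_isSpanningTree
  have hA' : ∀ e ∈ A, e ∈ edgesOf G R.mode Mode.hard := fun e he => by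
    have := hA.1 he
    rwa [hardGraph_edgeSet] at this
  have hB' : ∀ i, ∀ e ∈ B i, e ∈ edgesOf G R.mode (Mode.jet i) := fun i e he => by
    have := (hB i).1 he
    rwa [jetTilde_edgeSet] at this
  have hC' : ∀ e ∈ C, e ∈ edgesOf G R.mode Mode.soft := fun e he => by
    have := hC.1 he
    rwa [softTilde_edgeSet] at this
  have key : ∀ m, ∀ D : Finset E, (∀ e ∈ D, e ∈ edgesOf G R.mode m) →
      (∀ e ∈ A ∪ Finset.univ.biUnion B ∪ C, R.mode e = m → e ∈ D) →
      D ⊆ A ∪ Finset.univ.biUnion B ∪ C →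
      part G R.mode m (A ∪ Finset.univ.biUnion B ∪ C) = D := by
    intro m D h1 h2 h3
    ext e
    rw [mem_part]
    exact ⟨fun h => h2 e h.1 h.2.2, fun h => ⟨h3 h, (h1 e h).1, (h1 e h).2⟩⟩
  have cases : ∀ e ∈ A ∪ Finset.univ.biUnion B ∪ C,
      (e ∈ A ∧ e ∈ edgesOf G R.mode Mode.hard) ∨
        (∃ i, e ∈ B i ∧ e ∈ edgesOf G R.mode (Mode.jet i)) ∨
        (e ∈ C ∧ e ∈ edgesOf G R.mode Mode.soft) := by
    intro e he
    simp only [Finset.mem_union, Finset.mem_biUnion, Finset.mem_univ, true_and] at he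
    rcases he with (he | ⟨i, he⟩) | he
    · exact Or.inl ⟨he, hA' e he⟩
    · exact Or.inr (Or.inl ⟨i, he, hB' i e he⟩)
    · exact Or.inr (Or.inr ⟨he, hC' e he⟩)
  refine ⟨A ∪ Finset.univ.biUnion B ∪ C, R.isSpanningTree_of_parts ?_ ?_ ?_ ?_⟩
  · intro e he
    rcases cases e he with h | ⟨i, h⟩ | h
    exacts [h.2.1, h.2.1, h.2.1]
  · rw [key Mode.hard A hA' ?_ ?_]
    · exact hA
    · intro e he hm
      rcases cases e he with h | ⟨i, h⟩ | h
      · exact h.1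
      · exact absurd (hm.symm.trans h.2.2) (by simp)
      · exact absurd (hm.symm.trans h.2.2) (by simp)
    · intro e he
      simp [he]
  · intro i
    rw [key (Mode.jet i) (B i) (hB' i) ?_ ?_]
    · exact hB i
    · intro e he hm
      rcases cases e he with h | ⟨j, h⟩ | h
      · exact absurd (hm.symm.trans h.2.2) (by simp)
      · have hij : i = j := by simpa using hm.symm.trans h.2.2
        exact hij ▸ h.1
      · exact absurd (hm.symm.trans h.2.2) (by simp)
    · intro e he
      simp only [Finset.mem_union, Finset.mem_biUnion, Finset.mem_univ, true_and]
      exact Or.inl (Or.inr ⟨i, he⟩)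
  · rw [key Mode.soft C hC' ?_ ?_]
    · exact hC
    · intro e he hm
      rcases cases e he with h | ⟨i, h⟩ | h
      · exact absurd (hm.symm.trans h.2.2) (by simp)
      · exact absurd (hm.symm.trans h.2.2) (by simp)
      · exact h.1
    · intro e he
      simp [he]

/-! ### The power of `λ` of the terms -/

/-- The least value of `r · v` on the exponent vectors of the Lee-Pomeransky polynomial. -/
noncomputable def minPairing : ℤ := -∑ i, R.loopsJ i - 2 * R.loopsS

/-- By Euler's formula `∑ n_{J_i}` exceeds `∑ L(J̃_i)` by `d' - d`. Since `|V| - |T| = c + 1` and `H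
∪ J` accounts for `d' + 1` of this, `n_S` exceeds `L(S̃)` by `c - d'`. With the weights `-1` and
`-2` the sum is `d + d' - 2c`. -/
theorem pairing_of_card [Fintype E] (hE : (T : Set E) ⊆ G.graph.edgeSet) (n c : ℕ)
    (hc : G.graph.vertexSet.ncard = T.card + c + 1) :
    pairing R.vector (point G.graph T n) =
      R.minPairing + n + R.hardDeficit T + R.hardJetDeficit T - 2 * c := by
  have h1 := R.hardJetDeficit_eq T
  have h2 := card_eq_hardJetPart_add (μ := R.mode) hE
  have h3 := ncard_vertexSet (G := G) (μ := R.mode)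
  rw [R.pairing_point, minPairing, R.loopsS_eq]
  simp only [R.loopsJ_eq, nRemoved_eq]
  rw [Finset.sum_sub_distrib] at h1 ⊢
  rw [Finset.sum_sub_distrib]
  have h4 : R.hardJetDeficit T =
    (hardJetVerts G R.mode).ncard - 1 - (hardJetPart G R.mode T).card := rfl
  zify at h2 h3 hc
  linarith

variable {M : Type*} [AddCommGroup M] [Module ℝ M] {Q : QuadraticForm ℝ M} {k : Leg K N → M}

omit [Finite V] in
theorem leg_jet_of_not_reachable {v : V} (hH : ∀ u ∈ hardVerts G R.mode,
      Reachable (G.graph.restrict T) v u) {l : Leg K N}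
    (hl : ¬ Reachable (G.graph.restrict T) v (G.leg l)) :
    ∃ i, l = Sum.inl i ∧ G.leg (Sum.inl i) ∈ jetVerts G R.mode i := by
  rcases mem_hardJetVerts.1 (leg_mem_hardJetVerts (G := G) (μ := R.mode) l) with h | ⟨i, h⟩
  · exact absurd (hH _ h) hl
  · obtain rfl := leg_eq_of_mem_jetVerts h
    exact ⟨i, rfl, h⟩

variable [Fintype E]

/-- The momentum flow through a spanning 2-tree which is connected within `H`. -/
theorem flow_of_hardDeficit_eq_zero (hk : WideAngleMomenta Q k)
    (hT : IsSpanningTwoTree G.graph T) (hs : twoTreeInvariant Q k G.graph G.leg T ≠ 0)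
    (hd : R.hardDeficit T = 0) :
    (∃ i, FlowsP G.graph G.leg T i ∧ G.leg (Sum.inl i) ∈ jetVerts G R.mode i ∧
      ∀ u ∈ hardVerts G R.mode, ¬ Reachable (G.graph.restrict T) u (G.leg (Sum.inl i))) ∨
    ∃ i j, i ≠ j ∧ G.leg (Sum.inl i) ∈ jetVerts G R.mode i ∧
      G.leg (Sum.inl j) ∈ jetVerts G R.mode j ∧
      ∀ u ∈ hardVerts G R.mode, ¬ Reachable (G.graph.restrict T) u (G.leg (Sum.inl i)) ∧
        ¬ Reachable (G.graph.restrict T) u (G.leg (Sum.inl j)) := by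
  obtain ⟨v, hv⟩ := R.exists_mem_hardVerts
  have hH : ∀ u ∈ hardVerts G R.mode, Reachable (G.graph.restrict T) v u := fun u hu =>
    (R.reachable_of_hardTree (R.hardTree_of_deficit hT.2.1 hd) hv hu).mono (hardJetPart_subset T)
  obtain ⟨l, hl⟩ : ∃ l, ¬ Reachable (G.graph.restrict T) v (G.leg l) := by
    by_contra! hcon
    exact hT.legsAt_ne_univ G.leg_mem hk.conservation hs hv.1
      (Finset.eq_univ_iff_forall.2 fun l => mem_legsAt.2 (hcon l))
  obtain ⟨i, rfl, hi⟩ := R.leg_jet_of_not_reachable hH hl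
  by_cases hj : ∃ l, l ≠ Sum.inl i ∧ ¬ Reachable (G.graph.restrict T) v (G.leg l)
  · obtain ⟨l', hl', hr⟩ := hj
    obtain ⟨j, rfl, hj⟩ := R.leg_jet_of_not_reachable hH hr
    exact Or.inr ⟨i, j, fun h => hl' (by rw [h]), hi, hj, fun u hu =>
      ⟨fun h => hl ((hH u hu).trans h), fun h => hr ((hH u hu).trans h)⟩⟩
  · push Not at hj
    refine Or.inl ⟨i, ⟨G.leg (Sum.inl i), G.leg_mem _, ?_⟩, hi, fun u hu h =>
      hl ((hH u hu).trans h)⟩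
    ext l'
    rw [mem_legsAt, Finset.mem_singleton]
    constructor
    · intro h
      by_contra hne
      exact hl ((hj l' hne).trans h.symm)
    · rintro rfl
      exact Reachable.refl _ _

/-- A forest that is connected within `H ∪ J` has all external lines in one component, so that no
momentum flows between the two. -/
theorem one_le_hardJetDeficit (hk : WideAngleMomenta Q k)
    (hT : IsSpanningTwoTree G.graph T) (hs : twoTreeInvariant Q k G.graph G.leg T ≠ 0) :
    1 ≤ R.hardJetDeficit T := by
  have h0 := R.hardJetDeficit_nonneg hT.2.1
  by_contra hcon
  have hd : R.hardJetDeficit T = 0 := by omega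
  obtain ⟨v, hv⟩ := R.exists_mem_hardVerts
  refine hT.legsAt_ne_univ G.leg_mem hk.conservation hs hv.1
    (Finset.eq_univ_iff_forall.2 fun l => mem_legsAt.2 ?_)
  obtain ⟨x, hx, hr⟩ := R.exists_reachable_of_hardJetDeficit hT.2.1 (X := {v})
    (by simpa using mem_hardJetVerts.2 (Or.inl hv)) (by simp) (by simp [hd])
    (leg_mem_hardJetVerts l)
  rw [Finset.mem_singleton] at hx
  exact hx ▸ hr.mono (hardJetPart_subset T)

omit [Finite V] [Fintype E] in
-- Within `H ∪ J` a path can leave a jet only through `H`.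
theorem not_reachable_legs {i j : Fin K} (hij : i ≠ j)
    (hi : G.leg (Sum.inl i) ∈ jetVerts G R.mode i) (hj : G.leg (Sum.inl j) ∈ jetVerts G R.mode j)
    (hH : ∀ u ∈ hardVerts G R.mode, ¬ Reachable (G.graph.restrict T) u (G.leg (Sum.inl i))) :
    ¬ Reachable (G.graph.restrict (hardJetPart G R.mode T))
      (G.leg (Sum.inl i)) (G.leg (Sum.inl j)) := fun h => by
  rcases Reachable.jet_or_hard hi h with h1 | ⟨u, hu, h1⟩
  · exact hij (jetVerts_unique h1 hj)
  · exact hH u hu (h1.symm.mono (hardJetPart_subset T))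

omit [Finite V] [Fintype E] in
/-- A vertex of `H` and ends of `p_i`, `p_j` in the jets are in three components within
`H ∪ J`. -/
theorem eq_of_reachable_triple {v : V} (hv : v ∈ hardVerts G R.mode) {i j : Fin K} (hij : i ≠ j)
    (hi : G.leg (Sum.inl i) ∈ jetVerts G R.mode i) (hj : G.leg (Sum.inl j) ∈ jetVerts G R.mode j)
    (hH : ∀ u ∈ hardVerts G R.mode, ¬ Reachable (G.graph.restrict T) u (G.leg (Sum.inl i)) ∧
      ¬ Reachable (G.graph.restrict T) u (G.leg (Sum.inl j))) :
    ({v, G.leg (Sum.inl i), G.leg (Sum.inl j)} : Finset V).card = 3 ∧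
    (({v, G.leg (Sum.inl i), G.leg (Sum.inl j)} : Finset V) : Set V) ⊆ hardJetVerts G R.mode ∧
    ∀ x ∈ ({v, G.leg (Sum.inl i), G.leg (Sum.inl j)} : Finset V),
      ∀ y ∈ ({v, G.leg (Sum.inl i), G.leg (Sum.inl j)} : Finset V),
        Reachable (G.graph.restrict (hardJetPart G R.mode T)) x y → x = y := by
  have h1 : ¬ Reachable (G.graph.restrict (hardJetPart G R.mode T)) v (G.leg (Sum.inl i)) :=
    fun h => (hH v hv).1 (h.mono (hardJetPart_subset T))
  have h2 : ¬ Reachable (G.graph.restrict (hardJetPart G R.mode T)) v (G.leg (Sum.inl j)) :=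
    fun h => (hH v hv).2 (h.mono (hardJetPart_subset T))
  have h3 := R.not_reachable_legs hij hi hj fun u hu => (hH u hu).1
  have ne : ∀ {x y}, ¬ Reachable (G.graph.restrict (hardJetPart G R.mode T)) x y → x ≠ y :=
    fun h e => h (e ▸ Reachable.refl _ _)
  refine ⟨Finset.card_eq_three.2 ⟨_, _, _, ne h1, ne h2, ne h3, rfl⟩, ?_, ?_⟩
  · intro x hx
    simp only [Finset.coe_insert, Finset.coe_singleton, Set.mem_insert_iff,
      Set.mem_singleton_iff] at hx
    rcases hx with rfl | rfl | rfl
    · exact mem_hardJetVerts.2 (Or.inl hv)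
    · exact leg_mem_hardJetVerts _
    · exact leg_mem_hardJetVerts _
  · intro x hx y hy hr
    simp only [Finset.mem_insert, Finset.mem_singleton] at hx hy
    rcases hx with rfl | rfl | rfl <;> rcases hy with rfl | rfl | rfl
    · rfl
    · exact absurd hr h1
    · exact absurd hr h2
    · exact absurd hr.symm h1
    · rfl
    · exact absurd hr h3
    · exact absurd hr.symm h2
    · exact absurd hr.symm h3
    · rfl

/-- The deficit `d'` contributes at least `1`. If `d` contributes nothing, either a single `p_i`
flows and its factor contributes `1`, or two jet ends are cut off from `H` and `d'` itself is at
least `2`. -/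
theorem two_le_deficit (hk : WideAngleMomenta Q k)
    (hT : IsSpanningTwoTree G.graph T) (hs : twoTreeInvariant Q k G.graph G.leg T ≠ 0) :
    2 ≤ lamPower G.graph G.leg T + R.hardDeficit T + R.hardJetDeficit T := by
  have h0 := R.hardDeficit_nonneg hT.2.1
  have h1 := R.one_le_hardJetDeficit hk hT hs
  by_cases hd : R.hardDeficit T = 0
  · rcases R.flow_of_hardDeficit_eq_zero hk hT hs hd with ⟨i, hi, -⟩ | ⟨i, j, hij, hi, hj, hH⟩
    · rw [lamPower_of_flowsP hi]
      push_cast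
      omega
    · obtain ⟨v, hv⟩ := R.exists_mem_hardVerts
      obtain ⟨h2, h3, h4⟩ := R.eq_of_reachable_triple hv hij hi hj hH
      have h5 := R.card_le_hardJetDeficit hT.2.1 h3 h4
      rw [h2] at h5
      push_cast at h5
      omega
  · omega

theorem minPairing_le (hk : WideAngleMomenta Q k) {r : Option E →₀ ℕ}
    (hr : r ∈ (leePomeransky Q k G.graph G.leg).support) :
    R.minPairing ≤ pairing R.vector r := by
  rcases mem_support_leePomeransky Q k G.leg hr with ⟨T, hT, rfl⟩ | ⟨T, hT, hs, rfl⟩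
  · rw [R.pairing_of_card hT.1 0 0 hT.card]
    have h0 := R.hardDeficit_nonneg hT.2.1
    have h1 := R.hardJetDeficit_nonneg hT.2.1
    push_cast
    linarith
  · rw [R.pairing_of_card hT.1 _ 1 hT.card]
    have h0 := R.two_le_deficit hk hT hs
    push_cast
    linarith

/-- The bound `minPairing_le` is sharp by `exists_leading_tree`, so the face is the level set at
`minPairing`. -/
theorem mem_face_iff (hk : WideAngleMomenta Q k) {r : Option E →₀ ℕ} :
    r ∈ face R.vector (leePomeransky Q k G.graph G.leg) ↔
      r ∈ (leePomeransky Q k G.graph G.leg).support ∧ pairing R.vector r = R.minPairing := by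
  rw [face, Finset.mem_filter]
  refine and_congr_right fun hr => ⟨fun h => le_antisymm ?_ (R.minPairing_le hk hr), fun h r' hr' =>
    h ▸ R.minPairing_le hk hr'⟩
  obtain ⟨T, hT, hd, hd'⟩ := R.exists_leading_tree
  have h1 := h (point G.graph T 0) (by
    rw [mem_support_iff, coeff_point_tree Q k G.leg hT]
    exact one_ne_zero)
  rw [R.pairing_of_card hT.1 0 0 hT.card, hd, hd'] at h1
  simpa using h1

theorem isLeading_iff (hk : WideAngleMomenta Q k) (hT : IsSpanningTree G.graph T) :
    R.IsLeading Q k T 0 ↔ R.hardDeficit T = 0 ∧ R.hardJetDeficit T = 0 := by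
  rw [IsLeading, R.mem_face_iff hk, mem_support_iff, coeff_point_tree Q k G.leg hT,
    R.pairing_of_card hT.1 0 0 hT.card]
  have h0 := R.hardDeficit_nonneg hT.2.1
  have h1 := R.hardJetDeficit_nonneg hT.2.1
  constructor
  · rintro ⟨-, h⟩
    push_cast at h
    constructor <;> linarith
  · rintro ⟨h, h'⟩
    simp [h, h']

/-- The second component lowers the power of `λ` by `2`, which the kinematic factor and the deficits
must exactly make up for. -/
theorem isLeadingTwo_iff (hk : WideAngleMomenta Q k) (hT : IsSpanningTwoTree G.graph T) :
    R.IsLeadingTwo Q k T ↔ twoTreeInvariant Q k G.graph G.leg T ≠ 0 ∧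
      lamPower G.graph G.leg T + R.hardDeficit T + R.hardJetDeficit T = 2 := by
  rw [IsLeadingTwo, IsLeading, R.mem_face_iff hk, mem_support_iff,
    coeff_point_twoTree Q k G.leg hT, R.pairing_of_card hT.1 _ 1 hT.card, neg_ne_zero]
  refine and_congr_right fun _ => ?_
  push_cast
  constructor <;> intro h <;> linarith

end Region

/-! ### The terms of `F` in the leading polynomial -/

section PartOfPart

variable {V E : Type*} {K N : ℕ} {G : ScatteringGraph V E K N} {μ : E → Mode K}

theorem part_hard_hardJetPart (T : Finset E) :
    part G μ Mode.hard (hardJetPart G μ T) = part G μ Mode.hard T := by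
  ext e
  simp only [mem_part, mem_hardJetPart]
  exact ⟨fun h => ⟨h.1.1, h.2⟩, fun h => ⟨⟨h.1, h.2.1, by simp [h.2.2]⟩, h.2⟩⟩

theorem part_jet_hardJetPart (i : Fin K) (T : Finset E) :
    part G μ (Mode.jet i) (hardJetPart G μ T) = part G μ (Mode.jet i) T := by
  ext e
  simp only [mem_part, mem_hardJetPart]
  exact ⟨fun h => ⟨h.1.1, h.2⟩, fun h => ⟨⟨h.1, h.2.1, by simp [h.2.2]⟩, h.2⟩⟩

theorem part_left_jetPairPart (i j : Fin K) (T : Finset E) :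
    part G μ (Mode.jet i) (jetPairPart G μ i j T) = part G μ (Mode.jet i) T := by
  ext e
  simp only [mem_part, mem_jetPairPart]
  tauto

theorem part_right_jetPairPart (i j : Fin K) (T : Finset E) :
    part G μ (Mode.jet j) (jetPairPart G μ i j T) = part G μ (Mode.jet j) T := by
  ext e
  simp only [mem_part, mem_jetPairPart]
  tauto

theorem jetPairPart_subset (i j : Fin K) (T : Finset E) : jetPairPart G μ i j T ⊆ T :=
  Finset.filter_subset _ _

variable (G μ) in
/-- The vertices of the contracted jet graph of `J_i` to which the external lines are attached. -/
noncomputable def jetLeg (i : Fin K) (l : Leg K N) : Option V :=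
  contractVertex (jetVerts G μ i) (G.leg l)

variable (G μ) in
/-- The vertices of the contracted graph `J_i ∪ J_j ∪ S` to which the external lines are
attached. -/
noncomputable def jetPairLeg (i j : Fin K) (l : Leg K N) : Option V :=
  contractVertex (jetPairVerts G μ i j) (G.leg l)

theorem jetLeg_mem (i : Fin K) (l : Leg K N) : jetLeg G μ i l ∈ (jetTilde G μ i).vertexSet :=
  ⟨G.leg l, G.leg_mem l, rfl⟩

theorem jetPairLeg_mem (i j : Fin K) (l : Leg K N) :
    jetPairLeg G μ i j l ∈ (jetPairTilde G μ i j).vertexSet :=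
  ⟨G.leg l, G.leg_mem l, rfl⟩

theorem jetLeg_of_ne {i : Fin K} {l : Leg K N} (hl : l ≠ Sum.inl i) : jetLeg G μ i l = none :=
  contractVertex_of_notMem fun h => hl (leg_eq_of_mem_jetVerts h)

theorem jetPairLeg_of_ne {i j : Fin K} {l : Leg K N} (hi : l ≠ Sum.inl i) (hj : l ≠ Sum.inl j) :
    jetPairLeg G μ i j l = none := by
  refine contractVertex_of_notMem ?_
  rintro ((h | h) | h)
  exacts [hi (leg_eq_of_mem_jetVerts h), hj (leg_eq_of_mem_jetVerts h), leg_notMem_softVerts _ h]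

end PartOfPart

namespace Region

variable {V E : Type*} [Finite V] [Fintype E] {K N : ℕ} {G : ScatteringGraph V E K N}
  (R : Region G) {T : Finset E} {M : Type*} [AddCommGroup M] [Module ℝ M]
  {Q : QuadraticForm ℝ M} {k : Leg K N → M}

omit [Finite V] in
-- The types are defined by counting removed parameters, whereas the arguments count missing edges
-- of `T`. Euler's formula translates between the two, here and in the next two lemmas.
theorem nRemoved_hard_iff {c : ℤ} : nRemoved G R.mode Mode.hard T = R.loopsH + c ↔
    R.hardDeficit T = c := by
  rw [nRemoved_eq, R.loopsH_eq, hardDeficit]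
  constructor <;> intro h <;> linarith

theorem nRemoved_jet_iff {i : Fin K} {c : ℤ} :
    nRemoved G R.mode (Mode.jet i) T = R.loopsJ i + c ↔
      ((jetVerts G R.mode i).ncard : ℤ) = (part G R.mode (Mode.jet i) T).card + c := by
  rw [nRemoved_eq, R.loopsJ_eq]
  constructor <;> intro h <;> linarith

theorem nRemoved_soft_iff {c : ℤ} : nRemoved G R.mode Mode.soft T = R.loopsS + c ↔
    ((softVerts G R.mode).ncard : ℤ) = (part G R.mode Mode.soft T).card + c := by
  rw [nRemoved_eq, R.loopsS_eq]
  constructor <;> intro h <;> linarith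

omit [Fintype E] in
-- For `d' = 1` the soft edges are as many as the soft vertices, as in a spanning tree of the
-- contracted soft graph. For `d' = 2` there is one more: soft edges must then join two of the three
-- components within `H ∪ J`.
theorem card_soft_of_twoTree (hT : IsSpanningTwoTree G.graph T) :
    ((part G R.mode Mode.soft T).card : ℤ) + 1 =
      (softVerts G R.mode).ncard + R.hardJetDeficit T := by
  have h1 := hT.card
  have h2 := card_eq_hardJetPart_add (μ := R.mode) hT.1
  have h3 := ncard_vertexSet (G := G) (μ := R.mode)
  rw [hardJetDeficit]
  omega

omit [Fintype E] in
/-- The numbers of edges in the jets, if only the jets in `A` are not connected to `H`. -/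
theorem card_jet_of_deficit (A : Finset (Fin K))
    (h : ∀ l, (jetVerts G R.mode l).ncard ≤
      (part G R.mode (Mode.jet l) T).card + if l ∈ A then 1 else 0)
    (hd : R.hardJetDeficit T = R.hardDeficit T + A.card) (l : Fin K) :
    (jetVerts G R.mode l).ncard =
      (part G R.mode (Mode.jet l) T).card + if l ∈ A then 1 else 0 := by
  refine (Finset.sum_eq_sum_iff_of_le (s := Finset.univ)
    (f := fun l => (jetVerts G R.mode l).ncard)
    (g := fun l => (part G R.mode (Mode.jet l) T).card + if l ∈ A then 1 else 0)
    fun l _ => h l).1 ?_ l (Finset.mem_univ l)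
  rw [R.hardJetDeficit_eq, add_right_inj, Finset.sum_sub_distrib] at hd
  rw [Finset.sum_add_distrib]
  simp only [Finset.sum_ite_mem, Finset.univ_inter, Finset.sum_const, smul_eq_mul, mul_one]
  zify
  linarith

omit [Fintype E] in
theorem ncard_le_of_jet_vertex {i : Fin K} {x : V} (h : ∀ v ∈ jetVerts G R.mode i,
      ∃ u, (u ∈ hardVerts G R.mode ∨ u = x) ∧
        Reachable (G.graph.restrict (hardJetPart G R.mode T)) v u) :
    (jetVerts G R.mode i).ncard ≤ (part G R.mode (Mode.jet i) T).card + 1 := by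
  have h1 := (covers_jetTilde {x} (by simpa using h)).card_le (part_jet_subset_edgeSet i T)
  have h2 := Finset.card_insert_le (none : Option V)
    (({x} : Finset V).image (contractVertex (jetVerts G R.mode i)))
  rw [R.ncard_jetTilde] at h1
  simp only [Finset.image_singleton, Finset.card_singleton] at h1 h2
  omega

omit [Fintype E] in
theorem jetTwoTree_of_reachable {i : Fin K} {x : V} (hx : x ∈ jetVerts G R.mode i)
    (h : ∀ v ∈ jetVerts G R.mode i, ∃ u, (u ∈ hardVerts G R.mode ∨ u = x) ∧
      Reachable (G.graph.restrict (hardJetPart G R.mode T)) v u)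
    (hc : (jetVerts G R.mode i).ncard = (part G R.mode (Mode.jet i) T).card + 1) :
    IsSpanningTwoTree (jetTilde G R.mode i) (part G R.mode (Mode.jet i) T) ∧
      ¬ Reachable ((jetTilde G R.mode i).restrict (part G R.mode (Mode.jet i) T)) none
        (some x) := by
  have h1 := covers_jetTilde {x} (by simpa using h)
  rw [Finset.image_singleton, contractVertex_of_mem hx] at h1
  exact isSpanningTwoTree_of_covers (part_jet_subset_edgeSet i T) (R.none_mem_jetTilde i)
    ⟨x, hx.1, contractVertex_of_mem hx⟩ (by convert h1) (by rw [R.ncard_jetTilde, hc])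

omit [Finite V] in
/-- In a spanning 2-tree with momentum flow, both components contain vertices of `H ∪ J`. -/
theorem exists_hardJetVerts_of_twoTree (hk : WideAngleMomenta Q k)
    (hT : IsSpanningTwoTree G.graph T) (hs : twoTreeInvariant Q k G.graph G.leg T ≠ 0) {v : V}
    (hv : v ∈ G.graph.vertexSet) :
    ∃ u ∈ hardJetVerts G R.mode, Reachable (G.graph.restrict T) v u := by
  obtain ⟨l, hl⟩ := hT.exists_mem_legsAt G.leg_mem hk.conservation hs hv
  exact ⟨_, leg_mem_hardJetVerts l, hl⟩

/-! #### Terms with a factor `p_i ^ 2` -/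

theorem deficits_of_flowsP (hk : WideAngleMomenta Q k) (hT : IsSpanningTwoTree G.graph T)
    (hL : R.IsLeadingTwo Q k T) {i : Fin K} (hi : FlowsP G.graph G.leg T i) :
    R.hardDeficit T = 0 ∧ R.hardJetDeficit T = 1 := by
  obtain ⟨hs, hL⟩ := (R.isLeadingTwo_iff hk hT).1 hL
  have h0 := R.hardDeficit_nonneg hT.2.1
  have h1 := R.one_le_hardJetDeficit hk hT hs
  rw [lamPower_of_flowsP hi] at hL
  push_cast at hL
  constructor <;> linarith

/-- With `d = 0` and `d' = 1` there are exactly two components within `H ∪ J`, one containing `H`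
and one containing the end of `p_i`. The second cannot leave `J_i`, so all other jets are joined to
`H`, and the edge counts do the rest. -/
theorem parts_of_flowsP (hk : WideAngleMomenta Q k) (hT : IsSpanningTwoTree G.graph T)
    (hL : R.IsLeadingTwo Q k T) {i : Fin K} (hi : FlowsP G.graph G.leg T i) :
    IsSpanningTree (hardGraph G R.mode) (part G R.mode Mode.hard T) ∧
      (IsSpanningTwoTree (jetTilde G R.mode i) (part G R.mode (Mode.jet i) T) ∧
        FlowsP (jetTilde G R.mode i) (jetLeg G R.mode i) (part G R.mode (Mode.jet i) T) i) ∧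
      (∀ j, j ≠ i → IsSpanningTree (jetTilde G R.mode j) (part G R.mode (Mode.jet j) T)) ∧
      IsSpanningTree (softTilde G R.mode) (part G R.mode Mode.soft T) := by
  obtain ⟨hd, hd'⟩ := R.deficits_of_flowsP hk hT hL hi
  have hs := ((R.isLeadingTwo_iff hk hT).1 hL).1
  obtain ⟨v, hv⟩ := R.exists_mem_hardVerts
  have hvHJ : v ∈ hardJetVerts G R.mode := mem_hardJetVerts.2 (Or.inl hv)
  obtain ⟨hiJ, hH⟩ : G.leg (Sum.inl i) ∈ jetVerts G R.mode i ∧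
      ∀ u ∈ hardVerts G R.mode, ¬ Reachable (G.graph.restrict T) u (G.leg (Sum.inl i)) := by
    -- Two jet ends cut off from `H` would make three components within `H ∪ J`, whereas the deficit
    -- `1` leaves only two.
    rcases R.flow_of_hardDeficit_eq_zero hk hT hs hd with ⟨j, hj, h⟩ | ⟨a, b, hab, ha, hb, hH⟩
    · rwa [FlowsP.unique G.leg_mem hT hk hi hj]
    · obtain ⟨h2, h3, h4⟩ := R.eq_of_reachable_triple hv hab ha hb hH
      have h5 := R.card_le_hardJetDeficit hT.2.1 h3 h4
      rw [h2, hd'] at h5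
      norm_num at h5
  have hvp : ¬ Reachable (G.graph.restrict (hardJetPart G R.mode T)) v (G.leg (Sum.inl i)) :=
    fun h => hH v hv (h.mono (hardJetPart_subset T))
  obtain ⟨hc, hp⟩ := eq_of_reachable_pair hvp
  have hreach : ∀ w ∈ hardJetVerts G R.mode,
      Reachable (G.graph.restrict (hardJetPart G R.mode T)) w v ∨
        Reachable (G.graph.restrict (hardJetPart G R.mode T)) w (G.leg (Sum.inl i)) := by
    intro w hw
    obtain ⟨x, hx, hr⟩ := R.exists_reachable_of_hardJetDeficit hT.2.1
      (coe_pair_subset hvHJ (leg_mem_hardJetVerts _)) hp (by rw [hc, hd']; rfl) hw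
    simp only [Finset.mem_insert, Finset.mem_singleton] at hx
    rcases hx with rfl | rfl
    exacts [Or.inl hr.symm, Or.inr hr.symm]
  have hjet : ∀ j, j ≠ i → ∀ w ∈ jetVerts G R.mode j, ∃ u ∈ hardVerts G R.mode,
      Reachable (G.graph.restrict (hardJetPart G R.mode T)) w u := by
    intro j hj w hw
    rcases hreach w (mem_hardJetVerts.2 (Or.inr ⟨j, hw⟩)) with h | h
    · exact ⟨v, hv, h⟩
    · exact (Reachable.jet_or_hard hw h).resolve_left fun h' => hj (jetVerts_unique h' hiJ)
  have hjeti : ∀ w ∈ jetVerts G R.mode i, ∃ u, (u ∈ hardVerts G R.mode ∨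
      u = G.leg (Sum.inl i)) ∧ Reachable (G.graph.restrict (hardJetPart G R.mode T)) w u := by
    intro w hw
    rcases hreach w (mem_hardJetVerts.2 (Or.inr ⟨i, hw⟩)) with h | h
    · exact ⟨v, Or.inl hv, h⟩
    · exact ⟨_, Or.inr rfl, h⟩
  have hcard := R.card_jet_of_deficit (T := T) {i} (fun l => by
    by_cases hl : l = i
    · subst hl
      simpa using R.ncard_le_of_jet_vertex hjeti
    · simpa [hl] using R.ncard_le_of_jet (hjet l hl)) (by rw [hd, hd']; simp)
  obtain ⟨h2, hn⟩ := R.jetTwoTree_of_reachable hiJ hjeti (by simpa using hcard i)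
  refine ⟨R.hardTree_of_deficit hT.2.1 hd, ⟨h2, some (G.leg (Sum.inl i)),
    ⟨_, hiJ.1, contractVertex_of_mem hiJ⟩, ?_⟩, fun j hj => R.jetTree_of_reachable (hjet j hj)
      (by simpa [hj] using (hcard j).symm), R.softTree_of_reachable
        (fun w hw => R.exists_hardJetVerts_of_twoTree hk hT hs hw) ?_⟩
  · ext l
    rw [mem_legsAt, Finset.mem_singleton]
    constructor
    · intro h
      by_contra hl
      rw [jetLeg_of_ne hl] at h
      exact hn h.symm
    · rintro rfl
      rw [jetLeg, contractVertex_of_mem hiJ]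
      exact Reachable.refl _ _
  · have := R.card_soft_of_twoTree hT
    rw [hd'] at this
    omega

omit [Finite V] [Fintype E] in
/-- In a spanning 2-tree of a contracted jet graph that isolates `p_i`, this momentum enters at
a vertex of the jet. -/
theorem leg_mem_jetVerts_of_flowsP (hk : WideAngleMomenta Q k) {i : Fin K}
    (h : FlowsP (jetTilde G R.mode i) (jetLeg G R.mode i) (part G R.mode (Mode.jet i) T) i) :
    G.leg (Sum.inl i) ∈ jetVerts G R.mode i ∧
      ¬ Reachable ((jetTilde G R.mode i).restrict (part G R.mode (Mode.jet i) T)) none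
        (some (G.leg (Sum.inl i))) := by
  obtain ⟨x, hx, hl⟩ := h
  have hxi : Reachable ((jetTilde G R.mode i).restrict (part G R.mode (Mode.jet i) T)) x
      (jetLeg G R.mode i (Sum.inl i)) := by
    rw [← mem_legsAt, hl]
    simp
  obtain ⟨l, hne⟩ := hk.exists_ne_inl i
  have hxl : ¬ Reachable ((jetTilde G R.mode i).restrict (part G R.mode (Mode.jet i) T)) x
      none := by
    rw [← jetLeg_of_ne (G := G) (μ := R.mode) hne, ← mem_legsAt, hl]
    simpa using hne
  have hmem : G.leg (Sum.inl i) ∈ jetVerts G R.mode i := by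
    by_contra hmem
    rw [jetLeg, contractVertex_of_notMem hmem] at hxi
    exact hxl hxi
  rw [jetLeg, contractVertex_of_mem hmem] at hxi
  exact ⟨hmem, fun h => hxl (hxi.trans h.symm)⟩

omit [Fintype E] in
/-- Two components within `H ∪ J` and a spanning tree of the contracted soft graph. -/
theorem isSpanningTwoTree_of_hardJet (hE : (T : Set E) ⊆ G.graph.edgeSet) {x y : V}
    (hx : x ∈ G.graph.vertexSet) (hy : y ∈ G.graph.vertexSet)
    (hc : ∀ v ∈ hardJetVerts G R.mode,
      Reachable (G.graph.restrict (hardJetPart G R.mode T)) v x ∨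
        Reachable (G.graph.restrict (hardJetPart G R.mode T)) v y)
    (hS : IsSpanningTree (softTilde G R.mode) (part G R.mode Mode.soft T))
    (hd : R.hardJetDeficit T = 1) :
    IsSpanningTwoTree G.graph T ∧ ¬ Reachable (G.graph.restrict T) x y := by
  refine isSpanningTwoTree_of_covers hE hx hy (fun v hv => ?_) ?_
  · obtain ⟨u, hu, hr⟩ := R.exists_hardJetVerts_of_softTree hS hv
    rcases hc u hu with h | h
    · exact ⟨x, by simp, (hr.trans (h.mono (hardJetPart_subset T))).symm⟩
    · exact ⟨y, by simp, (hr.trans (h.mono (hardJetPart_subset T))).symm⟩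
  · have h1 := R.ncard_eq_of_softTree hS
    have h2 := card_eq_hardJetPart_add (μ := R.mode) hE
    have h3 := ncard_vertexSet (G := G) (μ := R.mode)
    rw [hardJetDeficit] at hd
    omega

/-- Within `H ∪ J` everything is joined to `H` or to the end of `p_i`. The soft tree attaches each
soft vertex to `H ∪ J`, and the number of edges prevents it from joining the two components. -/
theorem flowsP_of_parts (hk : WideAngleMomenta Q k) (hE : (T : Set E) ⊆ G.graph.edgeSet)
    {i : Fin K} (hH : IsSpanningTree (hardGraph G R.mode) (part G R.mode Mode.hard T))
    (hi : IsSpanningTwoTree (jetTilde G R.mode i) (part G R.mode (Mode.jet i) T))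
    (hf : FlowsP (jetTilde G R.mode i) (jetLeg G R.mode i) (part G R.mode (Mode.jet i) T) i)
    (hJ : ∀ j, j ≠ i → IsSpanningTree (jetTilde G R.mode j) (part G R.mode (Mode.jet j) T))
    (hS : IsSpanningTree (softTilde G R.mode) (part G R.mode Mode.soft T)) :
    IsSpanningTwoTree G.graph T ∧ R.IsLeadingTwo Q k T ∧ FlowsP G.graph G.leg T i := by
  obtain ⟨v, hv⟩ := R.exists_mem_hardVerts
  obtain ⟨hiJ, hn⟩ := R.leg_mem_jetVerts_of_flowsP hk hf
  have hd := R.hardDeficit_of_hardTree hH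
  have hd' : R.hardJetDeficit T = 1 := by
    have h1 := hi.card
    rw [R.ncard_jetTilde] at h1
    rw [R.hardJetDeficit_eq, hd, Finset.sum_eq_single i]
    · omega
    · intro j _ hj
      rw [R.ncard_eq_of_jetTree (hJ j hj), sub_self]
    · simp
  have hjet : ∀ j, j ≠ i → ∀ w ∈ jetVerts G R.mode j,
      Reachable (G.graph.restrict (hardJetPart G R.mode T)) w v := by
    intro j hj w hw
    obtain ⟨u, hu, hr⟩ := R.exists_hardVerts_of_jetTree (hJ j hj) hw
    exact hr.trans (R.reachable_of_hardTree hH hu hv)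
  have hjeti : ∀ w ∈ jetVerts G R.mode i,
      Reachable (G.graph.restrict (hardJetPart G R.mode T)) w v ∨
        Reachable (G.graph.restrict (hardJetPart G R.mode T)) w (G.leg (Sum.inl i)) := by
    intro w hw
    have key : (∃ u ∈ hardVerts G R.mode,
        Reachable (G.graph.restrict (hardJetPart G R.mode T)) w u) ∨
          Reachable (G.graph.restrict (hardJetPart G R.mode T)) w (G.leg (Sum.inl i)) := by
      rcases hi.reachable_or (R.none_mem_jetTilde i)
        ⟨_, hiJ.1, contractVertex_of_mem hiJ⟩ ⟨w, hw.1, rfl⟩ hn with h | h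
      · exact Or.inl (exists_hardVerts_of_jetTilde hw h.symm)
      -- The lifted path either stays in the jet up to the end of `p_i`, or leaves the jet and then
      -- meets `H`.
      · rcases Reachable.lift_contract h.symm with ⟨u, hu, hr⟩ | ⟨u, hu, he, hr⟩
        · exact Or.inl ((Reachable.jet_or_hard hw
            (hr.mono (part_jet_subset_hardJetPart i T))).resolve_left hu)
        · rw [Option.some.injEq] at he
          exact Or.inr (he ▸ hr.mono (part_jet_subset_hardJetPart i T))
    rcases key with ⟨u, hu, hr⟩ | h
    · exact Or.inl (hr.trans (R.reachable_of_hardTree hH hu hv))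
    · exact Or.inr h
  obtain ⟨hT, hvp⟩ := R.isSpanningTwoTree_of_hardJet hE hv.1 hiJ.1 (fun w hw => by
    rcases mem_hardJetVerts.1 hw with h | ⟨j, h⟩
    · exact Or.inl (R.reachable_of_hardTree hH h hv)
    · by_cases hj : j = i
      · subst hj
        exact hjeti w h
      · exact Or.inl (hjet j hj w h)) hS hd'
  have hflow : FlowsP G.graph G.leg T i := by
    refine ⟨G.leg (Sum.inl i), hiJ.1, ?_⟩
    ext l
    rw [mem_legsAt, Finset.mem_singleton]
    constructor
    · intro h
      by_contra hl
      refine hvp (Reachable.trans ?_ h.symm)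
      rcases mem_hardJetVerts.1 (leg_mem_hardJetVerts (G := G) (μ := R.mode) l) with h1 | ⟨j, h1⟩
      · exact (R.reachable_of_hardTree hH hv h1).mono (hardJetPart_subset T)
      · refine ((hjet j ?_ _ h1).mono (hardJetPart_subset T)).symm
        rintro rfl
        exact hl (leg_eq_of_mem_jetVerts h1)
    · rintro rfl
      exact Reachable.refl _ _
  refine ⟨hT, (R.isLeadingTwo_iff hk hT).2 ⟨?_, ?_⟩, hflow⟩
  · rw [twoTreeInvariant_of_flowsP G.leg_mem hT hk hflow]
    exact hk.p_sq_ne_zero i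
  · rw [lamPower_of_flowsP hflow, hd, hd']
    norm_num

/-! #### Off-shell terms of the first type -/

omit [Finite V] [Fintype E] in
-- If soft edges joined the two components of `H ∪ J`, all external lines would be in one component
-- of `T`, and no momentum would flow.
theorem reachable_hardJetPart_of_flowsHard
    (hT' : IsSpanningTwoTree (hardJetGraph G R.mode) (hardJetPart G R.mode T))
    (hf : FlowsHard G.graph G.leg T) {x y : V} (hx : x ∈ hardJetVerts G R.mode)
    (hy : y ∈ hardJetVerts G R.mode) (h : Reachable (G.graph.restrict T) x y) :
    Reachable ((hardJetGraph G R.mode).restrict (hardJetPart G R.mode T)) x y := by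
  by_contra hn
  refine (hf x (hardJetVerts_subset hx)).2.1 (Finset.eq_univ_iff_forall.2 fun l => mem_legsAt.2 ?_)
  rcases hT'.reachable_or hx hy (leg_mem_hardJetVerts l) hn with h1 | h1
  · exact h1.of_hardJetGraph (hardJetPart_subset T)
  · exact h.trans (h1.of_hardJetGraph (hardJetPart_subset T))

omit [Finite V] [Fintype E] in
theorem legsAt_hardJet (h : ∀ x ∈ hardJetVerts G R.mode, ∀ y ∈ hardJetVerts G R.mode,
      Reachable (G.graph.restrict T) x y →
        Reachable ((hardJetGraph G R.mode).restrict (hardJetPart G R.mode T)) x y)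
    {x : V} (hx : x ∈ hardJetVerts G R.mode) :
    legsAt (hardJetGraph G R.mode) G.leg (hardJetPart G R.mode T) x =
      legsAt G.graph G.leg T x := by
  ext l
  rw [mem_legsAt, mem_legsAt]
  exact ⟨fun h => h.of_hardJetGraph (hardJetPart_subset T), h x hx _ (leg_mem_hardJetVerts l)⟩

omit [Finite V] in
theorem twoTreeInvariant_hardJet (hk : WideAngleMomenta Q k) (hT : IsSpanningTwoTree G.graph T)
    (hT' : IsSpanningTwoTree (hardJetGraph G R.mode) (hardJetPart G R.mode T))
    (hf : FlowsHard G.graph G.leg T) :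
    twoTreeInvariant Q k (hardJetGraph G R.mode) G.leg (hardJetPart G R.mode T) =
      twoTreeInvariant Q k G.graph G.leg T := by
  obtain ⟨v, hv⟩ := R.exists_mem_hardVerts
  have hvHJ : v ∈ hardJetVerts G R.mode := mem_hardJetVerts.2 (Or.inl hv)
  have h := R.legsAt_hardJet (fun x hx y hy => R.reachable_hardJetPart_of_flowsHard hT' hf hx hy)
    hvHJ
  rw [hT.twoTreeInvariant_eq G.leg_mem hk.conservation ⟨v, hv.1, rfl⟩,
    hT'.twoTreeInvariant_eq leg_mem_hardJetVerts hk.conservation ⟨v, hvHJ, h⟩]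

/-- Both deficits are `1`, so the forests `T ∩ H` and `T ∩ (H ∪ J)` have two components each. That
the jets remain joined to `H` is due to the off-shell flow. -/
theorem parts_of_flowsHard_one (hk : WideAngleMomenta Q k) (hT : IsSpanningTwoTree G.graph T)
    (hL : R.IsLeadingTwo Q k T) (hf : FlowsHard G.graph G.leg T) (hd : R.hardDeficit T = 1) :
    R.hardJetDeficit T = 1 ∧
    (IsSpanningTwoTree (hardJetGraph G R.mode) (hardJetPart G R.mode T) ∧
      FlowsHard (hardJetGraph G R.mode) G.leg (hardJetPart G R.mode T) ∧
      IsSpanningTwoTree (hardGraph G R.mode) (part G R.mode Mode.hard T) ∧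
      ∀ i, IsSpanningTree (jetTilde G R.mode i) (part G R.mode (Mode.jet i) T)) ∧
    IsSpanningTree (softTilde G R.mode) (part G R.mode Mode.soft T) := by
  obtain ⟨hs, hL⟩ := (R.isLeadingTwo_iff hk hT).1 hL
  have hd' : R.hardJetDeficit T = 1 := by
    rw [lamPower_of_flowsHard hf, hd] at hL
    push_cast at hL
    linarith
  have hT' : IsSpanningTwoTree (hardJetGraph G R.mode) (hardJetPart G R.mode T) := by
    refine isSpanningTwoTree_of_acyclic (hardJetPart_subset_edgeSet T) hT.2.1.hardJet ?_
    rw [hardJetGraph_vertexSet]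
    rw [hardJetDeficit] at hd'
    omega
  have hr := fun x hx y hy => R.reachable_hardJetPart_of_flowsHard hT' hf (x := x) (y := y) hx hy
  refine ⟨hd', ⟨hT', fun x hx => ?_, ?_, R.jetTree_of_sum ?_ (hd'.trans hd.symm)⟩,
    R.softTree_of_reachable (fun w hw => R.exists_hardJetVerts_of_twoTree hk hT hs hw) ?_⟩
  · rw [R.legsAt_hardJet hr hx]
    exact hf x (hardJetVerts_subset hx)
  · refine isSpanningTwoTree_of_acyclic (part_hard_subset_edgeSet T) hT.2.1.hard ?_
    rw [hardGraph_vertexSet]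
    rw [hardDeficit] at hd
    omega
  -- A vertex of `J_i` not joined to `H` has a component within `H ∪ J` that stays in `J_i`. Its
  -- component in `T` carries the same external lines, hence none or only `p_i`, and the flow is not
  -- off-shell.
  · intro i v hv
    by_contra hcon
    have hvHJ : v ∈ hardJetVerts G R.mode := mem_hardJetVerts.2 (Or.inr ⟨i, hv⟩)
    have hsub : legsAt G.graph G.leg T v ⊆ {Sum.inl i} := by
      intro l hl
      have h1 := (hr v hvHJ _ (leg_mem_hardJetVerts l) (mem_legsAt.1 hl)).of_hardJetGraph
        (subset_refl _)
      exact Finset.mem_singleton.2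
        (leg_eq_of_mem_jetVerts ((Reachable.jet_or_hard hv h1).resolve_right hcon))
    have hhard := hf v hv.1
    rcases Finset.subset_singleton_iff.1 hsub with h | h
    · exact hhard.1 h
    · exact hhard.2.2 ⟨i, Or.inl h⟩
  · have := R.card_soft_of_twoTree hT
    rw [hd'] at this
    omega

/-- Soft vertices are attached to the two components of `H ∪ J` without joining them, again by the
number of edges, so the external lines are distributed over the components of `T` as over those of
`H ∪ J`. -/
theorem flowsHard_of_hardJet (hk : WideAngleMomenta Q k) (hE : (T : Set E) ⊆ G.graph.edgeSet)
    (hT' : IsSpanningTwoTree (hardJetGraph G R.mode) (hardJetPart G R.mode T))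
    (hf' : FlowsHard (hardJetGraph G R.mode) G.leg (hardJetPart G R.mode T))
    (hH : IsSpanningTwoTree (hardGraph G R.mode) (part G R.mode Mode.hard T))
    (hS : IsSpanningTree (softTilde G R.mode) (part G R.mode Mode.soft T)) :
    IsSpanningTwoTree G.graph T ∧ R.IsLeadingTwo Q k T ∧ FlowsHard G.graph G.leg T ∧
      R.hardDeficit T = 1 ∧ R.hardJetDeficit T = 1 := by
  have hd : R.hardDeficit T = 1 := by
    have := hH.card
    rw [hardGraph_vertexSet] at this
    rw [hardDeficit]
    omega
  have hd' : R.hardJetDeficit T = 1 := by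
    have := hT'.card
    rw [hardJetGraph_vertexSet] at this
    rw [hardJetDeficit]
    omega
  have key : ∀ x ∈ hardJetVerts G R.mode, ∀ y ∈ hardJetVerts G R.mode,
      ¬ Reachable ((hardJetGraph G R.mode).restrict (hardJetPart G R.mode T)) x y →
        IsSpanningTwoTree G.graph T ∧ ¬ Reachable (G.graph.restrict T) x y := by
    intro x hx y hy hxy
    refine R.isSpanningTwoTree_of_hardJet hE (hardJetVerts_subset hx) (hardJetVerts_subset hy)
      (fun v hv => ?_) hS hd'
    exact (hT'.reachable_or hx hy hv hxy).imp (fun h => (h.of_hardJetGraph subset_rfl).symm)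
      (fun h => (h.of_hardJetGraph subset_rfl).symm)
  obtain ⟨-, -, x, hx, y, hy, hxy, -⟩ := id hT'
  obtain ⟨hT, -⟩ := key x hx y hy hxy
  have hf : FlowsHard G.graph G.leg T := by
    refine FlowsHard.of_isolates G.leg_mem hT ⟨x, hardJetVerts_subset hx, rfl⟩ ?_
    rw [← R.legsAt_hardJet (fun x hx y hy h => by_contra fun hn => (key x hx y hy hn).2 h) hx]
    exact hf' x hx
  refine ⟨hT, (R.isLeadingTwo_iff hk hT).2
    ⟨twoTreeInvariant_ne_zero_of_flowsHard G.leg_mem hT hk hf, ?_⟩, hf, hd, hd'⟩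
  rw [lamPower_of_flowsHard hf, hd, hd']
  norm_num

/-! #### Off-shell terms of the second type -/

/-- A leading term with an off-shell factor and a spanning tree of `H` is due to the momentum of
two jets. -/
theorem exists_jetPair (hk : WideAngleMomenta Q k) (hT : IsSpanningTwoTree G.graph T)
    (hL : R.IsLeadingTwo Q k T) (hf : FlowsHard G.graph G.leg T) (hd : R.hardDeficit T = 0) :
    R.hardJetDeficit T = 2 ∧ ∃ i j, i ≠ j ∧ FlowsPP G.graph G.leg T i j ∧
      (∀ l, (jetVerts G R.mode l).ncard =
        (part G R.mode (Mode.jet l) T).card + if l = i ∨ l = j then 1 else 0) ∧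
      (G.leg (Sum.inl i) ∈ jetVerts G R.mode i ∧ G.leg (Sum.inl j) ∈ jetVerts G R.mode j ∧
        ∀ u ∈ hardVerts G R.mode, ¬ Reachable (G.graph.restrict T) u (G.leg (Sum.inl i)) ∧
          ¬ Reachable (G.graph.restrict T) u (G.leg (Sum.inl j))) ∧
      (IsSpanningTwoTree (jetTilde G R.mode i) (part G R.mode (Mode.jet i) T) ∧
        IsSpanningTwoTree (jetTilde G R.mode j) (part G R.mode (Mode.jet j) T)) ∧
      ∀ l, l ≠ i → l ≠ j →
        IsSpanningTree (jetTilde G R.mode l) (part G R.mode (Mode.jet l) T) := by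
  obtain ⟨hs, hL⟩ := (R.isLeadingTwo_iff hk hT).1 hL
  have hd' : R.hardJetDeficit T = 2 := by
    rw [lamPower_of_flowsHard hf, hd] at hL
    push_cast at hL
    linarith
  obtain ⟨v, hv⟩ := R.exists_mem_hardVerts
  have hvHJ : v ∈ hardJetVerts G R.mode := mem_hardJetVerts.2 (Or.inl hv)
  obtain ⟨i, j, hij, hi, hj, hH⟩ := (R.flow_of_hardDeficit_eq_zero hk hT hs hd).resolve_left
    fun ⟨i, hi, _⟩ => hf.not_flowsP i hi
  obtain ⟨h2, h3, h4⟩ := R.eq_of_reachable_triple hv hij hi hj hH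
  have hreach : ∀ w ∈ hardJetVerts G R.mode,
      Reachable (G.graph.restrict (hardJetPart G R.mode T)) w v ∨
        Reachable (G.graph.restrict (hardJetPart G R.mode T)) w (G.leg (Sum.inl i)) ∨
        Reachable (G.graph.restrict (hardJetPart G R.mode T)) w (G.leg (Sum.inl j)) := by
    intro w hw
    obtain ⟨x, hx, hr⟩ := R.exists_reachable_of_hardJetDeficit hT.2.1 h3 h4
      (by rw [h2, hd']; rfl) hw
    simp only [Finset.mem_insert, Finset.mem_singleton] at hx
    rcases hx with rfl | rfl | rfl
    exacts [Or.inl hr.symm, Or.inr (Or.inl hr.symm), Or.inr (Or.inr hr.symm)]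
  -- Stated for variable `a` and `b` so that it serves both jets with the roles exchanged. A jet
  -- other than `b` reaches the end of `p_b` only through `H`.
  have hjet : ∀ a b, (∀ w ∈ hardJetVerts G R.mode,
      Reachable (G.graph.restrict (hardJetPart G R.mode T)) w v ∨
        Reachable (G.graph.restrict (hardJetPart G R.mode T)) w (G.leg (Sum.inl a)) ∨
        Reachable (G.graph.restrict (hardJetPart G R.mode T)) w (G.leg (Sum.inl b))) →
      G.leg (Sum.inl b) ∈ jetVerts G R.mode b → ∀ l, l ≠ b → ∀ w ∈ jetVerts G R.mode l,
      ∃ u, (u ∈ hardVerts G R.mode ∨ u = G.leg (Sum.inl a)) ∧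
        Reachable (G.graph.restrict (hardJetPart G R.mode T)) w u := by
    intro a b hab hb l hl w hw
    rcases hab w (mem_hardJetVerts.2 (Or.inr ⟨l, hw⟩)) with h | h | h
    · exact ⟨v, Or.inl hv, h⟩
    · exact ⟨_, Or.inr rfl, h⟩
    · obtain ⟨u, hu, hr⟩ := (Reachable.jet_or_hard hw h).resolve_left
        fun h' => hl (jetVerts_unique h' hb)
      exact ⟨u, Or.inl hu, hr⟩
  have hjeti := hjet i j hreach hj i hij
  have hjetj := hjet j i (fun w hw => (hreach w hw).imp_right Or.symm) hi j hij.symm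
  have hjetl : ∀ l, l ≠ i → l ≠ j → ∀ w ∈ jetVerts G R.mode l, ∃ u ∈ hardVerts G R.mode,
      Reachable (G.graph.restrict (hardJetPart G R.mode T)) w u := by
    intro l hli hlj w hw
    obtain ⟨u, hu | rfl, hr⟩ := hjet i j hreach hj l hlj w hw
    · exact ⟨u, hu, hr⟩
    · exact (Reachable.jet_or_hard hw hr).resolve_left fun h' => hli (jetVerts_unique h' hi)
  have hcard : ∀ l, (jetVerts G R.mode l).ncard =
      (part G R.mode (Mode.jet l) T).card + if l = i ∨ l = j then 1 else 0 := by
    have h := R.card_jet_of_deficit (T := T) {i, j} (fun l => by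
      by_cases hli : l = i
      · subst hli
        simpa using R.ncard_le_of_jet_vertex hjeti
      by_cases hlj : l = j
      · subst hlj
        simpa using R.ncard_le_of_jet_vertex hjetj
      simpa [hli, hlj] using R.ncard_le_of_jet (hjetl l hli hlj))
      (by rw [hd, hd', Finset.card_pair hij]; rfl)
    simpa using h
  refine ⟨hd', i, j, hij, ⟨G.leg (Sum.inl i), G.leg_mem _, ?_⟩, hcard, ⟨hi, hj, hH⟩,
    ⟨(R.jetTwoTree_of_reachable hi hjeti (by simpa using hcard i)).1,
      (R.jetTwoTree_of_reachable hj hjetj (by simpa using hcard j)).1⟩,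
    fun l hli hlj => R.jetTree_of_reachable (hjetl l hli hlj)
      (by simpa [hli, hlj] using (hcard l).symm)⟩
  ext l
  rw [mem_legsAt, Finset.mem_insert, Finset.mem_singleton]
  constructor
  · intro h
    rcases hreach _ (leg_mem_hardJetVerts l) with h1 | h1 | h1
    · exact absurd (h.trans (h1.mono (hardJetPart_subset T))).symm (hH v hv).1
    · have h5 := Reachable.jet_or_hard hi h1.symm
      refine Or.inl (leg_eq_of_mem_jetVerts (h5.resolve_right ?_))
      rintro ⟨u, hu, hr⟩
      exact (hH u hu).1 (hr.mono (hardJetPart_subset T)).symm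
    · have h5 := Reachable.jet_or_hard hj h1.symm
      refine Or.inr (leg_eq_of_mem_jetVerts (h5.resolve_right ?_))
      rintro ⟨u, hu, hr⟩
      exact (hH u hu).2 (hr.mono (hardJetPart_subset T)).symm
  · rintro (rfl | rfl)
    · exact Reachable.refl _ _
    -- Neither end is in the component of `H` and `T` has only two components, so the two jet ends
    -- are joined in `T`, although not within `H ∪ J`.
    · exact (hT.reachable_or hv.1 hi.1 hj.1 (hH v hv).1).resolve_left (hH v hv).2

/-- `exists_jetPair` supplies some pair of jets; it must be the given one, because the jets that
lack an edge are known from the counts. Contracting the component of `H` and counting edges gives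
the 2-tree of the contracted graph. -/
theorem parts_of_flowsPP (hk : WideAngleMomenta Q k) (hT : IsSpanningTwoTree G.graph T)
    (hL : R.IsLeadingTwo Q k T) (hf : FlowsHard G.graph G.leg T) {i j : Fin K} (hij : i ≠ j)
    (hd : R.hardDeficit T = 0) (hJ : ∀ l, ((jetVerts G R.mode l).ncard : ℤ) =
        (part G R.mode (Mode.jet l) T).card + if l = i ∨ l = j then 1 else 0) :
    IsSpanningTree (hardGraph G R.mode) (part G R.mode Mode.hard T) ∧
      (IsSpanningTwoTree (jetPairTilde G R.mode i j) (jetPairPart G R.mode i j T) ∧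
        FlowsPP (jetPairTilde G R.mode i j) (jetPairLeg G R.mode i j)
          (jetPairPart G R.mode i j T) i j ∧
        IsSpanningTwoTree (jetTilde G R.mode i) (part G R.mode (Mode.jet i) T) ∧
        IsSpanningTwoTree (jetTilde G R.mode j) (part G R.mode (Mode.jet j) T)) ∧
      ∀ l, l ≠ i → l ≠ j →
        IsSpanningTree (jetTilde G R.mode l) (part G R.mode (Mode.jet l) T) := by
  obtain ⟨hd', a, b, hab, -, hJ', ⟨ha, hb, hH⟩, ⟨h2a, h2b⟩, htree⟩ :=
    R.exists_jetPair hk hT hL hf hd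
  have hiff : ∀ l, (l = a ∨ l = b) ↔ (l = i ∨ l = j) := by
    intro l
    have h1 := hJ l
    have h2 := hJ' l
    split_ifs at h1 h2 with h3 h4 h4
    · exact iff_of_true h4 h3
    · omega
    · omega
    · exact iff_of_false h4 h3
  have hcases : (a = i ∧ b = j) ∨ (a = j ∧ b = i) := by
    rcases (hiff a).1 (Or.inl rfl) with h1 | h1 <;> rcases (hiff b).1 (Or.inr rfl) with h2 | h2
    · exact absurd (h1.trans h2.symm) hab
    · exact Or.inl ⟨h1, h2⟩
    · exact Or.inr ⟨h1, h2⟩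
    · exact absurd (h1.trans h2.symm) hab
  obtain ⟨hi, hj, hH, h2i, h2j⟩ : G.leg (Sum.inl i) ∈ jetVerts G R.mode i ∧
      G.leg (Sum.inl j) ∈ jetVerts G R.mode j ∧
      (∀ u ∈ hardVerts G R.mode, ¬ Reachable (G.graph.restrict T) u (G.leg (Sum.inl i)) ∧
          ¬ Reachable (G.graph.restrict T) u (G.leg (Sum.inl j))) ∧
      IsSpanningTwoTree (jetTilde G R.mode i) (part G R.mode (Mode.jet i) T) ∧
      IsSpanningTwoTree (jetTilde G R.mode j) (part G R.mode (Mode.jet j) T) := by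
    rcases hcases with ⟨rfl, rfl⟩ | ⟨rfl, rfl⟩
    · exact ⟨ha, hb, hH, h2a, h2b⟩
    · exact ⟨hb, ha, fun u hu => (hH u hu).symm, h2b, h2a⟩
  obtain ⟨v, hv⟩ := R.exists_mem_hardVerts
  have hvn := contractVertex_of_notMem (R.hardVerts_notMem_jetPairVerts hv i j)
  have hiP : G.leg (Sum.inl i) ∈ jetPairVerts G R.mode i j := Or.inl (Or.inl hi)
  have hjP : G.leg (Sum.inl j) ∈ jetPairVerts G R.mode i j := Or.inl (Or.inr hj)
  obtain ⟨h2, hn⟩ : IsSpanningTwoTree (jetPairTilde G R.mode i j) (jetPairPart G R.mode i j T) ∧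
      ¬ Reachable ((jetPairTilde G R.mode i j).restrict (jetPairPart G R.mode i j T)) none
        (some (G.leg (Sum.inl i))) := by
    refine isSpanningTwoTree_of_covers (jetPairPart_subset_edgeSet i j T)
      (R.none_mem_jetPairTilde i j) ⟨_, hi.1, contractVertex_of_mem hiP⟩ ?_ ?_
    · rintro _ ⟨w, hw, rfl⟩
      rcases hT.reachable_or hv.1 hi.1 hw (hH v hv).1 with h | h
      · refine ⟨none, by simp, ?_⟩
        have h1 := h.jetPairTilde (μ := R.mode) i j
        rwa [hvn] at h1
      · refine ⟨some (G.leg (Sum.inl i)), by simp, ?_⟩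
        have h1 := h.jetPairTilde (μ := R.mode) i j
        rwa [contractVertex_of_mem hiP] at h1
    -- The two jets lack one edge each and `S` has one edge too many; together with the auxiliary
    -- vertex this makes vertices exceed edges by `2`.
    · rw [R.ncard_jetPairTilde, ncard_jetPairVerts hij, card_jetPairPart hij]
      have h1 := hJ i
      have h2 := hJ j
      have h3 := R.card_soft_of_twoTree hT
      simp only [true_or, or_true, if_true] at h1 h2
      rw [hd'] at h3
      omega
  refine ⟨R.hardTree_of_deficit hT.2.1 hd, ⟨h2, ⟨some (G.leg (Sum.inl i)),
    ⟨_, hi.1, contractVertex_of_mem hiP⟩, ?_⟩, h2i, h2j⟩, fun l hli hlj => htree l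
      (fun h => by simpa [hli, hlj] using (hiff l).1 (Or.inl h))
      (fun h => by simpa [hli, hlj] using (hiff l).1 (Or.inr h))⟩
  ext l
  rw [mem_legsAt, Finset.mem_insert, Finset.mem_singleton]
  constructor
  · intro h
    by_contra! hl
    rw [jetPairLeg_of_ne hl.1 hl.2] at h
    exact hn h.symm
  · rintro (rfl | rfl)
    · rw [jetPairLeg, contractVertex_of_mem hiP]
      exact Reachable.refl _ _
    · have h1 := ((hT.reachable_or hv.1 hi.1 hj.1 (hH v hv).1).resolve_left
        (hH v hv).2).jetPairTilde (μ := R.mode) i j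
      rwa [contractVertex_of_mem hiP] at h1

omit [Finite V] [Fintype E] in
/-- In a spanning 2-tree of the contracted graph of two jets and `S` that isolates `p_i` and `p_j`,
these momenta enter at vertices of the jets. -/
theorem legs_mem_jetVerts_of_flowsPP (hk : WideAngleMomenta Q k) {i j : Fin K} (hij : i ≠ j)
    (h : FlowsPP (jetPairTilde G R.mode i j) (jetPairLeg G R.mode i j)
      (jetPairPart G R.mode i j T) i j) :
    (G.leg (Sum.inl i) ∈ jetVerts G R.mode i ∧ G.leg (Sum.inl j) ∈ jetVerts G R.mode j) ∧
    ¬ Reachable ((jetPairTilde G R.mode i j).restrict (jetPairPart G R.mode i j T)) none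
        (some (G.leg (Sum.inl i))) ∧
    Reachable ((jetPairTilde G R.mode i j).restrict (jetPairPart G R.mode i j T))
        (some (G.leg (Sum.inl j))) (some (G.leg (Sum.inl i))) := by
  obtain ⟨x, hx, hl⟩ := h
  have hxi : Reachable ((jetPairTilde G R.mode i j).restrict (jetPairPart G R.mode i j T)) x
      (jetPairLeg G R.mode i j (Sum.inl i)) := by
    rw [← mem_legsAt, hl]
    simp
  have hxj : Reachable ((jetPairTilde G R.mode i j).restrict (jetPairPart G R.mode i j T)) x
      (jetPairLeg G R.mode i j (Sum.inl j)) := by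
    rw [← mem_legsAt, hl]
    simp
  obtain ⟨l, hne, hne'⟩ := hk.exists_notMem_pair hij
  have hxl : ¬ Reachable ((jetPairTilde G R.mode i j).restrict (jetPairPart G R.mode i j T)) x
      none := by
    rw [← jetPairLeg_of_ne (G := G) (μ := R.mode) hne hne', ← mem_legsAt, hl]
    simp [hne, hne']
  have hmemi : G.leg (Sum.inl i) ∈ jetPairVerts G R.mode i j := by
    by_contra hmem
    rw [jetPairLeg, contractVertex_of_notMem hmem] at hxi
    exact hxl hxi
  have hmemj : G.leg (Sum.inl j) ∈ jetPairVerts G R.mode i j := by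
    by_contra hmem
    rw [jetPairLeg, contractVertex_of_notMem hmem] at hxj
    exact hxl hxj
  rw [jetPairLeg, contractVertex_of_mem hmemi] at hxi
  rw [jetPairLeg, contractVertex_of_mem hmemj] at hxj
  refine ⟨⟨?_, ?_⟩, fun h => hxl (hxi.trans h.symm), hxj.symm.trans hxi⟩
  · rcases hmemi with (h | h) | h
    · exact h
    · exact absurd (leg_eq_of_mem_jetVerts h) (by simpa using hij)
    · exact absurd h (leg_notMem_softVerts _)
  · rcases hmemj with (h | h) | h
    · exact absurd (leg_eq_of_mem_jetVerts h) (by simpa using hij.symm)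
    · exact h
    · exact absurd h (leg_notMem_softVerts _)

/-- The counts in the three 2-trees show that `S` has one edge more than vertices, so that `d' = 2`.
The components of the contracted 2-tree lift to those of `H` and of the ends of `p_i` and `p_j`,
since all that was contracted is joined to `H`. -/
theorem flowsPP_of_parts (hk : WideAngleMomenta Q k) (hE : (T : Set E) ⊆ G.graph.edgeSet)
    {i j : Fin K} (hij : i ≠ j)
    (hH : IsSpanningTree (hardGraph G R.mode) (part G R.mode Mode.hard T))
    (h2 : IsSpanningTwoTree (jetPairTilde G R.mode i j) (jetPairPart G R.mode i j T))
    (hf : FlowsPP (jetPairTilde G R.mode i j) (jetPairLeg G R.mode i j)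
      (jetPairPart G R.mode i j T) i j)
    (h2i : IsSpanningTwoTree (jetTilde G R.mode i) (part G R.mode (Mode.jet i) T))
    (h2j : IsSpanningTwoTree (jetTilde G R.mode j) (part G R.mode (Mode.jet j) T))
    (hJ : ∀ l, l ≠ i → l ≠ j →
      IsSpanningTree (jetTilde G R.mode l) (part G R.mode (Mode.jet l) T)) :
    IsSpanningTwoTree G.graph T ∧ R.IsLeadingTwo Q k T ∧ FlowsHard G.graph G.leg T ∧
      FlowsPP G.graph G.leg T i j ∧ R.hardDeficit T = 0 ∧
      (∀ l, ((jetVerts G R.mode l).ncard : ℤ) =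
        (part G R.mode (Mode.jet l) T).card + if l = i ∨ l = j then 1 else 0) ∧
      ((softVerts G R.mode).ncard : ℤ) = (part G R.mode Mode.soft T).card + -1 := by
  obtain ⟨v, hv⟩ := R.exists_mem_hardVerts
  obtain ⟨⟨hi, hj⟩, hn, hrji⟩ := R.legs_mem_jetVerts_of_flowsPP hk hij hf
  have hiP : G.leg (Sum.inl i) ∈ jetPairVerts G R.mode i j := Or.inl (Or.inl hi)
  have hjP : G.leg (Sum.inl j) ∈ jetPairVerts G R.mode i j := Or.inl (Or.inr hj)
  have hd := R.hardDeficit_of_hardTree hH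
  have hcard : ∀ l, ((jetVerts G R.mode l).ncard : ℤ) =
      (part G R.mode (Mode.jet l) T).card + if l = i ∨ l = j then 1 else 0 := by
    intro l
    by_cases hli : l = i
    · subst hli
      have := h2i.card
      rw [R.ncard_jetTilde] at this
      simp only [true_or, if_true]
      omega
    by_cases hlj : l = j
    · subst hlj
      have := h2j.card
      rw [R.ncard_jetTilde] at this
      simp only [or_true, if_true]
      omega
    simp [hli, hlj, R.ncard_eq_of_jetTree (hJ l hli hlj)]
  have hsoft : ((softVerts G R.mode).ncard : ℤ) = (part G R.mode Mode.soft T).card + -1 := by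
    have h1 := h2.card
    have h3 := hcard i
    have h4 := hcard j
    rw [R.ncard_jetPairTilde, ncard_jetPairVerts hij, card_jetPairPart hij] at h1
    simp only [true_or, or_true, if_true] at h3 h4
    omega
  have hd' : R.hardJetDeficit T = 2 := by
    have h1 : ∀ l, ((jetVerts G R.mode l).ncard : ℤ) - (part G R.mode (Mode.jet l) T).card =
        if l ∈ ({i, j} : Finset (Fin K)) then 1 else 0 := fun l => by
      rw [hcard l]
      simp
    rw [R.hardJetDeficit_eq, hd, Finset.sum_congr rfl fun l _ => h1 l]
    rw [Finset.sum_ite_mem, Finset.univ_inter, Finset.sum_const, Finset.card_pair hij]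
    rfl
  -- Arrival at the auxiliary vertex in the contracted graph thus means being joined to `v` in `G`.
  have hout : ∀ w ∈ G.graph.vertexSet, w ∉ jetPairVerts G R.mode i j →
      Reachable (G.graph.restrict T) w v := by
    intro w hw hwP
    rcases mem_verts_cases (μ := R.mode) hw with h | ⟨l, h⟩ | h
    · exact (R.reachable_of_hardTree hH h hv).mono (hardJetPart_subset T)
    · obtain ⟨u, hu, hr⟩ := R.exists_hardVerts_of_jetTree (hJ l
        (by rintro rfl; exact hwP (Or.inl (Or.inl h)))
        (by rintro rfl; exact hwP (Or.inl (Or.inr h)))) h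
      exact (hr.trans (R.reachable_of_hardTree hH hu hv)).mono (hardJetPart_subset T)
    · exact absurd (Or.inr h) hwP
  obtain ⟨hT, hvp⟩ : IsSpanningTwoTree G.graph T ∧
      ¬ Reachable (G.graph.restrict T) v (G.leg (Sum.inl i)) := by
    refine isSpanningTwoTree_of_covers hE hv.1 hi.1 (fun w hw => ?_) ?_
    · have hlift : ∀ z, Reachable ((jetPairTilde G R.mode i j).restrict
          (jetPairPart G R.mode i j T)) (contractVertex (jetPairVerts G R.mode i j) w) z →
          z = none ∨ z = some (G.leg (Sum.inl i)) →
            Reachable (G.graph.restrict T) w v ∨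
              Reachable (G.graph.restrict T) w (G.leg (Sum.inl i)) := by
        intro z hz hz'
        rcases Reachable.lift_contract hz with ⟨u, hu, hr⟩ | ⟨u, hu, rfl, hr⟩
        · exact Or.inl ((hr.mono (jetPairPart_subset i j T)).trans (hout u (hr.mem hw) hu))
        · simp only [reduceCtorEq, Option.some.injEq, false_or] at hz'
          exact Or.inr (hz' ▸ hr.mono (jetPairPart_subset i j T))
      have h3 : Reachable (G.graph.restrict T) w v ∨
          Reachable (G.graph.restrict T) w (G.leg (Sum.inl i)) := by
        rcases h2.reachable_or (R.none_mem_jetPairTilde i j)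
          ⟨_, hi.1, contractVertex_of_mem hiP⟩ ⟨w, hw, rfl⟩ hn with h | h
        · exact hlift _ h.symm (Or.inl rfl)
        · exact hlift _ h.symm (Or.inr rfl)
      rcases h3 with h | h
      · exact ⟨v, by simp, h.symm⟩
      · exact ⟨_, by simp, h.symm⟩
    · have h3 := card_eq_hardJetPart_add (μ := R.mode) hE
      have h4 := ncard_vertexSet (G := G) (μ := R.mode)
      rw [hardJetDeficit] at hd'
      omega
  have hflow : FlowsPP G.graph G.leg T i j := by
    refine ⟨G.leg (Sum.inl i), hi.1, ?_⟩
    ext l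
    rw [mem_legsAt, Finset.mem_insert, Finset.mem_singleton]
    constructor
    · intro h
      by_contra! hl
      refine hvp ((hout _ (G.leg_mem l) ?_).symm.trans h.symm)
      exact contractVertex_eq_none.1 (jetPairLeg_of_ne hl.1 hl.2)
    · rintro (rfl | rfl)
      · exact Reachable.refl _ _
      · rw [← contractVertex_of_mem hjP] at hrji
        -- If the path from the end of `p_j` left the two jets and `S`, its image would join the end
        -- of `p_i` to the auxiliary vertex, contrary to `hn`.
        rcases Reachable.lift_contract hrji with ⟨u, hu, hr⟩ | ⟨u, hu, he, hr⟩
        · have h3 := hr.jetPairTilde (μ := R.mode) i j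
          have h4 : jetPairPart G R.mode i j (jetPairPart G R.mode i j T) =
              jetPairPart G R.mode i j T := by
            rw [jetPairPart, jetPairPart, Finset.filter_filter]
            simp only [and_self]
          rw [contractVertex_of_notMem hu, h4] at h3
          exact absurd (h3.symm.trans hrji) hn
        · rw [Option.some.injEq] at he
          exact he ▸ (hr.mono (jetPairPart_subset i j T)).symm
  have hfh := FlowsHard.of_isolates G.leg_mem hT hflow (hk.p_mul_p_large i j hij)
  refine ⟨hT, (R.isLeadingTwo_iff hk hT).2
    ⟨twoTreeInvariant_ne_zero_of_flowsHard G.leg_mem hT hk hfh, ?_⟩, hfh, hflow, hd, hcard, hsoft⟩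
  rw [lamPower_of_flowsHard hfh, hd, hd']
  norm_num

end Region

namespace Region

variable {V E : Type*} {K N : ℕ} {G : ScatteringGraph V E K N} (R : Region G)

/-! ### Factorization -/

theorem disjoint_edgesOf {μ : E → Mode K} {m m' : Mode K} (h : m ≠ m') :
    Disjoint (edgesOf G μ m) (edgesOf G μ m') :=
  Set.disjoint_left.2 fun _ he he' => h (he.2.symm.trans he'.2)

theorem disjoint_edgesOf_jets {μ : E → Mode K} {m : Mode K} {s : Finset (Fin K)}
    (h : ∀ i ∈ s, m ≠ Mode.jet i) :
    Disjoint (edgesOf G μ m) (⋃ i ∈ s, edgesOf G μ (Mode.jet i)) := by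
  simp only [Set.disjoint_iUnion_right]
  exact fun i hi => disjoint_edgesOf (h i hi)

theorem hard_union_jets_union_soft {μ : E → Mode K} :
    edgesOf G μ Mode.hard ∪ (⋃ i ∈ Finset.univ, edgesOf G μ (Mode.jet i)) ∪
      edgesOf G μ Mode.soft = G.graph.edgeSet := by
  ext e
  simp only [Set.mem_union, Set.mem_iUnion, Finset.mem_univ, exists_prop, true_and, edgesOf,
    Set.mem_ofPred_eq]
  cases h : μ e <;> simp

theorem hard_union_jet_union_jets_union_soft {μ : E → Mode K} (i : Fin K) :
    edgesOf G μ Mode.hard ∪ edgesOf G μ (Mode.jet i) ∪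
      (⋃ j ∈ Finset.univ.erase i, edgesOf G μ (Mode.jet j)) ∪
      edgesOf G μ Mode.soft = G.graph.edgeSet := by
  ext e
  simp only [Set.mem_union, Set.mem_iUnion, Finset.mem_erase, Finset.mem_univ, and_true,
    exists_prop, edgesOf, Set.mem_ofPred_eq]
  cases h : μ e <;> simp
  tauto

theorem hardJetEdges_union_soft {μ : E → Mode K} :
    hardJetEdges G μ ∪ edgesOf G μ Mode.soft = G.graph.edgeSet := by
  ext e
  simp only [Set.mem_union, mem_hardJetEdges, edgesOf, Set.mem_ofPred_eq]
  tauto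

theorem hard_union_jetPair_union_jets {μ : E → Mode K} (i j : Fin K) :
    edgesOf G μ Mode.hard ∪ jetPairEdges G μ i j ∪
      (⋃ l ∈ (Finset.univ.erase i).erase j, edgesOf G μ (Mode.jet l)) = G.graph.edgeSet := by
  ext e
  simp only [Set.mem_union, Set.mem_iUnion, Finset.mem_erase, Finset.mem_univ, and_true,
    exists_prop, edgesOf, jetPairEdges, Set.mem_ofPred_eq]
  cases h : μ e <;> simp
  tauto

variable [Fintype E]

theorem UH_eq : R.UH = subsetSum (edgesOf G R.mode Mode.hard)
    (fun T => onlyIf (IsSpanningTree (hardGraph G R.mode) (part G R.mode Mode.hard T)) 1) := by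
  rw [UH, treePoly_eq_subsetSum, hardGraph_edgeSet, subsetSum_eq_filter]
  rfl

theorem UJ_eq (i : Fin K) : R.UJ i = subsetSum (edgesOf G R.mode (Mode.jet i))
    (fun T => onlyIf (IsSpanningTree (jetTilde G R.mode i) (part G R.mode (Mode.jet i) T)) 1) := by
  rw [UJ, treePoly_eq_subsetSum, jetTilde_edgeSet, subsetSum_eq_filter]
  rfl

theorem US_eq : R.US = subsetSum (edgesOf G R.mode Mode.soft)
    (fun T => onlyIf (IsSpanningTree (softTilde G R.mode) (part G R.mode Mode.soft T)) 1) := by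
  rw [US, treePoly_eq_subsetSum, softTilde_edgeSet, subsetSum_eq_filter]
  rfl

omit [Fintype E] in
theorem localOn_hard : LocalOn (edgesOf G R.mode Mode.hard)
    (fun T => onlyIf (IsSpanningTree (hardGraph G R.mode) (part G R.mode Mode.hard T)) 1) :=
  LocalOn.of_filter _ (fun T => onlyIf (IsSpanningTree (hardGraph G R.mode) T) 1)

omit [Fintype E] in
theorem localOn_jet (i : Fin K) : LocalOn (edgesOf G R.mode (Mode.jet i))
    (fun T => onlyIf (IsSpanningTree (jetTilde G R.mode i) (part G R.mode (Mode.jet i) T)) 1) :=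
  LocalOn.of_filter _ (fun T => onlyIf (IsSpanningTree (jetTilde G R.mode i) T) 1)

omit [Fintype E] in
theorem localOn_soft : LocalOn (edgesOf G R.mode Mode.soft)
    (fun T => onlyIf (IsSpanningTree (softTilde G R.mode) (part G R.mode Mode.soft T)) 1) :=
  LocalOn.of_filter _ (fun T => onlyIf (IsSpanningTree (softTilde G R.mode) T) 1)

theorem prod_UJ (s : Finset (Fin K)) :
    LocalOn (⋃ i ∈ s, edgesOf G R.mode (Mode.jet i)) (fun T => onlyIf (∀ i ∈ s,
      IsSpanningTree (jetTilde G R.mode i) (part G R.mode (Mode.jet i) T))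
        1) ∧
    ∏ i ∈ s, R.UJ i = subsetSum (⋃ i ∈ s, edgesOf G R.mode (Mode.jet i)) (fun T => onlyIf (∀ i ∈ s,
      IsSpanningTree (jetTilde G R.mode i) (part G R.mode (Mode.jet i) T))
        1) := by
  have h := LocalOn.prod_subsetSum s (fun i j hij => disjoint_edgesOf (G := G) (μ := R.mode)
    (m := Mode.jet i) (m' := Mode.jet j) (by simpa using hij)) R.localOn_jet
  simp only [prod_onlyIf_one] at h
  simp only [UJ_eq]
  exact h

variable {M : Type*} [AddCommGroup M] [Module ℝ M] {Q : QuadraticForm ℝ M} {k : Leg K N → M}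

variable [Finite V]

/-- Both sides are sums over all subsets of the edges of `G`, so only the coefficients of each `T`
have to be compared. The other factorizations are obtained in the same way. -/
theorem URegion_eq (hk : WideAngleMomenta Q k) :
    R.URegion Q k = R.UH * (∏ i, R.UJ i) * R.US := by
  obtain ⟨hl, hp⟩ := R.prod_UJ Finset.univ
  have hd : Disjoint (edgesOf G R.mode Mode.hard)
      (⋃ i ∈ Finset.univ, edgesOf G R.mode (Mode.jet i)) := disjoint_edgesOf_jets (by simp)
  rw [hp, R.UH_eq, R.US_eq, R.localOn_hard.subsetSum_mul hd hl,
    (R.localOn_hard.mul hl).subsetSum_mul ?_ R.localOn_soft, hard_union_jets_union_soft, URegion,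
    treeSum_eq_subsetSum]
  · refine subsetSum_congr fun T hE => ?_
    rw [onlyIf_mul, onlyIf_mul, mul_one, mul_one]
    refine onlyIf_congr ⟨?_, ?_⟩ fun _ => rfl
    · rintro ⟨hT, hL⟩
      obtain ⟨h1, h2⟩ := (R.isLeading_iff hk hT).1 hL
      obtain ⟨h3, h4, h5⟩ := R.parts_of_isSpanningTree hT h1 h2
      exact ⟨⟨h3, fun i _ => h4 i⟩, h5⟩
    · rintro ⟨⟨h3, h4⟩, h5⟩
      obtain ⟨hT, hd⟩ := R.isSpanningTree_of_parts hE h3 (fun i => h4 i (Finset.mem_univ i)) h5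
      exact ⟨hT, (R.isLeading_iff hk hT).2 hd⟩
  · exact Disjoint.union_left (disjoint_edgesOf (by simp))
      (disjoint_edgesOf_jets (by simp)).symm

theorem FpRegion_eq (hk : WideAngleMomenta Q k) (i : Fin K) : R.FpRegion Q k i =
    R.UH * R.FJ Q k i * (∏ j ∈ Finset.univ.erase i, R.UJ j) * R.US := by
  obtain ⟨hl, hp⟩ := R.prod_UJ (Finset.univ.erase i)
  have hJ : R.FJ Q k i = subsetSum (edgesOf G R.mode (Mode.jet i)) (fun T =>
      onlyIf (IsSpanningTwoTree (jetTilde G R.mode i) (part G R.mode (Mode.jet i) T) ∧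
        FlowsP (jetTilde G R.mode i) (jetLeg G R.mode i) (part G R.mode (Mode.jet i) T) i)
        (-twoTreeInvariant Q k (jetTilde G R.mode i) (jetLeg G R.mode i)
        (part G R.mode (Mode.jet i) T))) := by
    rw [FJ, twoTreeSum_eq_subsetSum, jetTilde_edgeSet, subsetSum_eq_filter]
    rfl
  have hlJ : LocalOn (edgesOf G R.mode (Mode.jet i)) (fun T =>
      onlyIf (IsSpanningTwoTree (jetTilde G R.mode i) (part G R.mode (Mode.jet i) T) ∧
        FlowsP (jetTilde G R.mode i) (jetLeg G R.mode i) (part G R.mode (Mode.jet i) T) i)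
        (-twoTreeInvariant Q k (jetTilde G R.mode i) (jetLeg G R.mode i)
        (part G R.mode (Mode.jet i) T))) :=
    LocalOn.of_filter _ (fun T => onlyIf (IsSpanningTwoTree (jetTilde G R.mode i) T ∧
        FlowsP (jetTilde G R.mode i) (jetLeg G R.mode i) T i)
        (-twoTreeInvariant Q k (jetTilde G R.mode i) (jetLeg G R.mode i) T))
  have hne : ∀ j ∈ Finset.univ.erase i, (Mode.jet i : Mode K) ≠ Mode.jet j := fun j hj h => by
    rw [Mode.jet.injEq] at h
    exact (Finset.mem_erase.1 hj).1 h.symm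
  rw [hp, R.UH_eq, R.US_eq, hJ, R.localOn_hard.subsetSum_mul ?_ hlJ,
    (R.localOn_hard.mul hlJ).subsetSum_mul ?_ hl,
    ((R.localOn_hard.mul hlJ).mul hl).subsetSum_mul ?_ R.localOn_soft,
    hard_union_jet_union_jets_union_soft, FpRegion, twoTreeSum_eq_subsetSum]
  · refine subsetSum_congr fun T hE => ?_
    simp only [onlyIf_mul, one_mul, mul_one]
    refine onlyIf_congr ⟨?_, ?_⟩ ?_
    · rintro ⟨hT, hL, hf⟩
      obtain ⟨h1, h2, h4, h5⟩ := R.parts_of_flowsP hk hT hL hf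
      exact ⟨⟨⟨h1, h2⟩, fun j hj => h4 j (Finset.mem_erase.1 hj).1⟩, h5⟩
    · rintro ⟨⟨⟨h1, h2, h3⟩, h4⟩, h5⟩
      exact R.flowsP_of_parts hk hE h1 h2 h3
        (fun j hj => h4 j (Finset.mem_erase.2 ⟨hj, Finset.mem_univ j⟩)) h5
    -- In `G` and in the contracted jet graph the invariant is the same `p_i ^ 2`.
    · rintro ⟨hT, hL, hf⟩
      obtain ⟨-, ⟨h2, h3⟩, -⟩ := R.parts_of_flowsP hk hT hL hf
      rw [twoTreeInvariant_of_flowsP G.leg_mem hT hk hf,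
        twoTreeInvariant_of_flowsP (jetLeg_mem i) h2 hk h3]
  · exact Disjoint.union_left (Disjoint.union_left (disjoint_edgesOf (by simp))
      (disjoint_edgesOf (by simp))) (disjoint_edgesOf_jets (by simp)).symm
  · exact Disjoint.union_left (disjoint_edgesOf_jets (by simp)) (disjoint_edgesOf_jets hne)
  · exact disjoint_edgesOf (by simp)

/-- The conditions on the numbers of parameters in a term of the first off-shell type. -/
theorem typeOne_iff (hk : WideAngleMomenta Q k) {T : Finset E} (hT : IsSpanningTwoTree G.graph T) :
    (R.IsLeadingTwo Q k T ∧ FlowsHard G.graph G.leg T ∧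
      nRemoved G R.mode Mode.hard T = R.loopsH + 1 ∧
      ∑ i, nRemoved G R.mode (Mode.jet i) T = ∑ i, R.loopsJ i ∧
      nRemoved G R.mode Mode.soft T = R.loopsS) ↔
    R.IsLeadingTwo Q k T ∧ FlowsHard G.graph G.leg T ∧ R.hardDeficit T = 1 := by
  rw [R.nRemoved_hard_iff]
  -- For a leading off-shell term the hard count decides alone: it makes the jet and soft parts
  -- spanning trees, which fixes the other counts.
  refine ⟨fun h => ⟨h.1, h.2.1, h.2.2.1⟩, fun ⟨h1, h2, h3⟩ => ⟨h1, h2, h3, ?_⟩⟩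
  obtain ⟨-, ⟨-, -, -, hJ⟩, hS⟩ := R.parts_of_flowsHard_one hk hT h1 h2 h3
  constructor
  · refine Finset.sum_congr rfl fun i _ => ?_
    have := (R.nRemoved_jet_iff (i := i) (c := 0) (T := T)).2
      (by rw [R.ncard_eq_of_jetTree (hJ i), add_zero])
    rwa [add_zero] at this
  · have := (R.nRemoved_soft_iff (c := 0) (T := T)).2
      (by rw [R.ncard_eq_of_softTree hS, add_zero])
    rwa [add_zero] at this

theorem FIRegion_eq_subsetSum (hk : WideAngleMomenta Q k) : R.FIRegion Q k =
    subsetSum G.graph.edgeSet (fun T => onlyIf (IsSpanningTwoTree G.graph T ∧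
      R.IsLeadingTwo Q k T ∧ FlowsHard G.graph G.leg T ∧ R.hardDeficit T = 1)
        (-twoTreeInvariant Q k G.graph G.leg T)) := by
  rw [FIRegion, twoTreeSum_eq_subsetSum]
  exact subsetSum_congr fun T _ =>
    onlyIf_congr (and_congr_right fun hT => R.typeOne_iff hk hT) fun _ => rfl

theorem FIRegion_eq (hk : WideAngleMomenta Q k) : R.FIRegion Q k = R.FHJ Q k * R.US := by
  have hF : R.FHJ Q k = subsetSum (hardJetEdges G R.mode) (fun T =>
      onlyIf (IsSpanningTwoTree (hardJetGraph G R.mode) (hardJetPart G R.mode T) ∧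
        FlowsHard (hardJetGraph G R.mode) G.leg (hardJetPart G R.mode T) ∧
        IsSpanningTwoTree (hardGraph G R.mode)
          (part G R.mode Mode.hard (hardJetPart G R.mode T)) ∧
        ∀ i, IsSpanningTree (jetTilde G R.mode i)
          (part G R.mode (Mode.jet i) (hardJetPart G R.mode T)))
        (-twoTreeInvariant Q k (hardJetGraph G R.mode) G.leg (hardJetPart G R.mode T))) := by
    rw [FHJ, twoTreeSum_eq_subsetSum, hardJetGraph_edgeSet, subsetSum_eq_filter]
    rfl
  have hl : LocalOn (hardJetEdges G R.mode) (fun T =>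
      onlyIf (IsSpanningTwoTree (hardJetGraph G R.mode) (hardJetPart G R.mode T) ∧
        FlowsHard (hardJetGraph G R.mode) G.leg (hardJetPart G R.mode T) ∧
        IsSpanningTwoTree (hardGraph G R.mode)
          (part G R.mode Mode.hard (hardJetPart G R.mode T)) ∧
        ∀ i, IsSpanningTree (jetTilde G R.mode i)
          (part G R.mode (Mode.jet i) (hardJetPart G R.mode T)))
        (-twoTreeInvariant Q k (hardJetGraph G R.mode) G.leg (hardJetPart G R.mode T))) :=
    LocalOn.of_filter _ (fun T => onlyIf (IsSpanningTwoTree (hardJetGraph G R.mode) T ∧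
        FlowsHard (hardJetGraph G R.mode) G.leg T ∧
        IsSpanningTwoTree (hardGraph G R.mode) (part G R.mode Mode.hard T) ∧
        ∀ i, IsSpanningTree (jetTilde G R.mode i) (part G R.mode (Mode.jet i) T))
        (-twoTreeInvariant Q k (hardJetGraph G R.mode) G.leg T))
  rw [hF, R.US_eq, hl.subsetSum_mul ?_ R.localOn_soft, hardJetEdges_union_soft,
    R.FIRegion_eq_subsetSum hk]
  · refine subsetSum_congr fun T hE => ?_
    simp only [part_hard_hardJetPart, part_jet_hardJetPart]
    simp only [onlyIf_mul, mul_one]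
    refine onlyIf_congr ⟨?_, ?_⟩ ?_
    · rintro ⟨hT, hL, hf, hd⟩
      exact (R.parts_of_flowsHard_one hk hT hL hf hd).2
    · rintro ⟨⟨h1, h2, h3, -⟩, h4⟩
      obtain ⟨h5, h6, h7, h8, -⟩ := R.flowsHard_of_hardJet hk hE h1 h2 h3 h4
      exact ⟨h5, h6, h7, h8⟩
    · rintro ⟨hT, hL, hf, hd⟩
      obtain ⟨-, h1, -⟩ := R.parts_of_flowsHard_one hk hT hL hf hd
      rw [R.twoTreeInvariant_hardJet hk hT h1.1 hf]
  · exact Set.disjoint_left.2 fun e he he' => (mem_hardJetEdges.1 he).2 he'.2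

/-- The conditions on the numbers of parameters in a term of the second off-shell type. -/
theorem typeTwo_iff {T : Finset E} {i j : Fin K} :
    (nRemoved G R.mode Mode.hard T = R.loopsH ∧
      (∀ l, nRemoved G R.mode (Mode.jet l) T = R.loopsJ l + if l = i ∨ l = j then 1 else 0) ∧
      nRemoved G R.mode Mode.soft T = R.loopsS - 1) ↔
    R.hardDeficit T = 0 ∧ (∀ l, ((jetVerts G R.mode l).ncard : ℤ) =
        (part G R.mode (Mode.jet l) T).card + if l = i ∨ l = j then 1 else 0) ∧
      ((softVerts G R.mode).ncard : ℤ) = (part G R.mode Mode.soft T).card + -1 := by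
  rw [← R.nRemoved_hard_iff (c := 0), ← R.nRemoved_soft_iff (c := -1), add_zero, ← sub_eq_add_neg]
  simp only [R.nRemoved_jet_iff]

theorem FIIRegion_eq (hk : WideAngleMomenta Q k) {i j : Fin K} (hij : i ≠ j) :
    R.FIIRegion Q k i j =
      R.UH * R.FJJS Q k i j * ∏ l ∈ (Finset.univ.erase i).erase j, R.UJ l := by
  obtain ⟨hl, hp⟩ := R.prod_UJ ((Finset.univ.erase i).erase j)
  have hF : R.FJJS Q k i j = subsetSum (jetPairEdges G R.mode i j) (fun T =>
      onlyIf (IsSpanningTwoTree (jetPairTilde G R.mode i j) (jetPairPart G R.mode i j T) ∧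
        FlowsPP (jetPairTilde G R.mode i j) (jetPairLeg G R.mode i j)
          (jetPairPart G R.mode i j T) i j ∧
        IsSpanningTwoTree (jetTilde G R.mode i)
          (part G R.mode (Mode.jet i) (jetPairPart G R.mode i j T)) ∧
        IsSpanningTwoTree (jetTilde G R.mode j)
          (part G R.mode (Mode.jet j) (jetPairPart G R.mode i j T)))
        (-twoTreeInvariant Q k (jetPairTilde G R.mode i j) (jetPairLeg G R.mode i j)
        (jetPairPart G R.mode i j T))) := by
    rw [FJJS, twoTreeSum_eq_subsetSum, jetPairTilde_edgeSet, subsetSum_eq_filter]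
    rfl
  have hlF : LocalOn (jetPairEdges G R.mode i j) (fun T =>
      onlyIf (IsSpanningTwoTree (jetPairTilde G R.mode i j) (jetPairPart G R.mode i j T) ∧
        FlowsPP (jetPairTilde G R.mode i j) (jetPairLeg G R.mode i j)
          (jetPairPart G R.mode i j T) i j ∧
        IsSpanningTwoTree (jetTilde G R.mode i)
          (part G R.mode (Mode.jet i) (jetPairPart G R.mode i j T)) ∧
        IsSpanningTwoTree (jetTilde G R.mode j)
          (part G R.mode (Mode.jet j) (jetPairPart G R.mode i j T)))
        (-twoTreeInvariant Q k (jetPairTilde G R.mode i j) (jetPairLeg G R.mode i j)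
        (jetPairPart G R.mode i j T))) :=
    LocalOn.of_filter _ (fun T => onlyIf (IsSpanningTwoTree (jetPairTilde G R.mode i j) T ∧
        FlowsPP (jetPairTilde G R.mode i j) (jetPairLeg G R.mode i j) T i j ∧
        IsSpanningTwoTree (jetTilde G R.mode i) (part G R.mode (Mode.jet i) T) ∧
        IsSpanningTwoTree (jetTilde G R.mode j) (part G R.mode (Mode.jet j) T))
        (-twoTreeInvariant Q k (jetPairTilde G R.mode i j) (jetPairLeg G R.mode i j) T))
  have hne : ∀ l ∈ (Finset.univ.erase i).erase j, l ≠ i ∧ l ≠ j := fun l hl =>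
    ⟨(Finset.mem_erase.1 (Finset.mem_erase.1 hl).2).1, (Finset.mem_erase.1 hl).1⟩
  rw [hp, R.UH_eq, hF, R.localOn_hard.subsetSum_mul ?_ hlF,
    (R.localOn_hard.mul hlF).subsetSum_mul ?_ hl, hard_union_jetPair_union_jets, FIIRegion,
    twoTreeSum_eq_subsetSum]
  · refine subsetSum_congr fun T hE => ?_
    simp only [part_left_jetPairPart, part_right_jetPairPart, R.typeTwo_iff]
    simp only [onlyIf_mul, one_mul, mul_one]
    refine onlyIf_congr ⟨?_, ?_⟩ ?_
    · rintro ⟨hT, hL, hf, -, hd, hJ, -⟩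
      obtain ⟨h1, h2, h3⟩ := R.parts_of_flowsPP hk hT hL hf hij hd hJ
      exact ⟨⟨h1, h2⟩, fun l hl => h3 l (hne l hl).1 (hne l hl).2⟩
    · rintro ⟨⟨h1, h2, h3, h4, h5⟩, h6⟩
      exact R.flowsPP_of_parts hk hE hij h1 h2 h3 h4 h5 fun l hli hlj =>
        h6 l (Finset.mem_erase.2 ⟨hlj, Finset.mem_erase.2 ⟨hli, Finset.mem_univ l⟩⟩)
    · rintro ⟨hT, hL, hf, hp, hd, hJ, -⟩
      obtain ⟨-, h2, -⟩ := R.parts_of_flowsPP hk hT hL hf hij hd hJ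
      rw [hT.twoTreeInvariant_eq G.leg_mem hk.conservation hp,
        h2.1.twoTreeInvariant_eq (jetPairLeg_mem i j) hk.conservation h2.2.1]
  · refine Disjoint.union_left (disjoint_edgesOf_jets (by simp)) (Disjoint.union_left
      (Disjoint.union_left (disjoint_edgesOf_jets ?_) (disjoint_edgesOf_jets ?_))
      (disjoint_edgesOf_jets (by simp)))
    · exact fun l hl h => (hne l hl).1 (by simpa using h.symm)
    · exact fun l hl h => (hne l hl).2 (by simpa using h.symm)
  · exact Disjoint.union_right (Disjoint.union_right (disjoint_edgesOf (by simp))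
      (disjoint_edgesOf (by simp))) (disjoint_edgesOf (by simp))

/-! ### Classification of the leading terms of `F` -/

/-- `T` belongs to a term of the second off-shell type, for the jets `i` and `j`. -/
def IsTypeTwo (T : Finset E) (i j : Fin K) : Prop :=
  FlowsPP G.graph G.leg T i j ∧ R.hardDeficit T = 0 ∧
    (∀ l, ((jetVerts G R.mode l).ncard : ℤ) =
      (part G R.mode (Mode.jet l) T).card + if l = i ∨ l = j then 1 else 0) ∧
    ((softVerts G R.mode).ncard : ℤ) = (part G R.mode Mode.soft T).card + -1

omit [Finite V] [Fintype E] in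
-- The jets that lack an edge determine the unordered pair, and the ordering does the rest. No term
-- is therefore counted twice in the double sum.
theorem IsTypeTwo.eq {T : Finset E} {i j i' j' : Fin K} (hij : j < i) (hij' : j' < i')
    (h : R.IsTypeTwo T i j) (h' : R.IsTypeTwo T i' j') : i = i' ∧ j = j' := by
  have hiff : ∀ l, (l = i ∨ l = j) ↔ (l = i' ∨ l = j') := by
    intro l
    have h1 := h.2.2.1 l
    have h2 := h'.2.2.1 l
    split_ifs at h1 h2 with h3 h4 h4
    · exact iff_of_true h3 h4
    · omega
    · omega
    · exact iff_of_false h3 h4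
  have h1 := (hiff i).1 (Or.inl rfl)
  have h2 := (hiff j).1 (Or.inr rfl)
  simp only [Fin.ext_iff, Fin.lt_def] at *
  omega

/-- The pair from `exists_jetPair` comes in no particular order; the flow and the counts are
symmetric in it, so the larger index can be put first. -/
theorem exists_isTypeTwo (hk : WideAngleMomenta Q k) {T : Finset E}
    (hT : IsSpanningTwoTree G.graph T) (hL : R.IsLeadingTwo Q k T)
    (hf : FlowsHard G.graph G.leg T) (hd : R.hardDeficit T = 0) :
    ∃ i j, j < i ∧ R.IsTypeTwo T i j := by
  obtain ⟨hd', i, j, hij, hp, hc, -⟩ := R.exists_jetPair hk hT hL hf hd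
  have hs : ((softVerts G R.mode).ncard : ℤ) = (part G R.mode Mode.soft T).card + -1 := by
    have := R.card_soft_of_twoTree hT
    rw [hd'] at this
    linarith
  rcases lt_or_gt_of_ne hij with h | h
  · refine ⟨j, i, h, ?_, hd, fun l => ?_, hs⟩
    · rw [FlowsPP, Finset.pair_comm]
      exact hp
    · rw [hc l]
      simp only [or_comm (a := l = j)]
      push_cast
      rfl
  · refine ⟨i, j, h, hp, hd, fun l => ?_, hs⟩
    rw [hc l]
    push_cast
    rfl

/-- Every leading term of `F` is of exactly one type. -/
theorem FRegion_eq (hk : WideAngleMomenta Q k) :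
    R.FRegion Q k = ∑ i, R.FpRegion Q k i + R.FIRegion Q k +
      ∑ i, ∑ j ∈ Finset.Iio i, R.FIIRegion Q k i j := by
  rw [FRegion, R.FIRegion_eq_subsetSum hk]
  simp only [FpRegion, FIIRegion, twoTreeSum_eq_subsetSum, R.typeTwo_iff, sum_subsetSum,
    subsetSum_add]
  refine subsetSum_congr fun T _ => ?_
  by_cases h : IsSpanningTwoTree G.graph T ∧ R.IsLeadingTwo Q k T
  swap
  · rw [onlyIf_neg h, onlyIf_neg (fun h' => h ⟨h'.1, h'.2.1⟩), Finset.sum_eq_zero, Finset.sum_eq_zero]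
    · simp
    · exact fun i _ => Finset.sum_eq_zero fun j _ => onlyIf_neg (fun h' => h ⟨h'.1, h'.2.1⟩) _
    · exact fun i _ => onlyIf_neg (fun h' => h ⟨h'.1, h'.2.1⟩) _
  rw [onlyIf_pos h]
  obtain ⟨hT, hL⟩ := h
  have hs := ((R.isLeadingTwo_iff hk hT).1 hL).1
  rcases hT.flowsP_or_flowsHard G.leg_mem hk.conservation hs with ⟨i, hi⟩ | hf
  · have hn : ¬ FlowsHard G.graph G.leg T := fun h => h.not_flowsP i hi
    rw [onlyIf_neg (fun h' => hn h'.2.2.1), Finset.sum_eq_single_of_mem i (Finset.mem_univ i),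
      onlyIf_pos ⟨hT, hL, hi⟩, Finset.sum_eq_zero]
    · simp
    · exact fun j _ => Finset.sum_eq_zero fun l _ => onlyIf_neg (fun h' => hn h'.2.2.1) _
    · exact fun j _ hj =>
        onlyIf_neg (fun h' => hj (FlowsP.unique G.leg_mem hT hk h'.2.2 hi)) _
  · rw [Finset.sum_eq_zero fun i _ => onlyIf_neg (fun h' => hf.not_flowsP i h'.2.2) _, zero_add]
    by_cases hd : R.hardDeficit T = 1
    · rw [onlyIf_pos ⟨hT, hL, hf, hd⟩, Finset.sum_eq_zero, add_zero]
      refine fun i _ => Finset.sum_eq_zero fun j _ => onlyIf_neg (fun h' => ?_) _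
      have := h'.2.2.2.2.1
      rw [hd] at this
      exact one_ne_zero this
    -- Without a power of `λ` from the kinematic factor, the deficits add up to `2` and `d' ≥ 1`, so
    -- `d` is `0` or `1`.
    · have hd0 : R.hardDeficit T = 0 := by
        have h0 := R.hardDeficit_nonneg hT.2.1
        have h1 := R.one_le_hardJetDeficit hk hT hs
        have h2 := ((R.isLeadingTwo_iff hk hT).1 hL).2
        rw [lamPower_of_flowsHard hf] at h2
        push_cast at h2
        omega
      obtain ⟨i, j, hji, hij⟩ := R.exists_isTypeTwo hk hT hL hf hd0
      rw [onlyIf_neg (fun h' => hd h'.2.2.2), zero_add,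
        Finset.sum_eq_single_of_mem i (Finset.mem_univ i),
        Finset.sum_eq_single_of_mem j (Finset.mem_Iio.2 hji), onlyIf_pos ⟨hT, hL, hf, hij⟩]
      · exact fun l hl hne => onlyIf_neg (fun h' =>
          hne (IsTypeTwo.eq R (Finset.mem_Iio.1 hl) hji h'.2.2.2 hij).2) _
      · exact fun i' _ hne => Finset.sum_eq_zero fun l hl => onlyIf_neg (fun h' =>
          hne (IsTypeTwo.eq R (Finset.mem_Iio.1 hl) hji h'.2.2.2 hij).1) _

end Region

end WideAngle

theorem theorem2 {V E : Type*} [Finite V] [Fintype E] {K N : ℕ}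
    {M : Type*} [AddCommGroup M] [Module ℝ M] (Q : QuadraticForm ℝ M)
    (k : WideAngle.Leg K N → M) (hk : WideAngle.WideAngleMomenta Q k)
    (G : WideAngle.ScatteringGraph V E K N) (R : WideAngle.Region G) :
    R.P0 Q k = R.URegion Q k + R.FRegion Q k ∧
    R.FRegion Q k = ∑ i, R.FpRegion Q k i + R.FIRegion Q k +
      ∑ i, ∑ j ∈ Finset.Iio i, R.FIIRegion Q k i j ∧
    R.URegion Q k = R.UH * (∏ i, R.UJ i) * R.US ∧
    (∀ i, R.FpRegion Q k i =
      R.UH * R.FJ Q k i * (∏ j ∈ Finset.univ.erase i, R.UJ j) * R.US) ∧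
    R.FIRegion Q k = R.FHJ Q k * R.US ∧
    (∀ i j, j < i → R.FIIRegion Q k i j =
      R.UH * R.FJJS Q k i j * ∏ l ∈ (Finset.univ.erase i).erase j, R.UJ l) :=
  ⟨R.P0_eq Q k, R.FRegion_eq hk, R.URegion_eq hk, R.FpRegion_eq hk, R.FIRegion_eq hk,
    fun _ _ hij => R.FIIRegion_eq hk hij.ne'⟩
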